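/- **Notation.** A strict partition $\lambda=(\lambda_1>\dots>\lambda_l>0)$ of $n$ is a partition of $n$ with pairwise distinct parts ($n\ge 0$, the empty partition is allowed). Let $P_\lambda$ be Schur's $P$-function (the Hall–Littlewood function at $t=-1$) and $p_\rho=p_{\rho_1}p_{\rho_2}\cdots$ the power-sum symmetric function. For a partition $\rho$ of $n$ into odd parts, the numbers $X^\lambda_\rho$ are defined by $p_\rho=\sum_{\lambda}X^\lambda_\rho P_\lambda$ (sum over the strict partitions $\lambda$ of $n$), and $g^\lambda=X^\lambda_{(1^n)}$. For odd $m\ge 1$ and a strict partition $\lambda$ of $n$, the spin character is $$\mathfrak p_m(\lambda)=n(n-1)\cdots(n-m+1)\,\frac{X^\lambda_{(m,1^{n-m})}}{g^\lambda}\quad\text{if } m\le n,\qquad \mathfrak p_m(\lambda)=0\quad\text{if } m>n.$$ The symmetrized double diagram $\mathtt D(\lambda)$ is the diagram in the Russian convention whose upper boundary $\omega$ is the even function which, on $u>0$, has slope $-1$ on the intervals $(\lambda_i-\tfrac12,\lambda_i+\tfrac12)$ $(1\le i\le l)$ and slope $1$ elsewhere, and which equals $|u|$ for large $|u|$. Let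 $U$ be the set of local minima of $\omega$ and $V$ the set of its local maxima. The transition measure $\mathfrak m_{\mathtt D(\lambda)}$ is the probability measure on $\mathbb R$, supported by $U$, with Cauchy transform $$\int_{\mathbb R}\frac{\mathfrak m_{\mathtt D(\lambda)}(dx)}{z-x}=\frac{\prod_{y\in V}(z-y)}{\prod_{x\in U}(z-x)}.$$ Let $\mathtt R_k(\lambda)=\tfrac12R_k[\mathfrak m_{\mathtt D(\lambda)}]$ $(k\ge1)$, where the free cumulants $R_k[\mu]$ of a compactly supported probability measure $\mu$ are determined by $\int x^k\,\mu(dx)=\sum_{\pi}\prod_{B\in\pi}R_{|B|}[\mu]$ $(k\ge1)$, the sum being over the noncrossing partitions $\pi$ of $\{1,\dots,k\}$. **Proposition.** For each $k=1,2,3,\dots$ there is a polynomial $Q_k$ in $k-1$ variables with rational coefficients such that, for every strict partition $\lambda$, $$\mathfrak p_{2k-1}(\lambda)=\mathtt R_{2k}(\lambda)+Q_k\big(\mathtt R_2(\lambda),\mathtt R_4(\lambda),\dots,\mathtt R_{2k-2}(\lambda)\big).$$ In particular $\mathfrak p_{2k-1}$ is a polynomial in $\mathtt R_2,\mathtt R_4,\dots,\mathtt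 R_{2k}$. -/

import Mathlib

open MeasureTheory

/-! ### Strict partitions -/

/-- Strict partitions of `n`: the parts are pairwise distinct. -/
abbrev StrictPartition (n : ℕ) : Type := {lam : n.Partition // lam.parts.Nodup}

namespace StrictPartition

variable {n : ℕ}

/-- The length `ℓ(λ)`. -/
def length (lam : StrictPartition n) : ℕ := lam.1.parts.card

/-- The `i`-th largest part (counted from `0`), which is `0` for `i ≥ ℓ(λ)`. -/
def part (lam : StrictPartition n) (i : ℕ) : ℕ :=
  (lam.1.parts.sort (fun a b => b ≤ a)).getD i 0

/-- The set of (nonzero) parts. -/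
def partSet (lam : StrictPartition n) : Finset ℕ := lam.1.parts.toFinset

theorem zero_notMem_partSet (lam : StrictPartition n) : 0 ∉ lam.partSet := by
  intro h
  have h1 : 0 ∈ lam.1.parts := by simpa [partSet] using h
  exact absurd (lam.1.parts_pos h1) (lt_irrefl 0)

end StrictPartition

/-! ### Schur `P`-functions and spin characters -/

noncomputable section

/-- The variable `x_i`, as an element of the field `ℚ(x_1, …, x_N)`. -/
def schurVar (N : ℕ) (i : Fin N) : FractionRing (MvPolynomial (Fin N) ℚ) :=
  algebraMap (MvPolynomial (Fin N) ℚ) _ (MvPolynomial.X i)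

/-- Schur's `P`-function `P_λ(x_1, …, x_N)` of a strict partition `λ`, that is, the Hall-Littlewood
function `P_λ(x_1, …, x_N; t)` at `t = -1`:
`(1 / (N - ℓ(λ))!) ∑_{w ∈ S_N} w (∏_i x_i ^ λ_i · ∏_{λ_i > λ_j} (x_i + x_j) / (x_i - x_j))`
if `ℓ(λ) ≤ N`, and `0` otherwise. -/
def schurP {n : ℕ} (lam : StrictPartition n) (N : ℕ) :
    FractionRing (MvPolynomial (Fin N) ℚ) :=
  if lam.length ≤ N then
    (((N - lam.length).factorial : ℕ) : FractionRing (MvPolynomial (Fin N) ℚ))⁻¹ *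
      ∑ w : Equiv.Perm (Fin N),
        (∏ i : Fin N, schurVar N (w i) ^ lam.part i) *
        ∏ p : Fin N × Fin N with lam.part p.2 < lam.part p.1,
          (schurVar N (w p.1) + schurVar N (w p.2)) / (schurVar N (w p.1) - schurVar N (w p.2))
  else 0

/-- `c` is a family of coefficients with `p_ρ = ∑_λ c_λ P_λ`, where `λ` runs over the strict
partitions of `n = |ρ|`. An identity of symmetric functions in infinitely many variables means the
identity in `N` variables for every `N`. -/
def IsSchurPExpansion {n : ℕ} (ρ : n.Partition) (c : StrictPartition n → ℚ) : Prop :=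
  ∀ N : ℕ,
    algebraMap (MvPolynomial (Fin N) ℚ) (FractionRing (MvPolynomial (Fin N) ℚ))
        (MvPolynomial.psumPart (Fin N) ℚ ρ) =
      ∑ lam : StrictPartition n,
        algebraMap ℚ (FractionRing (MvPolynomial (Fin N) ℚ)) (c lam) * schurP lam N

open Classical in
/-- `X^λ_ρ`: the coefficient of `P_λ` in the expansion of `p_ρ`. (For an odd partition `ρ` this
expansion exists and is unique; the value is `0` by convention for a `ρ` without one.) -/
def spinX {n : ℕ} (lam : StrictPartition n) (ρ : n.Partition) : ℚ :=
  if h : ∃! c : StrictPartition n → ℚ, IsSchurPExpansion ρ c then h.exists.choose lam else 0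

/-- The partition `ρ ∪ (1^{n-k})` of `n`, for a partition `ρ` of `k ≤ n`. -/
def padOnes {k n : ℕ} (ρ : k.Partition) (h : k ≤ n) : n.Partition where
  parts := ρ.parts + Multiset.replicate (n - k) 1
  parts_pos := by
    intro i hi
    rcases Multiset.mem_add.1 hi with hi | hi
    · exact ρ.parts_pos hi
    · rw [Multiset.eq_of_mem_replicate hi]; exact Nat.one_pos
  parts_sum := by
    rw [Multiset.sum_add, ρ.parts_sum, Multiset.sum_replicate, smul_eq_mul, mul_one]
    exact Nat.add_sub_cancel' h

/-- `g^λ = X^λ_{(1^n)}`. -/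
def spinG {n : ℕ} (lam : StrictPartition n) : ℚ :=
  spinX lam (padOnes (Nat.Partition.indiscrete 0) (Nat.zero_le n))

/-- The spin character
`𝔭_ρ(λ) = n (n - 1) ⋯ (n - k + 1) X^λ_{ρ ∪ (1^{n-k})} / g^λ` if `k ≤ n`, and `0` if `k > n`,
where `ρ` is an (odd) partition of `k` and `λ` a strict partition of `n`. -/
def spinCharacter {k n : ℕ} (ρ : k.Partition) (lam : StrictPartition n) : ℚ :=
  if h : k ≤ n then (n.descFactorial k : ℚ) * spinX lam (padOnes ρ h) / spinG lam else 0

/-! ### Free cumulants -/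

/-- A partition of `{0, …, n-1}` is noncrossing if there are no `a < b < c < d` with `a, c` in one
block and `b, d` in another one. -/
def IsNoncrossing {n : ℕ} (π : Finpartition (Finset.univ : Finset (Fin n))) : Prop :=
  ∀ B ∈ π.parts, ∀ C ∈ π.parts, ∀ a ∈ B, ∀ b ∈ C, ∀ c ∈ B, ∀ d ∈ C,
    a < b → b < c → c < d → B = C

open Classical in
/-- The free cumulants of a moment sequence `M`, determined recursively by the free
cumulant-moment formula `M_n = ∑_{π ∈ NC(n)} ∏_{B ∈ π} R_{|B|}` for `n ≥ 1`
(see `moment_eq_sum_freeCumulantOfMoments`): the only noncrossing partition that has a block of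
size `n` is the partition with one block. -/
def freeCumulantOfMoments (M : ℕ → ℝ) (n : ℕ) : ℝ :=
  M n - ∑ π : {π : Finpartition (Finset.univ : Finset (Fin n)) //
      IsNoncrossing π ∧ ∀ B ∈ π.parts, B.card < n},
    ∏ B : {B // B ∈ π.1.parts}, freeCumulantOfMoments M B.1.card
termination_by n
decreasing_by exact π.2.2 B.1 B.2

open Classical in
theorem moment_eq_sum_freeCumulantOfMoments (M : ℕ → ℝ) (n : ℕ) (hn : 1 ≤ n) :
    M n = ∑ π : Finpartition (Finset.univ : Finset (Fin n)) with IsNoncrossing π,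
      ∏ B ∈ π.parts, freeCumulantOfMoments M B.card := by
  have : NeZero n := ⟨by omega⟩
  have hne : (Finset.univ : Finset (Fin n)) ≠ ⊥ := Finset.univ_nonempty.ne_empty
  set T : Finpartition (Finset.univ : Finset (Fin n)) := Finpartition.indiscrete hne with hT
  have hTparts : T.parts = {Finset.univ} := rfl
  have hTnc : IsNoncrossing T := by
    intro B hB C hC
    rw [hTparts, Finset.mem_singleton] at hB hC
    intros
    rw [hB, hC]
  have key : ∀ π : Finpartition (Finset.univ : Finset (Fin n)),
      (∀ B ∈ π.parts, B.card < n) ↔ π ≠ T := by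
    intro π
    constructor
    · rintro h rfl
      have := h Finset.univ (by rw [hTparts]; simp)
      simp at this
    · intro h B hB
      by_contra hlt
      have hBu : B = Finset.univ := by
        apply (Finset.card_eq_iff_eq_univ B).1
        have := Finset.card_le_univ B
        simp only [Fintype.card_fin] at this ⊢
        omega
      apply h
      ext1
      rw [hTparts]
      ext C
      rw [Finset.mem_singleton]
      constructor
      · intro hC
        by_contra hCB
        have hd := π.disjoint hC hB (by rw [hBu]; exact hCB)
        have hd2 : Disjoint C Finset.univ := by rw [← hBu]; exact hd
        have hC0 : C = ∅ := hd2.eq_bot_of_le (Finset.subset_univ C)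
        exact π.ne_bot hC hC0
      · intro hCu
        rw [hCu]
        exact hBu ▸ hB
  rw [← Finset.add_sum_erase _ _ (show T ∈ Finset.univ.filter IsNoncrossing by simp [hTnc]),
    hTparts, Finset.prod_singleton, Finset.card_univ, Fintype.card_fin]
  conv_rhs => rw [freeCumulantOfMoments]
  rw [sub_add_eq_add_sub, eq_comm, sub_eq_iff_eq_add, add_right_inj]
  rw [← Finset.sum_subtype (((Finset.univ.filter IsNoncrossing).erase T))
    (p := fun π => IsNoncrossing π ∧ ∀ B ∈ π.parts, B.card < n)
    (f := fun π => ∏ B : {B // B ∈ π.parts}, freeCumulantOfMoments M B.1.card)]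
  · apply Finset.sum_congr rfl
    intro π _
    exact (Finset.prod_coe_sort π.parts (fun B => freeCumulantOfMoments M B.card)).symm
  · intro π
    rw [Finset.mem_erase, Finset.mem_filter, key]
    simp [and_comm]

/-- The free cumulants `R_n[μ]` of a (compactly supported probability) measure `μ` on `ℝ`. -/
def freeCumulant (μ : Measure ℝ) (n : ℕ) : ℝ :=
  freeCumulantOfMoments (fun k => ∫ x, x ^ k ∂μ) n

/-! ### Symmetrized double diagrams and their transition measures -/

/-- The upper boundary, in the Russian convention, of the symmetrized double diagram of the strict
partition whose set of parts is `S`: an even function with slope `-1` on the intervals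
`[a - 1/2, a + 1/2]`, `a ∈ S`, with slope `1` elsewhere on the positive half-line, and equal to
`|u|` for large `|u|`. On `u ≥ 0` it bounds the shifted diagram translated by `(1/2, 1/2)`. -/
def symContour (S : Finset ℕ) (u : ℝ) : ℝ :=
  |u| + 2 * ∑ a ∈ S, max 0 (min 1 ((a : ℝ) + 1 / 2 - |u|))

/-- The local minima `0, ±𝚡_1, …, ±𝚡_m` of the boundary (see `isLocalMin_symContour_iff`). -/
def symMinima (S : Finset ℕ) : Finset ℝ :=
  {0} ∪ (S.filter fun a => a + 1 ∉ S).image (fun a : ℕ => (a : ℝ) + 1 / 2) ∪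
    (S.filter fun a => a + 1 ∉ S).image (fun a : ℕ => -((a : ℝ) + 1 / 2))

/-- The local maxima `±𝚢_1, …, ±𝚢_m` of the boundary (see `isLocalMax_symContour_iff`). -/
def symMaxima (S : Finset ℕ) : Finset ℝ :=
  (S.filter fun a => a - 1 ∉ S).image (fun a : ℕ => (a : ℝ) - 1 / 2) ∪
    (S.filter fun a => a - 1 ∉ S).image (fun a : ℕ => -((a : ℝ) - 1 / 2))

/-- The sum of a function over the minima minus its sum over the maxima. -/
theorem sum_symMinima_sub_sum_symMaxima {G : Type*} [AddCommGroup G] (S : Finset ℕ) (hS : 0 ∉ S)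
    (f : ℝ → G) :
    ∑ x ∈ symMinima S, f x - ∑ y ∈ symMaxima S, f y =
      f 0 + ∑ a ∈ S, (f ((a : ℝ) + 1 / 2) + f (-((a : ℝ) + 1 / 2)) -
        f ((a : ℝ) - 1 / 2) - f (-((a : ℝ) - 1 / 2))) := by
  have pos : ∀ a ∈ S, (1 : ℝ) ≤ a := by
    intro a ha
    have : a ≠ 0 := fun h => hS (h ▸ ha)
    exact_mod_cast Nat.one_le_iff_ne_zero.2 this
  have hmin : ∑ x ∈ symMinima S, f x = f 0 +
      ∑ a ∈ S with a + 1 ∉ S, (f ((a : ℝ) + 1 / 2) + f (-((a : ℝ) + 1 / 2))) := by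
    rw [symMinima, Finset.sum_union, Finset.sum_union, Finset.sum_singleton,
      Finset.sum_image, Finset.sum_image, Finset.sum_add_distrib, add_assoc]
    · intro a _ b _ h
      have : (a : ℝ) = b := by simpa using h
      exact_mod_cast this
    · intro a _ b _ h
      have : (a : ℝ) = b := by simpa using h
      exact_mod_cast this
    · rw [Finset.disjoint_left]
      intro x hx hx2
      simp only [Finset.mem_singleton] at hx
      obtain ⟨a, -, h⟩ := Finset.mem_image.1 hx2
      have : (0 : ℝ) ≤ a := a.cast_nonneg
      linarith
    · rw [Finset.disjoint_left]
      intro x hx hx2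
      obtain ⟨b, -, hb⟩ := Finset.mem_image.1 hx2
      have h2 : (0 : ℝ) ≤ b := b.cast_nonneg
      rcases Finset.mem_union.1 hx with hx | hx
      · simp only [Finset.mem_singleton] at hx
        linarith
      · obtain ⟨a, -, h⟩ := Finset.mem_image.1 hx
        have : (0 : ℝ) ≤ a := a.cast_nonneg
        linarith
  have hmax : ∑ x ∈ symMaxima S, f x =
      ∑ a ∈ S with a - 1 ∉ S, (f ((a : ℝ) - 1 / 2) + f (-((a : ℝ) - 1 / 2))) := by
    rw [symMaxima, Finset.sum_union, Finset.sum_image, Finset.sum_image, Finset.sum_add_distrib]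
    · intro a _ b _ h
      have : (a : ℝ) = b := by simpa using h
      exact_mod_cast this
    · intro a _ b _ h
      have : (a : ℝ) = b := by simpa using h
      exact_mod_cast this
    · rw [Finset.disjoint_left]
      intro x hx hx2
      obtain ⟨a, ha, h⟩ := Finset.mem_image.1 hx
      obtain ⟨b, hb, h2⟩ := Finset.mem_image.1 hx2
      have := pos a (Finset.mem_filter.1 ha).1
      have := pos b (Finset.mem_filter.1 hb).1
      linarith
  have hcomm : ∑ a ∈ S with a + 1 ∈ S, (f ((a : ℝ) + 1 / 2) + f (-((a : ℝ) + 1 / 2))) =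
      ∑ a ∈ S with a - 1 ∈ S, (f ((a : ℝ) - 1 / 2) + f (-((a : ℝ) - 1 / 2))) := by
    refine Finset.sum_bij' (fun a _ => a + 1) (fun a _ => a - 1) ?_ ?_ ?_ ?_ ?_
    · intro a ha
      simp only [Finset.mem_filter] at ha ⊢
      exact ⟨ha.2, by simpa using ha.1⟩
    · intro a ha
      simp only [Finset.mem_filter] at ha ⊢
      have h0 : a ≠ 0 := fun h => hS (h ▸ ha.1)
      refine ⟨ha.2, ?_⟩
      rw [Nat.sub_add_cancel (Nat.one_le_iff_ne_zero.2 h0)]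
      exact ha.1
    · intro a _
      simp
    · intro a ha
      simp only [Finset.mem_filter] at ha
      have h0 : a ≠ 0 := fun h => hS (h ▸ ha.1)
      exact Nat.sub_add_cancel (Nat.one_le_iff_ne_zero.2 h0)
    · intro a _
      have : ((a + 1 : ℕ) : ℝ) - 1 / 2 = (a : ℝ) + 1 / 2 := by push_cast; ring
      rw [this]
  have e1 := Finset.sum_filter_add_sum_filter_not S (fun a => a + 1 ∈ S)
    (fun a => f ((a : ℝ) + 1 / 2) + f (-((a : ℝ) + 1 / 2)))
  have e2 := Finset.sum_filter_add_sum_filter_not S (fun a => a - 1 ∈ S)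
    (fun a => f ((a : ℝ) - 1 / 2) + f (-((a : ℝ) - 1 / 2)))
  have e3 : ∑ a ∈ S, (f ((a : ℝ) + 1 / 2) + f (-((a : ℝ) + 1 / 2)) -
        f ((a : ℝ) - 1 / 2) - f (-((a : ℝ) - 1 / 2))) =
      ∑ a ∈ S, (f ((a : ℝ) + 1 / 2) + f (-((a : ℝ) + 1 / 2))) -
        ∑ a ∈ S, (f ((a : ℝ) - 1 / 2) + f (-((a : ℝ) - 1 / 2))) := by
    rw [← Finset.sum_sub_distrib]
    exact Finset.sum_congr rfl fun a _ => by abel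
  rw [hmin, hmax, e3, ← e1, ← e2, hcomm]
  abel

theorem card_symMinima (S : Finset ℕ) (hS : 0 ∉ S) :
    (symMinima S).card = (symMaxima S).card + 1 := by
  have h := sum_symMinima_sub_sum_symMaxima S hS (fun _ => (1 : ℤ))
  simp at h
  omega

/-- The boundary is the rectangular diagram with the given minima and maxima. -/
theorem symContour_eq (S : Finset ℕ) (hS : 0 ∉ S) (u : ℝ) :
    symContour S u = ∑ x ∈ symMinima S, |u - x| - ∑ y ∈ symMaxima S, |u - y| := by
  rw [sum_symMinima_sub_sum_symMaxima S hS (fun x => |u - x|), symContour, sub_zero,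
    Finset.mul_sum]
  congr 1
  apply Finset.sum_congr rfl
  intro a ha
  have ha0 : a ≠ 0 := fun h => hS (h ▸ ha)
  have ha1 : (1 : ℝ) ≤ a := by exact_mod_cast Nat.one_le_iff_ne_zero.2 ha0
  have habs : ∀ c : ℝ, 0 ≤ c → |u - c| + |u - -c| = |(|u| - c)| + (|u| + c) := by
    intro c hc
    rcases abs_cases u with ⟨h1, h1'⟩ | ⟨h1, h1'⟩
    · rw [h1, sub_neg_eq_add, abs_of_nonneg (add_nonneg h1' hc)]
    · rw [h1, sub_neg_eq_add, abs_of_nonpos (show u - c ≤ 0 by linarith), ← abs_neg (u + c)]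
      rw [show -(u + c) = -u - c by ring]
      ring
  have e1 := habs ((a : ℝ) + 1 / 2) (by linarith)
  have e2 := habs ((a : ℝ) - 1 / 2) (by linarith)
  have e3 : |u - ((a : ℝ) + 1 / 2)| + |u - -((a : ℝ) + 1 / 2)| - |u - ((a : ℝ) - 1 / 2)| -
      |u - -((a : ℝ) - 1 / 2)| =
      |(|u| - ((a : ℝ) + 1 / 2))| - |(|u| - ((a : ℝ) - 1 / 2))| + 1 := by linarith
  rw [e3]
  generalize |u| = v
  rcases le_total v ((a : ℝ) - 1 / 2) with h | h
  · rw [min_eq_left (by linarith), max_eq_right (by norm_num), abs_of_nonpos (by linarith),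
      abs_of_nonpos (by linarith)]
    ring
  · rcases le_total v ((a : ℝ) + 1 / 2) with h' | h'
    · rw [min_eq_right (by linarith), max_eq_right (by linarith), abs_of_nonpos (by linarith),
        abs_of_nonneg (by linarith)]
      ring
    · rw [min_eq_right (by linarith), max_eq_left (by linarith), abs_of_nonneg (by linarith),
        abs_of_nonneg (by linarith)]
      ring

theorem exists_of_mem_coord {S : Finset ℕ} (hS : 0 ∉ S) {u : ℝ}
    (hu : u ∈ symMinima S ∪ symMaxima S) :
    u = 0 ∨ ∃ b ∈ S, (u = b + 1 / 2 ∨ u = -(b + 1 / 2) ∨ u = b - 1 / 2 ∨ u = -(b - 1 / 2)) ∧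
      ((u = b + 1 / 2 ∨ u = -(b + 1 / 2)) → b + 1 ∉ S) ∧
      ((u = b - 1 / 2 ∨ u = -(b - 1 / 2)) → b - 1 ∉ S) := by
  have pos : ∀ a ∈ S, (1 : ℝ) ≤ a := by
    intro a ha
    have : a ≠ 0 := fun h => hS (h ▸ ha)
    exact_mod_cast Nat.one_le_iff_ne_zero.2 this
  simp only [symMinima, symMaxima, Finset.mem_union, Finset.mem_singleton, Finset.mem_image,
    Finset.mem_filter] at hu
  rcases hu with ((h | ⟨a, ⟨h1, h2⟩, h3⟩) | ⟨a, ⟨h1, h2⟩, h3⟩) | ⟨a, ⟨h1, h2⟩, h3⟩ |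
    ⟨a, ⟨h1, h2⟩, h3⟩
  · exact Or.inl h
  all_goals
    have := pos a h1
    refine Or.inr ⟨a, h1, ?_, ?_, ?_⟩
  · exact Or.inl h3.symm
  · exact fun _ => h2
  · rintro (h | h) <;> linarith
  · exact Or.inr (Or.inl h3.symm)
  · exact fun _ => h2
  · rintro (h | h) <;> linarith
  · exact Or.inr (Or.inr (Or.inl h3.symm))
  · rintro (h | h) <;> linarith
  · exact fun _ => h2
  · exact Or.inr (Or.inr (Or.inr h3.symm))
  · rintro (h | h) <;> linarith
  · exact fun _ => h2

/-- The minima and the maxima interlace: at each of them, the others balance. -/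
theorem sum_sign_eq_zero (S : Finset ℕ) (hS : 0 ∉ S) {u : ℝ}
    (hu : u ∈ symMinima S ∪ symMaxima S) :
    ∑ x ∈ symMinima S, Real.sign (u - x) - ∑ y ∈ symMaxima S, Real.sign (u - y) = 0 := by
  have pos : ∀ a ∈ S, (1 : ℝ) ≤ a := by
    intro a ha
    have : a ≠ 0 := fun h => hS (h ▸ ha)
    exact_mod_cast Nat.one_le_iff_ne_zero.2 this
  have sp : ∀ t : ℝ, 0 < t → Real.sign t = 1 := fun t => Real.sign_of_pos
  have sn : ∀ t : ℝ, t < 0 → Real.sign t = -1 := fun t => Real.sign_of_neg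
  rw [sum_symMinima_sub_sum_symMaxima S hS (fun x => Real.sign (u - x))]
  rcases exists_of_mem_coord hS hu with rfl | ⟨b, hb, hub, hb1, hb2⟩
  · rw [sub_zero, Real.sign_zero, zero_add]
    apply Finset.sum_eq_zero
    intro a ha
    have := pos a ha
    rw [sn (0 - (a + 1 / 2)) (by linarith), sp (0 - -(a + 1 / 2)) (by linarith),
      sn (0 - (a - 1 / 2)) (by linarith), sp (0 - -(a - 1 / 2)) (by linarith)]
    norm_num
  · have hbp := pos b hb
    rw [Finset.sum_eq_single_of_mem b hb]
    · rcases hub with rfl | rfl | rfl | rfl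
      · rw [sub_self, Real.sign_zero, sp, sp, sp, sp] <;> linarith
      · rw [sub_self, Real.sign_zero, sn, sn, sn, sn] <;> linarith
      · rw [sub_self, Real.sign_zero, sp, sn, sp, sp] <;> linarith
      · rw [sub_self, Real.sign_zero, sn, sn, sp, sn] <;> linarith
    · intro a ha hab
      have hap := pos a ha
      rcases lt_or_gt_of_ne hab with hlt | hgt
      · have h1 : (a : ℝ) + 1 ≤ b := by exact_mod_cast hlt
        have h2 : (u = b - 1 / 2 ∨ u = -(b - 1 / 2)) → (a : ℝ) + 2 ≤ b := by
          intro h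
          have : a ≠ b - 1 := fun h' => hb2 h (h' ▸ ha)
          have : a + 2 ≤ b := by omega
          exact_mod_cast this
        rcases hub with h | h | h | h
        · rw [sp, sp, sp, sp] <;> linarith
        · rw [sn, sn, sn, sn] <;> linarith
        · have := h2 (Or.inl h)
          rw [sp, sp, sp, sp] <;> linarith
        · have := h2 (Or.inr h)
          rw [sn, sn, sn, sn] <;> linarith
      · have h1 : (b : ℝ) + 1 ≤ a := by exact_mod_cast hgt
        have h2 : (u = b + 1 / 2 ∨ u = -(b + 1 / 2)) → (b : ℝ) + 2 ≤ a := by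
          intro h
          have : a ≠ b + 1 := fun h' => hb1 h (h' ▸ ha)
          have : b + 2 ≤ a := by omega
          exact_mod_cast this
        rcases hub with h | h | h | h
        · have := h2 (Or.inl h)
          rw [sn (u - (a + 1 / 2)), sp, sn, sp] <;> linarith
        · have := h2 (Or.inr h)
          rw [sn (u - (a + 1 / 2)), sp, sn, sp] <;> linarith
        · rw [sn (u - (a + 1 / 2)), sp, sn, sp] <;> linarith
        · rw [sn (u - (a + 1 / 2)), sp, sn, sp] <;> linarith

theorem disjoint_symMinima_symMaxima (S : Finset ℕ) (hS : 0 ∉ S) :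
    Disjoint (symMinima S) (symMaxima S) := by
  have pos : ∀ a ∈ S, (1 : ℝ) ≤ a := by
    intro a ha
    have : a ≠ 0 := fun h => hS (h ▸ ha)
    exact_mod_cast Nat.one_le_iff_ne_zero.2 this
  have key : ∀ a ∈ S, ∀ b ∈ S, a + 1 ∉ S → (a : ℝ) + 1 / 2 ≠ b - 1 / 2 := by
    intro a _ b hb ha h
    have h2 : (b : ℝ) = ((a + 1 : ℕ) : ℝ) := by push_cast; linarith
    have h3 : b = a + 1 := by exact_mod_cast h2
    exact ha (h3 ▸ hb)
  rw [Finset.disjoint_left]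
  intro u h1 h2
  simp only [symMinima, symMaxima, Finset.mem_union, Finset.mem_singleton, Finset.mem_image,
    Finset.mem_filter] at h1 h2
  rcases h2 with ⟨b, ⟨hb, -⟩, h2⟩ | ⟨b, ⟨hb, -⟩, h2⟩ <;>
  rcases h1 with (h1 | ⟨a, ⟨ha, ha'⟩, h1⟩) | ⟨a, ⟨ha, ha'⟩, h1⟩ <;>
  have := pos b hb
  · linarith
  · exact key a ha b hb ha' (by linarith)
  · have := pos a ha
    linarith
  · linarith
  · have := pos a ha
    linarith
  · exact key a ha b hb ha' (by linarith)

theorem eventually_rectangular (U V : Finset ℝ) (u : ℝ) :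
    ∀ᶠ v in nhds u, (∑ x ∈ U, |v - x| - ∑ y ∈ V, |v - y|) =
      (∑ x ∈ U, |u - x| - ∑ y ∈ V, |u - y|) +
        (∑ x ∈ U, Real.sign (u - x) - ∑ y ∈ V, Real.sign (u - y)) * (v - u) +
          ((if u ∈ U then |v - u| else 0) - (if u ∈ V then |v - u| else 0)) := by
  have h1 : ∀ x : ℝ, ∀ᶠ v in nhds u, |v - x| = |u - x| + Real.sign (u - x) * (v - u) +
      (if u = x then |v - u| else 0) := by
    intro x
    rcases lt_trichotomy u x with h | rfl | h
    · filter_upwards [gt_mem_nhds h] with v hv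
      rw [abs_of_neg (by linarith), abs_of_neg (by linarith), Real.sign_of_neg (by linarith),
        if_neg h.ne]
      ring
    · exact Filter.Eventually.of_forall fun v => by simp
    · filter_upwards [lt_mem_nhds h] with v hv
      rw [abs_of_pos (by linarith), abs_of_pos (by linarith), Real.sign_of_pos (by linarith),
        if_neg h.ne']
      ring
  have h2 : ∀ W : Finset ℝ, ∀ᶠ v in nhds u, ∑ x ∈ W, |v - x| = ∑ x ∈ W, |u - x| +
      (∑ x ∈ W, Real.sign (u - x)) * (v - u) + (if u ∈ W then |v - u| else 0) := by
    intro W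
    filter_upwards [(Filter.eventually_all_finset W).2 fun x _ => h1 x] with v hv
    rw [Finset.sum_congr rfl hv, Finset.sum_add_distrib, Finset.sum_add_distrib, Finset.sum_mul,
      Finset.sum_ite_eq]
  filter_upwards [h2 U, h2 V] with v hU hV
  rw [hU, hV]
  ring

theorem sum_sign_ne_zero (U V : Finset ℝ) (hc : U.card = V.card + 1) (u : ℝ) (hU : u ∉ U)
    (hV : u ∉ V) :
    ∑ x ∈ U, Real.sign (u - x) - ∑ y ∈ V, Real.sign (u - y) ≠ 0 := by
  have h : ∀ W : Finset ℝ, u ∉ W → ∃ m : ℤ, ∑ x ∈ W, Real.sign (u - x) = W.card + 2 * m := by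
    intro W hW
    refine ⟨∑ x ∈ W, (if u < x then -1 else 0), ?_⟩
    rw [Finset.card_eq_sum_ones]
    push_cast
    rw [Finset.mul_sum, ← Finset.sum_add_distrib]
    apply Finset.sum_congr rfl
    intro x hx
    rcases lt_trichotomy u x with h | rfl | h
    · rw [Real.sign_of_neg (by linarith), if_pos h]
      norm_num
    · exact absurd hx hW
    · rw [Real.sign_of_pos (by linarith), if_neg h.not_gt]
      norm_num
  obtain ⟨m, hm⟩ := h U hU
  obtain ⟨l, hl⟩ := h V hV
  rw [hm, hl, hc]
  intro h0
  have : (1 + 2 * m - 2 * l : ℤ) = 0 := by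
    have : ((1 + 2 * m - 2 * l : ℤ) : ℝ) = 0 := by
      push_cast at h0 ⊢
      linarith
    exact_mod_cast this
  omega

theorem exists_near_of_eventually {p : ℝ → Prop} {u : ℝ} (h : ∀ᶠ v in nhds u, p v) (s : ℝ) :
    ∃ ε > 0, p (u + ε * s) := by
  have hc : Filter.Tendsto (fun ε : ℝ => u + ε * s) (nhdsWithin 0 (Set.Ioi 0)) (nhds u) := by
    have : Continuous fun ε : ℝ => u + ε * s := by fun_prop
    have h2 := this.tendsto 0
    simp only [zero_mul, add_zero] at h2
    exact h2.mono_left nhdsWithin_le_nhds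
  obtain ⟨ε, h1, h2⟩ := ((hc.eventually h).and self_mem_nhdsWithin).exists
  exact ⟨ε, h2, h1⟩

theorem isLocalMin_symContour_iff (S : Finset ℕ) (hS : 0 ∉ S) (u : ℝ) :
    IsLocalMin (symContour S) u ↔ u ∈ symMinima S := by
  have hev := eventually_rectangular (symMinima S) (symMaxima S) u
  simp only [← symContour_eq S hS] at hev
  have hd := disjoint_symMinima_symMaxima S hS
  constructor
  · intro h
    by_contra hU
    by_cases hV : u ∈ symMaxima S
    · rw [sum_sign_eq_zero S hS (Finset.mem_union_right _ hV)] at hev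
      obtain ⟨ε, hε, h1, h2⟩ := exists_near_of_eventually (hev.and h) 1
      rw [h1, if_neg hU, if_pos hV] at h2
      have : (0 : ℝ) < |u + ε * 1 - u| := by
        rw [show u + ε * 1 - u = ε by ring]
        exact abs_pos.2 hε.ne'
      linarith
    · have hs := sum_sign_ne_zero _ _ (card_symMinima S hS) u hU hV
      obtain ⟨ε, hε, h1, h2⟩ := exists_near_of_eventually (hev.and h)
        (-(∑ x ∈ symMinima S, Real.sign (u - x) - ∑ y ∈ symMaxima S, Real.sign (u - y)))
      rw [h1, if_neg hU, if_neg hV] at h2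
      have := mul_pos hε (mul_self_pos.2 hs)
      nlinarith
  · intro hU
    have hV := Finset.disjoint_left.1 hd hU
    rw [sum_sign_eq_zero S hS (Finset.mem_union_left _ hU)] at hev
    filter_upwards [hev] with v hv
    rw [hv, if_pos hU, if_neg hV]
    have := abs_nonneg (v - u)
    linarith

theorem isLocalMax_symContour_iff (S : Finset ℕ) (hS : 0 ∉ S) (u : ℝ) :
    IsLocalMax (symContour S) u ↔ u ∈ symMaxima S := by
  have hev := eventually_rectangular (symMinima S) (symMaxima S) u
  simp only [← symContour_eq S hS] at hev
  have hd := disjoint_symMinima_symMaxima S hS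
  constructor
  · intro h
    by_contra hV
    by_cases hU : u ∈ symMinima S
    · rw [sum_sign_eq_zero S hS (Finset.mem_union_left _ hU)] at hev
      obtain ⟨ε, hε, h1, h2⟩ := exists_near_of_eventually (hev.and h) 1
      rw [h1, if_pos hU, if_neg hV] at h2
      have : (0 : ℝ) < |u + ε * 1 - u| := by
        rw [show u + ε * 1 - u = ε by ring]
        exact abs_pos.2 hε.ne'
      linarith
    · have hs := sum_sign_ne_zero _ _ (card_symMinima S hS) u hU hV
      obtain ⟨ε, hε, h1, h2⟩ := exists_near_of_eventually (hev.and h)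
        (∑ x ∈ symMinima S, Real.sign (u - x) - ∑ y ∈ symMaxima S, Real.sign (u - y))
      rw [h1, if_neg hU, if_neg hV] at h2
      have := mul_pos hε (mul_self_pos.2 hs)
      nlinarith
  · intro hV
    have hU := Finset.disjoint_right.1 hd hV
    rw [sum_sign_eq_zero S hS (Finset.mem_union_right _ hV)] at hev
    filter_upwards [hev] with v hv
    rw [hv, if_pos hV, if_neg hU]
    have := abs_nonneg (v - u)
    linarith

/-- Kerov's transition measure of a diagram with set of local minima `U` and set of local
maxima `V`: the measure supported by `U` whose mass at `x ∈ U` is the residue at `x` of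
`∏_{y ∈ V} (z - y) / ∏_{x ∈ U} (z - x)`. -/
def transitionMeasure (U V : Finset ℝ) : Measure ℝ :=
  ∑ x ∈ U, ENNReal.ofReal ((∏ y ∈ V, (x - y)) / ∏ x' ∈ U.erase x, (x - x')) • Measure.dirac x

/-- The masses of the transition measure are nonnegative. -/
theorem residue_nonneg (S : Finset ℕ) (hS : 0 ∉ S) {x : ℝ} (hx : x ∈ symMinima S) :
    0 ≤ (∏ y ∈ symMaxima S, (x - y)) / ∏ x' ∈ (symMinima S).erase x, (x - x') := by
  have hV := Finset.disjoint_left.1 (disjoint_symMinima_symMaxima S hS) hx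
  have hsgn : ∀ W : Finset ℝ, x ∉ W → ∃ m : ℕ,
      ∑ y ∈ W, Real.sign (x - y) = W.card - 2 * m ∧ 0 ≤ (-1) ^ m * ∏ y ∈ W, (x - y) := by
    intro W
    induction W using Finset.induction_on with
    | empty => exact fun _ => ⟨0, by simp⟩
    | insert a W ha ih =>
      intro h
      rw [Finset.mem_insert, not_or] at h
      obtain ⟨m, h1, h2⟩ := ih h.2
      rw [Finset.sum_insert ha, Finset.prod_insert ha, Finset.card_insert_of_notMem ha, h1]
      rcases lt_or_gt_of_ne h.1 with hlt | hgt
      · refine ⟨m + 1, ?_, ?_⟩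
        · rw [Real.sign_of_neg (by linarith)]
          push_cast
          ring
        · rw [show (-1 : ℝ) ^ (m + 1) * ((x - a) * ∏ y ∈ W, (x - y)) =
            (a - x) * ((-1) ^ m * ∏ y ∈ W, (x - y)) by ring]
          exact mul_nonneg (by linarith) h2
      · refine ⟨m, ?_, ?_⟩
        · rw [Real.sign_of_pos (by linarith)]
          push_cast
          ring
        · rw [show (-1 : ℝ) ^ m * ((x - a) * ∏ y ∈ W, (x - y)) =
            (x - a) * ((-1) ^ m * ∏ y ∈ W, (x - y)) by ring]
          exact mul_nonneg (by linarith) h2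
  obtain ⟨m, hm1, hm2⟩ := hsgn (symMaxima S) hV
  obtain ⟨l, hl1, hl2⟩ := hsgn ((symMinima S).erase x) (Finset.notMem_erase _ _)
  have h0 := sum_sign_eq_zero S hS (Finset.mem_union_left _ hx)
  rw [← Finset.add_sum_erase _ _ hx, sub_self, Real.sign_zero, zero_add, hm1, hl1,
    Finset.card_erase_of_mem hx, card_symMinima S hS, Nat.add_sub_cancel] at h0
  have hml : m = l := by
    have : (m : ℝ) = l := by linarith
    exact_mod_cast this
  subst hml
  have h1 : (-1 : ℝ) ^ m ≠ 0 := pow_ne_zero _ (by norm_num)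
  rw [← mul_div_mul_left _ _ h1]
  exact div_nonneg hm2 hl2

theorem integral_transitionMeasure {E : Type*} [NormedAddCommGroup E] [NormedSpace ℝ E]
    [CompleteSpace E] (S : Finset ℕ) (hS : 0 ∉ S) (f : ℝ → E) :
    ∫ t, f t ∂(transitionMeasure (symMinima S) (symMaxima S)) =
      ∑ x ∈ symMinima S,
        ((∏ y ∈ symMaxima S, (x - y)) / ∏ x' ∈ (symMinima S).erase x, (x - x')) • f x := by
  rw [transitionMeasure, integral_finsetSum_measure]
  · apply Finset.sum_congr rfl
    intro x hx
    rw [integral_smul_measure, integral_dirac, ENNReal.toReal_ofReal (residue_nonneg S hS hx)]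
  · intro x _
    exact (integrable_dirac (by simp)).smul_measure ENNReal.ofReal_ne_top

theorem isProbabilityMeasure_transitionMeasure (S : Finset ℕ) (hS : 0 ∉ S) :
    IsProbabilityMeasure (transitionMeasure (symMinima S) (symMaxima S)) := by
  have hdeg : (∏ y ∈ symMaxima S, (Polynomial.X - Polynomial.C y)).degree =
      ((symMaxima S).card : WithBot ℕ) := by
    rw [Polynomial.degree_prod]
    simp
  have h := Lagrange.leadingCoeff_eq_sum (s := symMinima S) (v := id)
    (P := ∏ y ∈ symMaxima S, (Polynomial.X - Polynomial.C y))
    Function.injective_id.injOn (by rw [hdeg, card_symMinima S hS]; norm_cast)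
  rw [(Polynomial.monic_prod_of_monic _ _ fun y _ => Polynomial.monic_X_sub_C y).leadingCoeff] at h
  simp only [Polynomial.eval_prod, Polynomial.eval_sub, Polynomial.eval_X, Polynomial.eval_C,
    id] at h
  constructor
  rw [transitionMeasure, Measure.finsetSum_apply]
  simp only [Measure.smul_apply, measure_univ, smul_eq_mul, mul_one]
  rw [← ENNReal.ofReal_sum_of_nonneg fun x hx => residue_nonneg S hS hx, ← h, ENNReal.ofReal_one]

/-- The Cauchy transform of the transition measure. -/
theorem cauchyTransform_transitionMeasure (S : Finset ℕ) (hS : 0 ∉ S) (z : ℂ)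
    (hz : ∀ x ∈ symMinima S, z ≠ x) :
    ∫ t : ℝ, (z - t)⁻¹ ∂(transitionMeasure (symMinima S) (symMaxima S)) =
      (∏ y ∈ symMaxima S, (z - y)) / ∏ x ∈ symMinima S, (z - x) := by
  have hinj : Set.InjOn (fun x : ℝ => (x : ℂ)) (symMinima S) :=
    Complex.ofReal_injective.injOn
  have hdeg : (∏ y ∈ symMaxima S, (Polynomial.X - Polynomial.C (y : ℂ))).degree =
      ((symMaxima S).card : WithBot ℕ) := by
    rw [Polynomial.degree_prod]
    simp
  have h := Lagrange.eq_interpolate (s := symMinima S) (v := fun x : ℝ => (x : ℂ))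
    (f := ∏ y ∈ symMaxima S, (Polynomial.X - Polynomial.C (y : ℂ))) hinj
    (by rw [hdeg, card_symMinima S hS]; norm_cast; exact Nat.lt_succ_self _)
  have h2 := congrArg (Polynomial.eval z) h
  rw [Lagrange.eval_interpolate_not_at_node _ hz] at h2
  simp only [Polynomial.eval_prod, Polynomial.eval_sub, Polynomial.eval_X, Polynomial.eval_C,
    Lagrange.eval_nodal, Lagrange.nodalWeight] at h2
  have hne : ∏ x ∈ symMinima S, (z - x) ≠ 0 :=
    Finset.prod_ne_zero_iff.2 fun x hx => sub_ne_zero.2 (hz x hx)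
  rw [integral_transitionMeasure S hS, h2, mul_div_cancel_left₀ _ hne]
  apply Finset.sum_congr rfl
  intro x _
  rw [Complex.real_smul]
  push_cast
  rw [Finset.prod_inv_distrib]
  ring

/-- The transition measure of the symmetrized double diagram of `λ`. -/
def symTransitionMeasure {n : ℕ} (lam : StrictPartition n) : Measure ℝ :=
  transitionMeasure (symMinima lam.partSet) (symMaxima lam.partSet)

/-- `𝚁_k(λ)`: half of the `k`-th free cumulant of the transition measure of the symmetrized double
diagram of `λ`. -/
def symR {n : ℕ} (k : ℕ) (lam : StrictPartition n) : ℝ :=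
  freeCumulant (symTransitionMeasure lam) k / 2

end

/-! The spin character is expressed as a residue at infinity, and both it and the free cumulants
turn out to be unitriangular in the odd power sums of the parts.

Let `B_a` be the vertex operator that adds a row of length `a`, so that `P_λ = B_{λ_1} ⋯ B_{λ_l} 1`.
These operators anticommute, satisfy `[p_m, B_a] = B_{a+m}`, and for odd `m` the function `p_m` is
itself a combination of `B_m 1` and the `B_{m-c} B_c 1`. So multiplying `P_λ` by `p_m` lengthens a
row by `m`, adds a row of length `m`, or adds two rows of total length `m` (`psumFn_mul_schurFn`).
Applied to `p_1^n = n! ∑ w(S) P_S`, where `w(S)` is an explicit product (`shiftedWeight`), this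
yields the coefficients of `p_m p_1^(n-m)`. Since the `P_λ` are linearly independent
(`schurP_independent`), the spin character is the ratio `barSum`, a sum over removals of `m`-bars
(`spinCharacter_indiscrete`).

The bar sum is `-1/(4m)` times the coefficient of `z⁻¹` at infinity of `2z ∏_{0<s<m} (z - s + m/2)
∏_t (z² - (t + m/2)²)/(z² - (t - m/2)²)` (`barSum_eq_coeff`). Single bars are simple poles; a pair
of parts with sum `m` makes two poles collide, and a zero of the first product reduces the double
pole to a simple one.

The Cauchy transform of the transition measure is `z⁻¹` times a product of the same shape with `m/2`
replaced by `-1/2`, so one power series `evenQuotient` governs both sides. Its logarithmic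
derivative gives a Newton recursion, whence its coefficient of degree `2n+2` is `-4h ∑ t^(2n+1)`
plus a polynomial in lower odd power sums (`coeff_evenQuotient_mem`). Consequently `𝔭_{2n+1}` and
`𝚁_{2n+2}` both equal `∑ t^(2n+1)` plus a polynomial in lower odd power sums. The leading terms
cancel in the difference, and inverting the triangular system for the `𝚁`'s gives `Q_k`. Working
with functions on all strict partitions at once makes `Q_k` independent of `λ`. -/

noncomputable section

/-! ### Vertex operators on functions of finite sets of variables -/

section VertexOp

variable {σ K : Type*} [DecidableEq σ] [Field K] (x : σ → K)

/-- The vertex operator adding a row of length `a` to a `P`-function. -/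
def vertexOp (a : ℕ) : (Finset σ → K) →ₗ[K] (Finset σ → K) where
  toFun F A := ∑ i ∈ A, x i ^ a * (∏ k ∈ A.erase i, (x i + x k) / (x i - x k)) * F (A.erase i)
  map_add' F G := by
    funext A
    simp only [Pi.add_apply, mul_add, Finset.sum_add_distrib]
  map_smul' c F := by
    funext A
    simp only [Pi.smul_apply, smul_eq_mul, Finset.mul_sum, RingHom.id_apply]
    exact Finset.sum_congr rfl fun i _ => by ring

/-- The power sum, as a function of the finite set of variables. -/
def psumFn (m : ℕ) : Finset σ → K := fun A => ∑ i ∈ A, x i ^ m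

theorem vertexOp_apply (a : ℕ) (F : Finset σ → K) (A : Finset σ) :
    vertexOp x a F A =
      ∑ i ∈ A, x i ^ a * (∏ k ∈ A.erase i, (x i + x k) / (x i - x k)) * F (A.erase i) := rfl

/-- Pulls out the factor that couples `i` and `j`; what remains besides the monomial is symmetric in
`i` and `j`. -/
theorem vertexOp_vertexOp_apply (a b : ℕ) (F : Finset σ → K) (A : Finset σ) :
    vertexOp x a (vertexOp x b F) A =
      ∑ i ∈ A, ∑ j ∈ A.erase i, x i ^ a * x j ^ b * ((x i + x j) / (x i - x j)) *
        ((∏ k ∈ (A.erase i).erase j, (x i + x k) / (x i - x k)) *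
          (∏ k ∈ (A.erase i).erase j, (x j + x k) / (x j - x k)) * F ((A.erase i).erase j)) := by
  rw [vertexOp_apply]
  refine Finset.sum_congr rfl fun i _ => ?_
  rw [vertexOp_apply, Finset.mul_sum]
  refine Finset.sum_congr rfl fun j hj => ?_
  rw [← Finset.mul_prod_erase _ _ hj]
  ring

/-- Exchanging `i` and `j` in the double sum changes only the sign of `(x i + x j) / (x i - x j)`.
-/
theorem vertexOp_anticomm (a b : ℕ) (F : Finset σ → K) :
    vertexOp x a (vertexOp x b F) = -vertexOp x b (vertexOp x a F) := by
  funext A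
  rw [Pi.neg_apply, vertexOp_vertexOp_apply, vertexOp_vertexOp_apply,
    Finset.sum_comm' (s' := fun j => A.erase j) (t' := A)]
  · rw [← Finset.sum_neg_distrib]
    refine Finset.sum_congr rfl fun i _ => ?_
    rw [← Finset.sum_neg_distrib]
    refine Finset.sum_congr rfl fun j _ => ?_
    rw [Finset.erase_right_comm, add_comm (x j), ← neg_sub (x i) (x j), div_neg]
    ring
  · intro i j
    simp only [Finset.mem_erase]
    tauto

theorem vertexOp_self [CharZero K] (a : ℕ) (F : Finset σ → K) :
    vertexOp x a (vertexOp x a F) = 0 := by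
  have h := vertexOp_anticomm x a a F
  exact self_eq_neg.1 h

/-- On `A` the power sum is `x i ^ m` plus the power sum on `A.erase i`; the extra `x i ^ m` raises
the exponent `a`. -/
theorem psumFn_mul_vertexOp (m a : ℕ) (F : Finset σ → K) :
    psumFn x m * vertexOp x a F = vertexOp x a (psumFn x m * F) + vertexOp x (a + m) F := by
  funext A
  simp only [Pi.mul_apply, Pi.add_apply, vertexOp_apply]
  rw [Finset.mul_sum, ← Finset.sum_add_distrib]
  refine Finset.sum_congr rfl fun i hi => ?_
  rw [psumFn, psumFn, ← Finset.add_sum_erase _ _ hi]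
  ring

variable {x}

/-- Partial fractions in `t`: the value at infinity is `1` and the residue at `x j` is `2 x j ∏ (x j
+ x k) / (x j - x k)`. -/
theorem prod_add_div_sub_eq (hx : Function.Injective x) (A : Finset σ) :
    ∀ t : K, (∀ k ∈ A, t ≠ x k) → ∏ k ∈ A, (t + x k) / (t - x k) =
      1 + ∑ j ∈ A, 2 * x j / (t - x j) * ∏ k ∈ A.erase j, (x j + x k) / (x j - x k) := by
  induction A using Finset.induction_on with
  | empty => simp
  | insert c A hc ih =>
    intro t ht
    have hcA : ∀ k ∈ A, x c ≠ x k := fun k hk h => hc (hx h ▸ hk)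
    have htc : t - x c ≠ 0 := sub_ne_zero.2 (ht c (Finset.mem_insert_self _ _))
    rw [Finset.prod_insert hc, Finset.sum_insert hc, Finset.erase_insert hc, ih _ hcA,
      ih t fun k hk => ht k (Finset.mem_insert_of_mem hk)]
    have e : ∑ j ∈ A, 2 * x j / (t - x j) * ∏ k ∈ (insert c A).erase j, (x j + x k) / (x j - x k) =
        ∑ j ∈ A, 2 * x j / (t - x j) * ((x j + x c) / (x j - x c)) *
          ∏ k ∈ A.erase j, (x j + x k) / (x j - x k) := by
      refine Finset.sum_congr rfl fun j hj => ?_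
      have hjc : c ≠ j := fun h => hc (h ▸ hj)
      rw [Finset.erase_insert_of_ne hjc, Finset.prod_insert fun h => hc (Finset.mem_of_mem_erase h)]
      ring
    rw [e, mul_add, mul_add, Finset.mul_sum, Finset.mul_sum]
    -- Partial fractions of `(t + x c) / ((t - x c) (t - x j))` for each `j`; the first resulting
    -- sum is the residue at `x c`, expanded by the induction hypothesis at `t = x c`.
    have e2 : ∑ j ∈ A, (t + x c) / (t - x c) *
          (2 * x j / (t - x j) * ∏ k ∈ A.erase j, (x j + x k) / (x j - x k)) =
        ∑ j ∈ A, 2 * x c / (t - x c) *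
          (2 * x j / (x c - x j) * ∏ k ∈ A.erase j, (x j + x k) / (x j - x k)) +
        ∑ j ∈ A, 2 * x j / (t - x j) * ((x j + x c) / (x j - x c)) *
          ∏ k ∈ A.erase j, (x j + x k) / (x j - x k) := by
      rw [← Finset.sum_add_distrib]
      refine Finset.sum_congr rfl fun j hj => ?_
      have h1 : t - x j ≠ 0 := sub_ne_zero.2 (ht j (Finset.mem_insert_of_mem hj))
      have h2 : x c - x j ≠ 0 := sub_ne_zero.2 (hcA j hj)
      have h3 : x j - x c ≠ 0 := sub_ne_zero.2 (hcA j hj).symm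
      generalize ∏ k ∈ A.erase j, (x j + x k) / (x j - x k) = E
      rw [← neg_sub (x c) (x j), div_neg]
      field_simp
      ring
    rw [e2]
    have e3 : (t + x c) / (t - x c) = 1 + 2 * x c / (t - x c) := by
      field_simp
      ring
    rw [mul_one, mul_one, e3]
    ring

/-- The sum over `b` is geometric. Its value splits into a part antisymmetric in `i, j`, which sums
to zero, and a part whose sum over `j` is the partial fraction expansion of `∏ (t + x k) / (t - x
k)` at `t = -x i`. That product is the inverse of the one at `t = x i`, so `x i ^ m` is left after
`vertexOp x m 1` cancels. -/
theorem psumFn_odd [CharZero K] (hx : Function.Injective x)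
    (hx2 : ∀ i j, i ≠ j → x i + x j ≠ 0) {m : ℕ} (hm : Odd m) :
    psumFn x m = vertexOp x m 1 + ∑ b ∈ Finset.range (m - 1),
      (-1 : K) ^ (b + 1) • vertexOp x (m - 1 - b) (vertexOp x (b + 1) 1) := by
  obtain ⟨r, rfl⟩ := hm
  funext A
  rw [Nat.add_sub_cancel]
  simp only [Pi.add_apply, Finset.sum_apply, Pi.smul_apply, smul_eq_mul,
    vertexOp_vertexOp_apply, Finset.mul_sum]
  rw [Finset.sum_comm, vertexOp_apply]
  have key : ∀ i ∈ A, ∀ j ∈ A.erase i, ∑ b ∈ Finset.range (2 * r), (-1 : K) ^ (b + 1) *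
      (x i ^ (2 * r - b) * x j ^ (b + 1) * ((x i + x j) / (x i - x j)) *
        ((∏ k ∈ (A.erase i).erase j, (x i + x k) / (x i - x k)) *
          (∏ k ∈ (A.erase i).erase j, (x j + x k) / (x j - x k)) *
            (1 : Finset σ → K) ((A.erase i).erase j))) =
      x i ^ (2 * r + 1) * (∏ k ∈ A.erase i, (x i + x k) / (x i - x k)) *
        (2 * x j / (-x i - x j) * ∏ k ∈ (A.erase i).erase j, (x j + x k) / (x j - x k)) +
      (x i * x j ^ (2 * r + 1) + x i ^ (2 * r + 1) * x j) / (x i - x j) *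
        ((∏ k ∈ (A.erase i).erase j, (x i + x k) / (x i - x k)) *
          (∏ k ∈ (A.erase i).erase j, (x j + x k) / (x j - x k))) := by
    intro i _ j hj
    have hji := (Finset.ne_of_mem_erase hj).symm
    have h1 := hx2 i j hji
    have h2 : x i - x j ≠ 0 := sub_ne_zero.2 fun h => hji (hx h)
    rw [← Finset.mul_prod_erase _ _ hj]
    -- Oddness of `m = 2r + 1` enters here: the ratio of the geometric sum is negative, and `(-x j)
    -- ^ (2r) = x j ^ (2r)`.
    have hg : (∑ b ∈ Finset.range (2 * r), (-1 : K) ^ (b + 1) * (x i ^ (2 * r - b) * x j ^ (b + 1))) *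
        (x i + x j) = x i * x j * (x j ^ (2 * r) - x i ^ (2 * r)) := by
      have h := (Commute.all (-x j) (x i)).geom_sum₂_mul (2 * r)
      rw [Even.neg_pow (even_two_mul r)] at h
      rw [← h, Finset.sum_mul, Finset.sum_mul, Finset.mul_sum]
      refine Finset.sum_congr rfl fun b hb => ?_
      have hb' := Finset.mem_range.1 hb
      rw [show 2 * r - b = (2 * r - 1 - b) + 1 by omega, neg_pow (x j)]
      ring
    generalize ∏ k ∈ (A.erase i).erase j, (x i + x k) / (x i - x k) = E
    generalize ∏ k ∈ (A.erase i).erase j, (x j + x k) / (x j - x k) = E'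
    have e : ∀ b, (-1 : K) ^ (b + 1) * (x i ^ (2 * r - b) * x j ^ (b + 1) *
        ((x i + x j) / (x i - x j)) * (E * E' * (1 : Finset σ → K) ((A.erase i).erase j))) =
        (-1 : K) ^ (b + 1) * (x i ^ (2 * r - b) * x j ^ (b + 1)) *
          ((x i + x j) / (x i - x j) * (E * E')) := by
      intro b
      rw [Pi.one_apply]
      ring
    simp only [e]
    rw [← Finset.sum_mul, div_mul_eq_mul_div, ← mul_div_assoc, ← mul_assoc, hg,
      show -x i - x j = -(x i + x j) by ring, div_neg]
    field_simp
    ring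
  have hanti : ∑ i ∈ A, ∑ j ∈ A.erase i,
      (x i * x j ^ (2 * r + 1) + x i ^ (2 * r + 1) * x j) / (x i - x j) *
        ((∏ k ∈ (A.erase i).erase j, (x i + x k) / (x i - x k)) *
          (∏ k ∈ (A.erase i).erase j, (x j + x k) / (x j - x k))) = 0 := by
    refine self_eq_neg.1 ?_
    conv_lhs => rw [Finset.sum_comm' (s' := fun j => A.erase j) (t' := A) (by
      intro i j
      simp only [Finset.mem_erase]
      tauto)]
    rw [← Finset.sum_neg_distrib]
    refine Finset.sum_congr rfl fun i _ => ?_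
    rw [← Finset.sum_neg_distrib]
    refine Finset.sum_congr rfl fun j _ => ?_
    rw [Finset.erase_right_comm, ← neg_sub (x i) (x j), div_neg]
    ring
  have hcomm : ∀ i ∈ A, ∑ b ∈ Finset.range (2 * r), ∑ j ∈ A.erase i, (-1 : K) ^ (b + 1) *
      (x i ^ (2 * r - b) * x j ^ (b + 1) * ((x i + x j) / (x i - x j)) *
        ((∏ k ∈ (A.erase i).erase j, (x i + x k) / (x i - x k)) *
          (∏ k ∈ (A.erase i).erase j, (x j + x k) / (x j - x k)) *
            (1 : Finset σ → K) ((A.erase i).erase j))) =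
      x i ^ (2 * r + 1) * (∏ k ∈ A.erase i, (x i + x k) / (x i - x k)) *
        (∏ k ∈ A.erase i, (-x i + x k) / (-x i - x k) - 1) +
      ∑ j ∈ A.erase i, (x i * x j ^ (2 * r + 1) + x i ^ (2 * r + 1) * x j) / (x i - x j) *
        ((∏ k ∈ (A.erase i).erase j, (x i + x k) / (x i - x k)) *
          (∏ k ∈ (A.erase i).erase j, (x j + x k) / (x j - x k))) := by
    intro i hi
    rw [Finset.sum_comm, Finset.sum_congr rfl (key i hi), Finset.sum_add_distrib, ← Finset.mul_sum,
      prod_add_div_sub_eq hx (A.erase i) (-x i), add_sub_cancel_left]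
    intro k hk h
    exact hx2 i k (Finset.ne_of_mem_erase hk).symm (by rw [← h]; ring)
  rw [Finset.sum_congr rfl hcomm, Finset.sum_add_distrib, hanti, add_zero, psumFn,
    ← Finset.sum_add_distrib]
  refine Finset.sum_congr rfl fun i hi => ?_
  have hprod : (∏ k ∈ A.erase i, (x i + x k) / (x i - x k)) *
      ∏ k ∈ A.erase i, (-x i + x k) / (-x i - x k) = 1 := by
    rw [← Finset.prod_mul_distrib]
    refine Finset.prod_eq_one fun k hk => ?_
    have hki := (Finset.ne_of_mem_erase hk).symm
    have h1 := hx2 i k hki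
    have h2 : x i - x k ≠ 0 := sub_ne_zero.2 fun h => hki (hx h)
    rw [show -x i + x k = -(x i - x k) by ring, show -x i - x k = -(x i + x k) by ring,
      neg_div_neg_eq]
    field_simp
  rw [Pi.one_apply, mul_one, mul_sub, mul_one, mul_assoc (x i ^ (2 * r + 1)), hprod]
  ring

end VertexOp

end

/-! ### Products of vertex operators and multiplication by odd power sums -/

noncomputable section

/-- The sign of the permutation that sorts `a` into the decreasing sequence of elements of `S`. -/
def insertSign (R : Type*) [CommRing R] (a : ℕ) (S : Finset ℕ) : R :=
  ∏ s ∈ S, if s < a then 1 else -1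

theorem insertSign_mul_self {R : Type*} [CommRing R] (a : ℕ) (S : Finset ℕ) :
    insertSign R a S * insertSign R a S = 1 := by
  rw [insertSign, ← Finset.prod_mul_distrib]
  refine Finset.prod_eq_one fun s _ => ?_
  split_ifs <;> simp

theorem insertSign_insert {R : Type*} [CommRing R] (a c : ℕ) (S : Finset ℕ) (hc : c ∉ S) :
    insertSign R a (insert c S) = (if c < a then 1 else -1) * insertSign R a S :=
  Finset.prod_insert hc

theorem insertSign_of_lt {R : Type*} [CommRing R] (a : ℕ) (S : Finset ℕ) (h : ∀ s ∈ S, s < a) :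
    insertSign R a S = 1 :=
  Finset.prod_eq_one fun s hs => if_pos (h s hs)

theorem insertSign_zero {R : Type*} [CommRing R] (S : Finset ℕ) :
    insertSign R 0 S = (-1) ^ S.card := by
  simp [insertSign]

section SchurFn

variable {σ K : Type*} [DecidableEq σ] [Field K] (x : σ → K)

/-- The `P`-function of the strict partition with set of parts `S`, as a function of the finite set
of variables. -/
def schurFn (S : Finset ℕ) : Finset σ → K :=
  (S.sort (fun a b => b ≤ a)).foldr (fun a F => vertexOp x a F) 1

theorem schurFn_empty : schurFn x ∅ = 1 := by
  simp [schurFn]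

theorem schurFn_insert {c : ℕ} {S : Finset ℕ} (h : ∀ s ∈ S, s < c) :
    schurFn x (insert c S) = vertexOp x c (schurFn x S) := by
  rw [schurFn, Finset.sort_insert (r := fun a b => b ≤ a) (fun b hb => (h b hb).le)
    (fun hc => (h c hc).false), List.foldr_cons, schurFn]

/-- The new operator is moved past the operators of the larger parts, each costing a factor `-1`. -/
theorem vertexOp_schurFn_of_notMem {a : ℕ} {S : Finset ℕ} (ha : a ∉ S) :
    vertexOp x a (schurFn x S) = insertSign K a S • schurFn x (insert a S) := by
  induction S using Finset.induction_on_max with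
  | empty =>
    rw [schurFn_insert x (by simp), insertSign_of_lt _ _ (by simp), one_smul]
  | insert c S hc ih =>
    have hcS : c ∉ S := fun h => (hc c h).false
    rw [Finset.mem_insert, not_or] at ha
    rcases lt_or_gt_of_ne ha.1 with hlt | hgt
    · rw [schurFn_insert x hc, vertexOp_anticomm, ih ha.2, map_smul, ← schurFn_insert,
        insertSign_insert _ _ _ hcS, if_neg hlt.not_gt, Finset.insert_comm, neg_one_mul, neg_smul]
      intro s hs
      rcases Finset.mem_insert.1 hs with rfl | hs
      · exact hlt
      · exact hc s hs
    · have h : ∀ s ∈ insert c S, s < a := by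
        intro s hs
        rcases Finset.mem_insert.1 hs with rfl | hs
        · exact hgt
        · exact (hc s hs).trans hgt
      rw [insertSign_of_lt _ _ h, one_smul, schurFn_insert x h]

/-- Up to sign the operator of `a` can be brought to the front of `schurFn x S`, where it meets
itself, and its square is zero. -/
theorem vertexOp_schurFn_of_mem [CharZero K] {a : ℕ} {S : Finset ℕ} (ha : a ∈ S) :
    vertexOp x a (schurFn x S) = 0 := by
  have h1 := vertexOp_schurFn_of_notMem x (Finset.notMem_erase a S)
  rw [Finset.insert_erase ha] at h1
  have h2 : schurFn x S = insertSign K a (S.erase a) • vertexOp x a (schurFn x (S.erase a)) := by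
    rw [h1, smul_smul, insertSign_mul_self, one_smul]
  rw [h2, map_smul, vertexOp_self, smul_zero]

variable {x}

/-- The power sum is commuted past all vertex operators and then acts on `1`. The index `0` in
`insert 0 S` stands for an empty row, which is lengthened to a new row of length `m`. -/
theorem psumFn_mul_schurFn [CharZero K] (hx : Function.Injective x)
    (hx2 : ∀ i j, i ≠ j → x i + x j ≠ 0) {m : ℕ} (hm : Odd m) (S : Finset ℕ) (h0 : 0 ∉ S) :
    psumFn x m * schurFn x S =
      ∑ s ∈ insert 0 S, insertSign K s (S.erase s) • vertexOp x (s + m) (schurFn x (S.erase s)) +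
      ∑ b ∈ Finset.range (m - 1),
        (-1 : K) ^ (b + 1) • vertexOp x (m - 1 - b) (vertexOp x (b + 1) (schurFn x S)) := by
  rw [Finset.sum_insert h0, Finset.erase_eq_of_notMem h0, zero_add, insertSign_zero]
  induction S using Finset.induction_on_max with
  | empty =>
    simp only [schurFn_empty, mul_one, Finset.card_empty, pow_zero, one_smul, Finset.sum_empty,
      add_zero]
    exact psumFn_odd hx hx2 hm
  | insert c S hc ih =>
    have hcS : c ∉ S := fun h => (hc c h).false
    rw [Finset.mem_insert, not_or] at h0
    rw [schurFn_insert x hc, psumFn_mul_vertexOp, ih h0.2, map_add, map_add, map_smul, map_sum,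
      map_sum, Finset.sum_insert hcS, Finset.erase_insert hcS, insertSign_of_lt _ _ hc, one_smul,
      Finset.card_insert_of_notMem hcS, vertexOp_anticomm x c m]
    -- The sign from moving `c` past the lengthened row is the factor that `c > s` contributes to
    -- `insertSign`.
    have e1 : ∑ s ∈ S, vertexOp x c (insertSign K s (S.erase s) •
          vertexOp x (s + m) (schurFn x (S.erase s))) =
        ∑ s ∈ S, insertSign K s ((insert c S).erase s) •
          vertexOp x (s + m) (schurFn x ((insert c S).erase s)) := by
      refine Finset.sum_congr rfl fun s hs => ?_
      have hlt : ∀ t ∈ S.erase s, t < c := fun t ht => hc t (Finset.mem_of_mem_erase ht)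
      rw [Finset.erase_insert_of_ne (hc s hs).ne', schurFn_insert x hlt,
        insertSign_insert _ _ _ (fun h => (hlt c h).false), if_neg (hc s hs).not_gt, map_smul,
        vertexOp_anticomm, neg_one_mul, smul_neg, neg_smul]
    have e2 : ∑ b ∈ Finset.range (m - 1), vertexOp x c ((-1 : K) ^ (b + 1) •
          vertexOp x (m - 1 - b) (vertexOp x (b + 1) (schurFn x S))) =
        ∑ b ∈ Finset.range (m - 1), (-1 : K) ^ (b + 1) •
          vertexOp x (m - 1 - b) (vertexOp x (b + 1) (vertexOp x c (schurFn x S))) := by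
      refine Finset.sum_congr rfl fun b _ => ?_
      rw [map_smul, vertexOp_anticomm x c, vertexOp_anticomm x c, map_neg, neg_neg]
    rw [e1, e2, pow_succ, mul_neg_one, neg_smul, smul_neg]
    abel

end SchurFn

end

/-! ### Tableau weights and their ratios under adding bars -/

noncomputable section

/-- The sets of parts of the strict partitions of `n`. -/
def strictSets (n : ℕ) : Finset (Finset ℕ) :=
  (Finset.Icc 1 n).powerset.filter fun S => ∑ s ∈ S, s = n

theorem mem_strictSets {n : ℕ} {S : Finset ℕ} : S ∈ strictSets n ↔ 0 ∉ S ∧ ∑ s ∈ S, s = n := by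
  rw [strictSets, Finset.mem_filter, Finset.mem_powerset]
  constructor
  · rintro ⟨h1, h2⟩
    exact ⟨fun h => absurd (Finset.mem_Icc.1 (h1 h)).1 (by norm_num), h2⟩
  · rintro ⟨h1, h2⟩
    refine ⟨fun s hs => Finset.mem_Icc.2 ⟨?_, ?_⟩, h2⟩
    · exact Nat.one_le_iff_ne_zero.2 fun h => h1 (h ▸ hs)
    · exact h2 ▸ Finset.single_le_sum (f := fun s => s) (fun _ _ => Nat.zero_le _) hs

section Weight

variable (K : Type*) [Field K]

/-- The number of standard shifted tableaux with row lengths in `S`, divided by the factorial of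
their size. -/
def shiftedWeight (S : Finset ℕ) : K :=
  (∏ s ∈ S, ((s.factorial : ℕ) : K)⁻¹) *
    ∏ s ∈ S, ∏ t ∈ S, if t < s then ((s : K) - t) / (s + t) else 1

/-- The value of the spin character of an `m`-cycle on the strict partition with set of parts `T`,
written as a sum over the ways to remove an `m`-bar. -/
def barSum (m : ℕ) (T : Finset ℕ) : K :=
  ∑ t ∈ T, (t.descFactorial m : K) * ∏ s ∈ T.erase t,
      (((t : K) - m - s) * (t + s)) / (((t : K) - m + s) * (t - s)) +
  ∑ a ∈ T with a < m ∧ m - a ∈ T, (-1 : K) ^ (m - a) *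
      ((a.factorial : K) * ((m - a).factorial : K) * m / (a - (m - a : ℕ))) *
        ∏ s ∈ (T.erase a).erase (m - a),
          (((a : K) + s) * ((m - a : ℕ) + s)) / (((a : K) - s) * ((m - a : ℕ) - s))

variable {K}

/-- The sign turns each factor `(s - a) / (s + a)` with `s > a` into `(a - s) / (a + s)`, so that no
comparison of `a` with the other parts remains. -/
theorem insertSign_mul_shiftedWeight_insert {a : ℕ} {S : Finset ℕ} (ha : a ∉ S) :
    insertSign K a S * shiftedWeight K (insert a S) =
      shiftedWeight K S * ((a.factorial : ℕ) : K)⁻¹ * ∏ s ∈ S, ((a : K) - s) / (a + s) := by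
  have h1 : ∏ s ∈ insert a S, ∏ t ∈ insert a S, (if t < s then ((s : K) - t) / (s + t) else 1) =
      (∏ t ∈ S, if t < a then ((a : K) - t) / (a + t) else 1) *
        ((∏ s ∈ S, if a < s then ((s : K) - a) / (s + a) else 1) *
          ∏ s ∈ S, ∏ t ∈ S, if t < s then ((s : K) - t) / (s + t) else 1) := by
    have h (s : ℕ) : ∏ t ∈ insert a S, (if t < s then ((s : K) - t) / (s + t) else 1) =
        (if a < s then ((s : K) - a) / (s + a) else 1) *
          ∏ t ∈ S, if t < s then ((s : K) - t) / (s + t) else 1 := Finset.prod_insert ha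
    simp only [h]
    rw [Finset.prod_insert ha, if_neg (lt_irrefl a), one_mul, Finset.prod_mul_distrib]
  have h2 : insertSign K a S * ((∏ t ∈ S, if t < a then ((a : K) - t) / (a + t) else 1) *
      (∏ s ∈ S, if a < s then ((s : K) - a) / (s + a) else 1)) =
      ∏ s ∈ S, ((a : K) - s) / (a + s) := by
    rw [insertSign, ← Finset.prod_mul_distrib, ← Finset.prod_mul_distrib]
    refine Finset.prod_congr rfl fun s hs => ?_
    rcases lt_trichotomy s a with h | h | h
    · rw [if_pos h, if_pos h, if_neg h.not_gt, one_mul, mul_one]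
    · exact absurd (h ▸ hs) ha
    · rw [if_neg h.not_gt, if_neg h.not_gt, if_pos h, one_mul, add_comm (s : K) a, ← neg_sub,
        neg_div, neg_mul_neg, one_mul]
  rw [shiftedWeight, shiftedWeight, h1, Finset.prod_insert ha, ← h2]
  ring

theorem shiftedWeight_insert {a : ℕ} {S : Finset ℕ} (ha : a ∉ S) :
    shiftedWeight K (insert a S) = insertSign K a S *
      (shiftedWeight K S * ((a.factorial : ℕ) : K)⁻¹ * ∏ s ∈ S, ((a : K) - s) / (a + s)) := by
  rw [← insertSign_mul_shiftedWeight_insert ha, ← mul_assoc, insertSign_mul_self, one_mul]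

variable [CharZero K]

/-- Allows the creation of a new row to be treated as the lengthening of a row of length `0`. -/
theorem shiftedWeight_insert_zero {S : Finset ℕ} (h0 : 0 ∉ S) :
    shiftedWeight K (insert 0 S) = shiftedWeight K S := by
  rw [shiftedWeight_insert h0, insertSign_zero]
  have : ∏ s ∈ S, (((0 : ℕ) : K) - s) / ((0 : ℕ) + s) = (-1) ^ S.card := by
    rw [← Finset.prod_const]
    refine Finset.prod_congr rfl fun s hs => ?_
    have : (s : K) ≠ 0 := Nat.cast_ne_zero.2 fun h => h0 (h ▸ hs)
    rw [Nat.cast_zero, zero_sub, zero_add, neg_div, div_self this]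
  rw [this, Nat.factorial_zero, Nat.cast_one, inv_one, mul_one, mul_comm, mul_assoc, ← mul_pow,
    neg_one_mul, neg_neg, one_pow, mul_one]

theorem shiftedWeight_ne_zero {S : Finset ℕ} : shiftedWeight K S ≠ 0 := by
  rw [shiftedWeight]
  refine mul_ne_zero (Finset.prod_ne_zero_iff.2 fun s _ => ?_)
    (Finset.prod_ne_zero_iff.2 fun s _ => Finset.prod_ne_zero_iff.2 fun t _ => ?_)
  · exact inv_ne_zero (Nat.cast_ne_zero.2 s.factorial_ne_zero)
  · split_ifs with h
    · refine div_ne_zero (sub_ne_zero.2 fun h' => h.ne (Nat.cast_injective h').symm) ?_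
      rw [← Nat.cast_add]
      exact Nat.cast_ne_zero.2 (by omega)
    · exact one_ne_zero

/-- The ratio of the weights before and after replacing the row `s` by `s + m` is, with signs, a
single-bar summand of `barSum`. -/
theorem shiftedWeight_shift {s m : ℕ} {S : Finset ℕ} (h0 : 0 ∉ S) (hs : s ∉ S) (hm : s + m ∉ S) :
    insertSign K s S * shiftedWeight K (insert s S) * insertSign K (s + m) S =
      shiftedWeight K (insert (s + m) S) * (((s + m).descFactorial m : K) * ∏ u ∈ S,
        ((((s + m : ℕ) : K) - m - u) * ((s + m : ℕ) + u)) /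
          ((((s + m : ℕ) : K) - m + u) * ((s + m : ℕ) - u))) := by
  rw [insertSign_mul_shiftedWeight_insert hs, shiftedWeight_insert hm]
  have hf : (((s + m).factorial : ℕ) : K) = (s.factorial : K) * ((s + m).descFactorial m : K) := by
    rw [← Nat.cast_mul, ← Nat.factorial_mul_descFactorial (Nat.le_add_left m s),
      Nat.add_sub_cancel]
  have h1 : (((s + m).descFactorial m : ℕ) : K) ≠ 0 := by
    intro h
    rw [h, mul_zero] at hf
    exact Nat.cast_ne_zero.2 (Nat.factorial_ne_zero _) hf
  have h2 : (s.factorial : K) ≠ 0 := Nat.cast_ne_zero.2 (Nat.factorial_ne_zero _)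
  have hp : ∏ u ∈ S, ((s : K) - u) / (s + u) = (∏ u ∈ S, (((s + m : ℕ) : K) - u) / ((s + m : ℕ) + u)) *
      ∏ u ∈ S, ((((s + m : ℕ) : K) - m - u) * ((s + m : ℕ) + u)) /
          ((((s + m : ℕ) : K) - m + u) * ((s + m : ℕ) - u)) := by
    rw [← Finset.prod_mul_distrib]
    refine Finset.prod_congr rfl fun u hu => ?_
    have hu0 : u ≠ 0 := fun h => h0 (h ▸ hu)
    have h3 : ((s + m : ℕ) : K) - u ≠ 0 := sub_ne_zero.2 fun h => hm (Nat.cast_injective h ▸ hu)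
    have h4 : ((s + m : ℕ) : K) + u ≠ 0 := by
      rw [← Nat.cast_add]
      exact Nat.cast_ne_zero.2 (by omega)
    have h5 : (s : K) + u ≠ 0 := by
      rw [← Nat.cast_add]
      exact Nat.cast_ne_zero.2 (by omega)
    rw [show ((s + m : ℕ) : K) - m = s by push_cast; ring]
    field_simp
  rw [hp, hf]
  field_simp

/-- The analogue for two added rows: the factor `m / (a - c)` is the inverse of the interaction `(a
- c) / (a + c)` of these rows. -/
theorem shiftedWeight_pair {a c m : ℕ} {S : Finset ℕ} (h0 : 0 ∉ S) (ha : a ∉ S) (hc : c ∉ S)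
    (hac : a ≠ c) (ha0 : a ≠ 0) (hm : a + c = m) :
    insertSign K c S * insertSign K a (insert c S) * shiftedWeight K S =
      shiftedWeight K (insert a (insert c S)) *
        ((a.factorial : K) * (c.factorial : K) * m / (a - c) *
          ∏ s ∈ S, (((a : K) + s) * (c + s)) / (((a : K) - s) * (c - s))) := by
  have hac' : a ∉ insert c S := by simp [hac, ha]
  rw [shiftedWeight_insert hac', shiftedWeight_insert hc, Finset.prod_insert hc]
  have h1 : (a.factorial : K) ≠ 0 := Nat.cast_ne_zero.2 (Nat.factorial_ne_zero _)
  have h2 : (c.factorial : K) ≠ 0 := Nat.cast_ne_zero.2 (Nat.factorial_ne_zero _)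
  have h3 : (a : K) - c ≠ 0 := sub_ne_zero.2 fun h => hac (Nat.cast_injective h)
  have h4 : (m : K) ≠ 0 := Nat.cast_ne_zero.2 (by omega)
  have h5 : (a : K) + c = m := by rw [← hm, Nat.cast_add]
  have hp : (∏ s ∈ S, ((c : K) - s) / (c + s)) * (∏ s ∈ S, ((a : K) - s) / (a + s)) *
      ∏ s ∈ S, (((a : K) + s) * (c + s)) / (((a : K) - s) * (c - s)) = 1 := by
    rw [← Finset.prod_mul_distrib, ← Finset.prod_mul_distrib]
    refine Finset.prod_eq_one fun s hs => ?_
    have hu0 : s ≠ 0 := fun h => h0 (h ▸ hs)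
    have e1 : (a : K) - s ≠ 0 := sub_ne_zero.2 fun h => ha (Nat.cast_injective h ▸ hs)
    have e2 : (c : K) - s ≠ 0 := sub_ne_zero.2 fun h => hc (Nat.cast_injective h ▸ hs)
    have e3 : (a : K) + s ≠ 0 := by
      rw [← Nat.cast_add]
      exact Nat.cast_ne_zero.2 (by omega)
    have e4 : (c : K) + s ≠ 0 := by
      rw [← Nat.cast_add]
      exact Nat.cast_ne_zero.2 (by omega)
    field_simp
  rw [h5]
  generalize ∏ s ∈ S, ((c : K) - s) / (c + s) = X at *
  generalize ∏ s ∈ S, ((a : K) - s) / (a + s) = Y at *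
  generalize ∏ s ∈ S, (((a : K) + s) * (c + s)) / (((a : K) - s) * (c - s)) = Z at *
  field_simp
  linear_combination (-insertSign K c S * insertSign K a (insert c S) * shiftedWeight K S) * hp

end Weight
end

/-! ### Reindexing the product with an odd power sum by the resulting partition -/

noncomputable section

section Expansion

variable {σ K : Type*} [DecidableEq σ] [Field K] [CharZero K] {x : σ → K}

theorem add_sum_erase_of_mem_insert_zero {s : ℕ} {S : Finset ℕ} (hs : s ∈ insert 0 S) (h0 : 0 ∉ S) :
    s + ∑ u ∈ S.erase s, u = ∑ u ∈ S, u := by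
  rcases Finset.mem_insert.1 hs with rfl | hs
  · rw [zero_add, Finset.erase_eq_of_notMem h0]
  · exact Finset.add_sum_erase S (fun u => u) hs

/-- Pairs `(S, s)` correspond to `(T, t)` with `t = s + m`. Terms outside the bijection vanish: on
the left a row repeats, on the right either `t < m` kills the falling factorial or `t - m ∈ T` kills
a factor of the product. -/
theorem sum_single_bar {m : ℕ} (hm : m ≠ 0) (n : ℕ) :
    ∑ S ∈ strictSets n, ∑ s ∈ insert 0 S, (shiftedWeight K S * insertSign K s (S.erase s)) •
        vertexOp x (s + m) (schurFn x (S.erase s)) =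
      ∑ T ∈ strictSets (n + m), ∑ t ∈ T, (shiftedWeight K T *
        ((t.descFactorial m : K) * ∏ s ∈ T.erase t,
          (((t : K) - m - s) * (t + s)) / (((t : K) - m + s) * (t - s)))) • schurFn x T := by
  rw [Finset.sum_sigma', Finset.sum_sigma']
  rw [← Finset.sum_filter_of_ne (p := fun q => q.2 + m ∉ q.1) (s := (strictSets n).sigma _),
    ← Finset.sum_filter_of_ne (p := fun q => m ≤ q.2 ∧ q.2 - m ∉ q.1)
      (s := (strictSets (n + m)).sigma _)]
  -- The inverse erases `0` because the removed bar may be a whole row, leaving `t - m = 0`.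
  · refine Finset.sum_bij' (fun q _ => ⟨insert (q.2 + m) (q.1.erase q.2), q.2 + m⟩)
      (fun q _ => ⟨(insert (q.2 - m) (q.1.erase q.2)).erase 0, q.2 - m⟩) ?_ ?_ ?_ ?_ ?_
    · rintro ⟨S, s⟩ h
      simp only [Finset.mem_filter, Finset.mem_sigma, mem_strictSets] at h ⊢
      obtain ⟨⟨⟨h0, hn⟩, hs⟩, hsm⟩ := h
      have hsm' : s + m ∉ S.erase s := fun h => hsm (Finset.mem_of_mem_erase h)
      refine ⟨⟨⟨?_, ?_⟩, Finset.mem_insert_self _ _⟩, Nat.le_add_left _ _, ?_⟩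
      · rw [Finset.mem_insert, not_or]
        exact ⟨by omega, fun h => h0 (Finset.mem_of_mem_erase h)⟩
      · rw [Finset.sum_insert hsm', ← hn, ← add_sum_erase_of_mem_insert_zero hs h0]
        ring
      · rw [Nat.add_sub_cancel, Finset.mem_insert, not_or]
        exact ⟨by omega, Finset.notMem_erase _ _⟩
    · rintro ⟨T, t⟩ h
      simp only [Finset.mem_filter, Finset.mem_sigma, mem_strictSets] at h ⊢
      obtain ⟨⟨⟨h0, hn⟩, ht⟩, hmt, htm⟩ := h
      have htm' : t - m ∉ T.erase t := fun h => htm (Finset.mem_of_mem_erase h)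
      have hsum : ∑ s ∈ (insert (t - m) (T.erase t)).erase 0, s = n := by
        rw [Finset.sum_erase (f := fun s : ℕ => s) _ rfl, Finset.sum_insert htm']
        have := Finset.add_sum_erase T (fun u => u) ht
        omega
      refine ⟨⟨⟨Finset.notMem_erase _ _, hsum⟩, ?_⟩, ?_⟩
      · rcases Nat.eq_zero_or_pos (t - m) with h | h
        · exact Finset.mem_insert.2 (Or.inl h)
        · exact Finset.mem_insert_of_mem (Finset.mem_erase.2 ⟨h.ne', Finset.mem_insert_self _ _⟩)
      · rw [Nat.sub_add_cancel hmt, Finset.mem_erase, Finset.mem_insert, Finset.mem_erase]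
        rintro ⟨-, h | h⟩
        · omega
        · exact h.1 rfl
    · rintro ⟨S, s⟩ h
      simp only [Finset.mem_filter, Finset.mem_sigma, mem_strictSets] at h ⊢
      obtain ⟨⟨⟨h0, hn⟩, hs⟩, hsm⟩ := h
      have hsm' : s + m ∉ S.erase s := fun h => hsm (Finset.mem_of_mem_erase h)
      have : (insert (s + m - m) ((insert (s + m) (S.erase s)).erase (s + m))).erase 0 = S := by
        rw [Nat.add_sub_cancel, Finset.erase_insert hsm']
        rcases Finset.mem_insert.1 hs with rfl | hs
        · rw [Finset.erase_eq_of_notMem h0, Finset.erase_insert h0]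
        · rw [Finset.insert_erase hs, Finset.erase_eq_of_notMem h0]
      rw [Sigma.mk.injEq]
      exact ⟨this, heq_of_eq (Nat.add_sub_cancel s m)⟩
    · rintro ⟨T, t⟩ h
      simp only [Finset.mem_filter, Finset.mem_sigma, mem_strictSets] at h ⊢
      obtain ⟨⟨⟨h0, hn⟩, ht⟩, hmt, htm⟩ := h
      have htm' : t - m ∉ T.erase t := fun h => htm (Finset.mem_of_mem_erase h)
      have : insert (t - m + m) (((insert (t - m) (T.erase t)).erase 0).erase (t - m)) = T := by
        rw [Nat.sub_add_cancel hmt, Finset.erase_right_comm, Finset.erase_insert htm',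
          Finset.erase_right_comm, Finset.erase_eq_of_notMem h0, Finset.insert_erase ht]
      rw [Sigma.mk.injEq]
      exact ⟨this, heq_of_eq (Nat.sub_add_cancel hmt)⟩
    · rintro ⟨S, s⟩ h
      simp only [Finset.mem_filter, Finset.mem_sigma, mem_strictSets] at h ⊢
      obtain ⟨⟨⟨h0, hn⟩, hs⟩, hsm⟩ := h
      have hsm' : s + m ∉ S.erase s := fun h => hsm (Finset.mem_of_mem_erase h)
      have h0' : 0 ∉ S.erase s := fun h => h0 (Finset.mem_of_mem_erase h)
      have hw : shiftedWeight K S = shiftedWeight K (insert s (S.erase s)) := by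
        rcases Finset.mem_insert.1 hs with rfl | hs
        · rw [Finset.erase_eq_of_notMem h0, shiftedWeight_insert_zero h0]
        · rw [Finset.insert_erase hs]
      rw [vertexOp_schurFn_of_notMem x hsm', smul_smul, Finset.erase_insert hsm',
        ← shiftedWeight_shift h0' (Finset.notMem_erase _ _) hsm', hw, mul_comm (shiftedWeight K _)]
  · rintro ⟨T, t⟩ h hne
    simp only [Finset.mem_sigma, mem_strictSets] at h
    constructor
    · by_contra hlt
      apply hne
      simp only
      rw [Nat.descFactorial_eq_zero_iff_lt.2 (not_le.1 hlt), Nat.cast_zero, zero_mul, mul_zero,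
        zero_smul]
    · intro hmem
      simp only at hmem
      apply hne
      simp only
      by_cases hmt : m ≤ t
      · have hmem' : t - m ∈ T.erase t := by
          refine Finset.mem_erase.2 ⟨fun h' => ?_, hmem⟩
          have : t = 0 := by omega
          exact h.1.1 (this ▸ h.2)
        rw [Finset.prod_eq_zero hmem', mul_zero, mul_zero, zero_smul]
        rw [Nat.cast_sub hmt, sub_self, zero_mul, zero_div]
      · rw [Nat.sub_eq_zero_of_le (not_le.1 hmt).le] at hmem
        exact absurd hmem h.1.1
  · rintro ⟨S, s⟩ h hne hmem
    simp only at hmem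
    apply hne
    simp only
    rw [vertexOp_schurFn_of_mem x (Finset.mem_erase.2 ⟨by omega, hmem⟩), smul_zero]

/-- Here `T` is `S` with the rows `a = m - 1 - b` and `m - a = b + 1` added; they differ because `m`
is odd. Both orders of a pair occur on each side. -/
theorem sum_pair_bar {m : ℕ} (hm : Odd m) (n : ℕ) :
    ∑ S ∈ strictSets n, ∑ b ∈ Finset.range (m - 1), (shiftedWeight K S * (-1 : K) ^ (b + 1)) •
        vertexOp x (m - 1 - b) (vertexOp x (b + 1) (schurFn x S)) =
      ∑ T ∈ strictSets (n + m), ∑ a ∈ T with a < m ∧ m - a ∈ T, (shiftedWeight K T *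
        ((-1 : K) ^ (m - a) *
          ((a.factorial : K) * ((m - a).factorial : K) * m / (a - (m - a : ℕ))) *
        ∏ s ∈ (T.erase a).erase (m - a),
          (((a : K) + s) * ((m - a : ℕ) + s)) / (((a : K) - s) * ((m - a : ℕ) - s)))) •
            schurFn x T := by
  rw [Finset.sum_sigma', Finset.sum_sigma']
  rw [← Finset.sum_filter_of_ne (p := fun q => q.2 + 1 ∉ q.1 ∧ m - 1 - q.2 ∉ q.1)
    (s := (strictSets n).sigma _)]
  · refine Finset.sum_bij' (fun q _ => ⟨insert (m - 1 - q.2) (insert (q.2 + 1) q.1), m - 1 - q.2⟩)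
      (fun q _ => ⟨(q.1.erase q.2).erase (m - q.2), m - 1 - q.2⟩) ?_ ?_ ?_ ?_ ?_
    · rintro ⟨S, b⟩ h
      simp only [Finset.mem_filter, Finset.mem_sigma, mem_strictSets, Finset.mem_range] at h ⊢
      obtain ⟨⟨⟨h0, hn⟩, hb⟩, hb1, hb2⟩ := h
      have hodd : m - 1 - b ≠ b + 1 := by
        obtain ⟨r, rfl⟩ := hm
        omega
      have h1 : m - 1 - b ∉ insert (b + 1) S := by simp [hodd, hb2]
      refine ⟨⟨?_, ?_⟩, Finset.mem_insert_self _ _, by omega, ?_⟩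
      · simp only [Finset.mem_insert, not_or]
        exact ⟨by omega, by omega, h0⟩
      · rw [Finset.sum_insert h1, Finset.sum_insert hb1]
        omega
      · rw [show m - (m - 1 - b) = b + 1 by omega]
        exact Finset.mem_insert_of_mem (Finset.mem_insert_self _ _)
    · rintro ⟨T, a⟩ h
      simp only [Finset.mem_filter, Finset.mem_sigma, mem_strictSets, Finset.mem_range] at h ⊢
      obtain ⟨⟨h0, hn⟩, ha, ham, hma⟩ := h
      have ha0 : a ≠ 0 := fun h => h0 (h ▸ ha)
      have hodd : m - a ≠ a := by
        obtain ⟨r, rfl⟩ := hm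
        omega
      have h1 := Finset.add_sum_erase T (fun u => u) ha
      have h2 := Finset.add_sum_erase (T.erase a) (fun u => u) (Finset.mem_erase.2 ⟨hodd, hma⟩)
      refine ⟨⟨⟨?_, by omega⟩, by omega⟩, ?_, ?_⟩
      · exact fun h => h0 (Finset.mem_of_mem_erase (Finset.mem_of_mem_erase h))
      · rw [show m - 1 - a + 1 = m - a by omega]
        exact Finset.notMem_erase _ _
      · rw [show m - 1 - (m - 1 - a) = a by omega]
        exact fun h => Finset.notMem_erase _ _ (Finset.mem_of_mem_erase h)
    · rintro ⟨S, b⟩ h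
      simp only [Finset.mem_filter, Finset.mem_sigma, mem_strictSets, Finset.mem_range] at h ⊢
      obtain ⟨⟨⟨h0, hn⟩, hb⟩, hb1, hb2⟩ := h
      have hodd : m - 1 - b ≠ b + 1 := by
        obtain ⟨r, rfl⟩ := hm
        omega
      have h1 : m - 1 - b ∉ insert (b + 1) S := by simp [hodd, hb2]
      rw [Sigma.mk.injEq, show m - (m - 1 - b) = b + 1 by omega, Finset.erase_insert h1,
        Finset.erase_insert hb1]
      exact ⟨rfl, heq_of_eq (by omega)⟩
    · rintro ⟨T, a⟩ h
      simp only [Finset.mem_filter, Finset.mem_sigma, mem_strictSets] at h ⊢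
      obtain ⟨⟨h0, hn⟩, ha, ham, hma⟩ := h
      have hodd : m - a ≠ a := by
        obtain ⟨r, rfl⟩ := hm
        omega
      have ha0 : a ≠ 0 := fun h => h0 (h ▸ ha)
      rw [Sigma.mk.injEq, show m - 1 - a + 1 = m - a by omega, show m - 1 - (m - 1 - a) = a by omega,
        Finset.insert_erase (Finset.mem_erase.2 ⟨hodd, hma⟩), Finset.insert_erase ha]
      exact ⟨rfl, HEq.rfl⟩
    · rintro ⟨S, b⟩ h
      simp only [Finset.mem_filter, Finset.mem_sigma, mem_strictSets, Finset.mem_range] at h ⊢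
      obtain ⟨⟨⟨h0, hn⟩, hb⟩, hb1, hb2⟩ := h
      have hodd : m - 1 - b ≠ b + 1 := by
        obtain ⟨r, rfl⟩ := hm
        omega
      have h1 : m - 1 - b ∉ insert (b + 1) S := by simp [hodd, hb2]
      have h2 := shiftedWeight_pair (K := K) h0 hb2 hb1 hodd (by omega)
        (show m - 1 - b + (b + 1) = m by omega)
      rw [vertexOp_schurFn_of_notMem x hb1, map_smul, vertexOp_schurFn_of_notMem x h1, smul_smul,
        smul_smul, show m - (m - 1 - b) = b + 1 by omega, Finset.erase_insert h1,
        Finset.erase_insert hb1]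
      congr 1
      linear_combination (-1 : K) ^ (b + 1) * h2
  · rintro ⟨S, b⟩ h hne
    have hb1 : b + 1 ∉ S := by
      intro hmem
      apply hne
      simp only
      rw [vertexOp_schurFn_of_mem x hmem, map_zero, smul_zero]
    refine ⟨hb1, fun hmem => hne ?_⟩
    simp only at hmem ⊢
    rw [vertexOp_schurFn_of_notMem x hb1, map_smul,
      vertexOp_schurFn_of_mem x (Finset.mem_insert_of_mem hmem), smul_zero, smul_zero]

theorem psumFn_mul_sum_shiftedWeight (hx : Function.Injective x)
    (hx2 : ∀ i j, i ≠ j → x i + x j ≠ 0) {m : ℕ} (hm : Odd m) (n : ℕ) :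
    psumFn x m * ∑ S ∈ strictSets n, shiftedWeight K S • schurFn x S =
      ∑ T ∈ strictSets (n + m), (shiftedWeight K T * barSum K m T) • schurFn x T := by
  have h : ∀ S ∈ strictSets n, psumFn x m * (shiftedWeight K S • schurFn x S) =
      (∑ s ∈ insert 0 S, (shiftedWeight K S * insertSign K s (S.erase s)) •
        vertexOp x (s + m) (schurFn x (S.erase s))) +
      ∑ b ∈ Finset.range (m - 1), (shiftedWeight K S * (-1 : K) ^ (b + 1)) •
        vertexOp x (m - 1 - b) (vertexOp x (b + 1) (schurFn x S)) := by
    intro S hS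
    rw [mul_smul_comm, psumFn_mul_schurFn hx hx2 hm S (mem_strictSets.1 hS).1, smul_add,
      Finset.smul_sum, Finset.smul_sum]
    simp only [smul_smul]
  rw [Finset.mul_sum, Finset.sum_congr rfl h, Finset.sum_add_distrib, sum_single_bar hm.pos.ne',
    sum_pair_bar hm, ← Finset.sum_add_distrib]
  refine Finset.sum_congr rfl fun T _ => ?_
  rw [← Finset.sum_smul, ← Finset.sum_smul, ← add_smul, ← Finset.mul_sum, ← Finset.mul_sum,
    ← mul_add, barSum]

end Expansion

end

/-! ### Agreement of the symmetrization formula with the vertex operators -/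

noncomputable section

section Symmetrization

variable {σ K : Type*} [Field K] (x : σ → K)

/-- The summand of Schur's `P`-function of the strict partition with list of parts `L` that
belongs to an ordering `w` of the variables. -/
def schurSummand (L : List ℕ) {N : ℕ} (w : Fin N → σ) : K :=
  (∏ i : Fin N, x (w i) ^ L.getD i 0) *
    ∏ p : Fin N × Fin N with L.getD p.2 0 < L.getD p.1 0,
      (x (w p.1) + x (w p.2)) / (x (w p.1) - x (w p.2))

theorem schurSummand_nil {N : ℕ} (w : Fin N → σ) : schurSummand x [] w = 1 := by
  simp [schurSummand]

/-- Position `0` carries the strictly largest entry, including against the zeros that pad `L`, so it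
is paired with every other position. -/
theorem schurSummand_cons {a : ℕ} {L : List ℕ} (ha : 0 < a) (hL : ∀ b ∈ L, b < a) {N : ℕ} (i : σ)
    (w : Fin N → σ) :
    schurSummand x (a :: L) (Fin.cons i w : Fin (N + 1) → σ) =
      x i ^ a * (∏ j : Fin N, (x i + x (w j)) / (x i - x (w j))) * schurSummand x L w := by
  have hlt (j : ℕ) : L.getD j 0 < a := by
    rw [List.getD_eq_getElem?_getD]
    rcases h : L[j]? with _ | b
    · simpa using ha
    · simpa using hL b (List.mem_of_getElem? h)
  rw [schurSummand, schurSummand, Finset.prod_filter, Finset.prod_filter, Fintype.prod_prod_type,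
    Fintype.prod_prod_type, Fin.prod_univ_succ, Fin.prod_univ_succ, Fin.prod_univ_succ]
  simp only [Fin.cons_zero, Fin.cons_succ, Fin.val_zero, Fin.val_succ, List.getD_cons_zero,
    List.getD_cons_succ, lt_irrefl, if_false, hlt, if_true, one_mul, Fin.prod_univ_succ (n := N),
    (hlt _).not_gt]
  ring

variable [DecidableEq σ]

/-- Each operator uses up one variable; this matches the convention that `schurP` vanishes when
there are more rows than variables. -/
theorem foldr_vertexOp_eq_zero (L : List ℕ) : ∀ A : Finset σ, A.card < L.length →
    L.foldr (fun a F => vertexOp x a F) 1 A = 0 := by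
  induction L with
  | nil => simp
  | cons a L ih =>
    intro A hA
    rw [List.foldr_cons, vertexOp_apply]
    refine Finset.sum_eq_zero fun i hi => ?_
    rw [ih, mul_zero]
    rw [Finset.card_erase_of_mem hi]
    have := Finset.card_pos.2 ⟨i, hi⟩
    rw [List.length_cons] at hA
    omega

variable [Fintype σ]

open Classical in
/-- The orderings of a finite set of variables. -/
def orderings (N : ℕ) (A : Finset σ) : Finset (Fin N → σ) :=
  Finset.univ.filter fun w => Function.Injective w ∧ Finset.univ.image w = A

theorem mem_orderings {N : ℕ} {A : Finset σ} {w : Fin N → σ} :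
    w ∈ orderings N A ↔ Function.Injective w ∧ Finset.univ.image w = A := by
  classical
  simp [orderings]

theorem cons_mem_orderings {N : ℕ} {A : Finset σ} {i : σ} {w : Fin N → σ} :
    (Fin.cons i w : Fin (N + 1) → σ) ∈ orderings (N + 1) A ↔
      i ∈ A ∧ w ∈ orderings N (A.erase i) := by
  have h : Finset.univ.image (Fin.cons i w : Fin (N + 1) → σ) = insert i (Finset.univ.image w) := by
    ext j
    simp [Fin.exists_fin_succ, eq_comm]
  rw [mem_orderings, mem_orderings, Fin.cons_injective_iff, h]
  have hr : i ∉ Set.range w ↔ i ∉ Finset.univ.image w := by simp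
  rw [hr]
  constructor
  · rintro ⟨⟨h1, h2⟩, rfl⟩
    exact ⟨Finset.mem_insert_self _ _, h2, (Finset.erase_insert h1).symm⟩
  · rintro ⟨h1, h2, h3⟩
    rw [h3]
    exact ⟨⟨Finset.notMem_erase _ _, h2⟩, Finset.insert_erase h1⟩

theorem sum_orderings_succ {N : ℕ} (A : Finset σ) (f : (Fin (N + 1) → σ) → K) :
    ∑ w ∈ orderings (N + 1) A, f w =
      ∑ i ∈ A, ∑ w ∈ orderings N (A.erase i), f (Fin.cons i w) := by
  rw [Finset.sum_sigma']
  refine Finset.sum_bij' (fun w _ => ⟨w 0, Fin.tail w⟩) (fun q _ => Fin.cons q.1 q.2) ?_ ?_ ?_ ?_ ?_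
  · intro w hw
    rw [← Fin.cons_self_tail w, cons_mem_orderings] at hw
    simpa using hw
  · rintro ⟨i, w⟩ h
    exact cons_mem_orderings.2 (by simpa using h)
  · intro w _
    simp
  · rintro ⟨i, w⟩ _
    simp
  · intro w _
    simp

/-- Choosing the first variable of an ordering is one application of a vertex operator. Once the
rows are exhausted the summand is `1`, and the orderings of the remaining variables give the
factorial. -/
theorem sum_schurSummand {N : ℕ} : ∀ (L : List ℕ) (A : Finset σ), L.Pairwise (fun a b => b < a) →
    (∀ a ∈ L, 0 < a) → L.length ≤ N → A.card = N →
    ∑ w ∈ orderings N A, schurSummand x L w =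
      ((N - L.length).factorial : ℕ) * L.foldr (fun a F => vertexOp x a F) 1 A := by
  induction N with
  | zero =>
    intro L A _ _ hl hA
    obtain rfl := List.length_eq_zero_iff.1 (Nat.le_zero.1 hl)
    obtain rfl := Finset.card_eq_zero.1 hA
    have : orderings 0 (∅ : Finset σ) = Finset.univ :=
      Finset.eq_univ_of_forall fun w =>
        mem_orderings.2 ⟨Function.injective_of_subsingleton w, by simp⟩
    simp [schurSummand_nil, this]
  | succ N ih =>
    intro L A hL hpos hl hA
    rw [sum_orderings_succ]
    have hcard : ∀ i ∈ A, (A.erase i).card = N := fun i hi => by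
      rw [Finset.card_erase_of_mem hi, hA, Nat.add_sub_cancel]
    rcases L with _ | ⟨a, L⟩
    · have : ∀ i ∈ A, ∑ w ∈ orderings N (A.erase i),
          schurSummand x [] (Fin.cons i w : Fin (N + 1) → σ) = (N.factorial : K) := by
        intro i hi
        have h := ih [] (A.erase i) hL hpos (Nat.zero_le _) (hcard i hi)
        simp only [schurSummand_nil] at h ⊢
        simpa using h
      rw [Finset.sum_congr rfl this, Finset.sum_const, hA]
      simp [Nat.factorial_succ]
    · rw [List.foldr_cons, vertexOp_apply, Finset.mul_sum]
      refine Finset.sum_congr rfl fun i hi => ?_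
      have h := ih L (A.erase i) hL.of_cons (fun b hb => hpos b (List.mem_cons_of_mem a hb))
        (by simpa using hl) (hcard i hi)
      have h2 : ∀ w ∈ orderings N (A.erase i),
          schurSummand x (a :: L) (Fin.cons i w : Fin (N + 1) → σ) =
          x i ^ a * (∏ k ∈ A.erase i, (x i + x k) / (x i - x k)) * schurSummand x L w := by
        intro w hw
        obtain ⟨h3, h4⟩ := mem_orderings.1 hw
        rw [schurSummand_cons x (hpos a List.mem_cons_self) (List.pairwise_cons.1 hL).1, ← h4,
          Finset.prod_image h3.injOn]
      rw [Finset.sum_congr rfl h2, ← Finset.mul_sum, h, List.length_cons, Nat.add_sub_add_right]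
      ring

end Symmetrization

theorem sum_perm_eq_sum_orderings {K : Type*} [Field K] {N : ℕ} (f : (Fin N → Fin N) → K) :
    ∑ w : Equiv.Perm (Fin N), f w = ∑ w ∈ orderings N Finset.univ, f w := by
  refine Finset.sum_bij (fun w _ => ⇑w) ?_ ?_ ?_ ?_
  · intro w _
    exact mem_orderings.2 ⟨w.injective, Finset.image_univ_of_surjective w.surjective⟩
  · intro w _ w' _ h
    exact Equiv.coe_fn_injective h
  · intro w hw
    have h := (mem_orderings.1 hw).1
    exact ⟨Equiv.ofBijective w (Finite.injective_iff_bijective.1 h), Finset.mem_univ _, rfl⟩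
  · intro w _
    rfl

theorem schurP_eq_schurFn {n : ℕ} (lam : StrictPartition n) (N : ℕ) :
    schurP lam N = schurFn (schurVar N) lam.partSet Finset.univ := by
  have hsort : lam.partSet.sort (fun a b => b ≤ a) = lam.1.parts.sort (fun a b => b ≤ a) := by
    rw [StrictPartition.partSet, ← Finset.sort_val, Multiset.toFinset_val, lam.2.dedup]
  have hlen : (lam.1.parts.sort (fun a b => b ≤ a)).length = lam.length := by
    rw [Multiset.length_sort, StrictPartition.length]
  rw [schurFn, hsort]
  rw [schurP]
  split_ifs with h
  · have hpw : (lam.1.parts.sort (fun a b => b ≤ a)).Pairwise (fun a b => b < a) := by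
      rw [← hsort]
      refine ((Finset.pairwise_sort _ _).and (Finset.sort_nodup _ _)).imp ?_
      rintro a b ⟨h1, h2⟩
      exact lt_of_le_of_ne h1 h2.symm
    have key := sum_schurSummand (schurVar N) _ (Finset.univ : Finset (Fin N)) hpw
      (fun a ha => lam.1.parts_pos (by simpa using ha)) (hlen.trans_le h) (by simp)
    rw [← sum_perm_eq_sum_orderings, hlen] at key
    have : (((N - lam.length).factorial : ℕ) : FractionRing (MvPolynomial (Fin N) ℚ)) ≠ 0 :=
      Nat.cast_ne_zero.2 (Nat.factorial_ne_zero _)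
    rw [inv_mul_eq_iff_eq_mul₀ this, ← key]
    rfl
  · rw [foldr_vertexOp_eq_zero]
    rw [hlen]
    simpa using h

end

/-! ### Linear independence of the `P`-functions and uniqueness of expansions -/

noncomputable section

namespace StrictPartition

variable {n : ℕ}

theorem length_sort_parts (lam : StrictPartition n) :
    (lam.1.parts.sort (fun a b => b ≤ a)).length = lam.length := by
  rw [Multiset.length_sort, length]

theorem strictAnti_part (lam : StrictPartition n) {N : ℕ} (h : lam.length = N) :
    StrictAnti fun i : Fin N => lam.part i := by
  intro i j hij
  have hl := lam.length_sort_parts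
  have hpw : (lam.1.parts.sort (fun a b => b ≤ a)).Pairwise (fun a b => b < a) := by
    have hnd : (lam.1.parts.sort (fun a b => b ≤ a)).Nodup := by
      rw [← Multiset.coe_nodup, Multiset.sort_eq]
      exact lam.2
    refine ((Multiset.pairwise_sort _ _).and hnd).imp ?_
    rintro a b ⟨h1, h2⟩
    exact lt_of_le_of_ne h1 h2.symm
  have hi : (i : ℕ) < (lam.1.parts.sort (fun a b => b ≤ a)).length := by omega
  have hj : (j : ℕ) < (lam.1.parts.sort (fun a b => b ≤ a)).length := by omega
  simp only [part]
  rw [List.getD_eq_getElem _ _ hi, List.getD_eq_getElem _ _ hj]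
  exact List.pairwise_iff_getElem.1 hpw i j hi hj hij

theorem ext_part {lam mu : StrictPartition n} {N : ℕ} (h1 : lam.length = N) (h2 : mu.length = N)
    (h : ∀ i : Fin N, lam.part i = mu.part i) : lam = mu := by
  have hs : lam.1.parts.sort (fun a b => b ≤ a) = mu.1.parts.sort (fun a b => b ≤ a) := by
    refine List.ext_getElem (by rw [length_sort_parts, length_sort_parts, h1, h2]) ?_
    intro i hi hj
    have := h ⟨i, by rwa [← h1, ← length_sort_parts]⟩
    simp only [part] at this
    rwa [List.getD_eq_getElem _ _ hi, List.getD_eq_getElem _ _ hj] at this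
  apply Subtype.ext
  apply Nat.Partition.ext
  rw [← Multiset.sort_eq lam.1.parts (fun a b => b ≤ a), hs, Multiset.sort_eq]

theorem partSet_injective : Function.Injective (partSet : StrictPartition n → Finset ℕ) := by
  intro lam mu h
  apply Subtype.ext
  apply Nat.Partition.ext
  have h' := congrArg Finset.val h
  rwa [partSet, partSet, Multiset.toFinset_val, Multiset.toFinset_val, lam.2.dedup,
    mu.2.dedup] at h'

theorem sum_partSet (lam : StrictPartition n) : ∑ s ∈ lam.partSet, s = n := by
  conv_rhs => rw [← lam.1.parts_sum]
  rw [Finset.sum, partSet, Multiset.toFinset_val, lam.2.dedup, Multiset.map_id']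

theorem sum_eq_sum_strictSets {M : Type*} [AddCommMonoid M] (f : Finset ℕ → M) :
    ∑ lam : StrictPartition n, f lam.partSet = ∑ S ∈ strictSets n, f S := by
  refine Finset.sum_bij (fun lam _ => lam.partSet) ?_ ?_ ?_ ?_
  · exact fun lam _ => mem_strictSets.2 ⟨lam.zero_notMem_partSet, lam.sum_partSet⟩
  · exact fun lam _ mu _ h => partSet_injective h
  · intro S hS
    obtain ⟨h0, hn⟩ := mem_strictSets.1 hS
    refine ⟨⟨⟨S.val, fun {i} hi => Nat.pos_of_ne_zero fun h => h0 (h ▸ hi), ?_⟩, S.nodup⟩,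
      Finset.mem_univ _, ?_⟩
    · rw [← hn, Finset.sum, Multiset.map_id']
    · exact Finset.val_toFinset S
  · exact fun _ _ => rfl

end StrictPartition

theorem schurVar_injective (N : ℕ) : Function.Injective (schurVar N) :=
  (IsFractionRing.injective (MvPolynomial (Fin N) ℚ) _).comp (MvPolynomial.X_injective)

theorem schurVar_add_ne_zero {N : ℕ} {i j : Fin N} (h : i ≠ j) :
    schurVar N i + schurVar N j ≠ 0 := by
  rw [schurVar, schurVar, ← map_add]
  intro h0
  have h1 := (IsFractionRing.injective (MvPolynomial (Fin N) ℚ)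
    (FractionRing (MvPolynomial (Fin N) ℚ))) (h0.trans (map_zero _).symm)
  have h2 := congrArg (MvPolynomial.eval fun k => if k = i then (1 : ℚ) else 0) h1
  simp [h.symm] at h2

theorem perm_eq_one_of_strictAnti {N : ℕ} {μ ν : Fin N → ℕ} (hμ : StrictAnti μ) (hν : StrictAnti ν)
    {w : Equiv.Perm (Fin N)} (h : ∀ i, μ i = ν (w i)) : w = 1 := by
  have hw : StrictMono w := by
    intro i j hij
    have := hμ hij
    rw [h, h] at this
    exact hν.lt_iff_gt.1 this
  have : (w : Fin N → Fin N) = id :=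
    (StrictMono.range_inj hw strictMono_id).1 (by simp)
  exact Equiv.ext fun i => congrFun this i

/-- The antisymmetrization of the monomial with exponent `μ`. -/
def alternant {N : ℕ} (μ : Fin N → ℕ) : MvPolynomial (Fin N) ℚ :=
  ∑ w : Equiv.Perm (Fin N), ((w.sign : ℤ) : MvPolynomial (Fin N) ℚ) *
    ∏ i, MvPolynomial.X (w i) ^ μ i

/-- A monomial with strictly decreasing exponents arises only from the identity permutation. -/
theorem coeff_alternant {N : ℕ} {μ ν : Fin N → ℕ} (hμ : StrictAnti μ) (hν : StrictAnti ν) :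
    MvPolynomial.coeff (Finsupp.equivFunOnFinite.symm ν) (alternant μ) =
      if μ = ν then 1 else 0 := by
  have hmon : ∀ w : Equiv.Perm (Fin N), ∏ i, (MvPolynomial.X (w i) : MvPolynomial (Fin N) ℚ) ^ μ i =
      MvPolynomial.monomial (Finsupp.equivFunOnFinite.symm (μ ∘ w.symm)) 1 := by
    intro w
    rw [MvPolynomial.monomial_eq, map_one, one_mul, Finsupp.prod_fintype _ _ (by simp)]
    conv_rhs => rw [← Equiv.prod_comp w]
    simp
  have hcoeff : ∀ w : Equiv.Perm (Fin N), MvPolynomial.coeff (Finsupp.equivFunOnFinite.symm ν)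
      (((w.sign : ℤ) : MvPolynomial (Fin N) ℚ) * ∏ i, MvPolynomial.X (w i) ^ μ i) =
      if w = 1 then (if μ = ν then 1 else 0) else 0 := by
    intro w
    rw [hmon, ← map_intCast (MvPolynomial.C : ℚ →+* MvPolynomial (Fin N) ℚ),
      MvPolynomial.coeff_C_mul, MvPolynomial.coeff_monomial]
    by_cases hw : w = 1
    · subst hw
      simp [Equiv.Perm.one_def]
    · rw [if_neg hw, if_neg, mul_zero]
      intro h
      have h' := Finsupp.equivFunOnFinite.symm.injective h
      refine hw (perm_eq_one_of_strictAnti hμ hν fun i => ?_)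
      rw [← h']
      simp
  rw [alternant, MvPolynomial.coeff_sum, Finset.sum_congr rfl fun w _ => hcoeff w]
  simp

/-- With as many variables as rows every pair of positions enters the product, which is then
antisymmetric under permutations and factors out of the sum with the sign. -/
theorem schurP_eq_alternant {n : ℕ} (lam : StrictPartition n) {N : ℕ} (h : lam.length = N) :
    schurP lam N = algebraMap (MvPolynomial (Fin N) ℚ) _ (alternant fun i : Fin N => lam.part i) *
      ∏ j, ∏ i ∈ Finset.Iio j,
        (schurVar N i + schurVar N j) / (schurVar N i - schurVar N j) := by
  rw [schurP, if_pos h.le, h, Nat.sub_self, Nat.factorial_zero, Nat.cast_one, inv_one, one_mul,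
    alternant, map_sum, Finset.sum_mul]
  refine Finset.sum_congr rfl fun w _ => ?_
  have hanti := lam.strictAnti_part h
  have h1 : ∏ p : Fin N × Fin N with lam.part p.2 < lam.part p.1,
      (schurVar N (w p.1) + schurVar N (w p.2)) / (schurVar N (w p.1) - schurVar N (w p.2)) =
      ∏ j, ∏ i ∈ Finset.Iio j,
        (schurVar N (w i) + schurVar N (w j)) / (schurVar N (w i) - schurVar N (w j)) := by
    rw [Finset.prod_sigma']
    refine Finset.prod_bij' (fun p _ => ⟨p.2, p.1⟩) (fun q _ => (q.2, q.1)) ?_ ?_ ?_ ?_ ?_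
    · intro p hp
      have := hanti.lt_iff_gt.1 (Finset.mem_filter.1 hp).2
      simpa using this
    · intro q hq
      have : q.2 < q.1 := by simpa using hq
      simpa using hanti this
    · exact fun _ _ => rfl
    · exact fun _ _ => rfl
    · exact fun _ _ => rfl
  have hk := w.prod_Iio_comp_eq_sign_mul_prod
    (f := fun i j => (schurVar N i + schurVar N j) / (schurVar N i - schurVar N j)) (by
      intro i j
      rw [← neg_sub (schurVar N j), div_neg, add_comm])
  rw [h1, hk, map_mul, map_prod, map_intCast]
  simp only [map_pow, schurVar]
  ring

/-- Induction on the number of rows, testing the relation for partitions with `N` rows in exactly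
`N` variables, where it becomes a relation between alternants. -/
theorem schurP_independent {n : ℕ} (c : StrictPartition n → ℚ)
    (hc : ∀ N : ℕ, ∑ lam : StrictPartition n,
      algebraMap ℚ (FractionRing (MvPolynomial (Fin N) ℚ)) (c lam) * schurP lam N = 0) :
    c = 0 := by
  have key : ∀ N : ℕ, ∀ lam : StrictPartition n, lam.length = N → c lam = 0 := by
    intro N
    induction N using Nat.strong_induction_on with
    | _ N ih =>
      intro mu hmu
      have h := hc N
      -- Coefficients of partitions with fewer rows vanish by induction, and `P`-functions with more
      -- than `N` rows vanish in `N` variables.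
      rw [← Finset.sum_filter_of_ne (p := fun lam => lam.length = N)] at h
      · have h2 : ∀ lam ∈ Finset.univ.filter (fun lam : StrictPartition n => lam.length = N),
            algebraMap ℚ (FractionRing (MvPolynomial (Fin N) ℚ)) (c lam) * schurP lam N =
            algebraMap (MvPolynomial (Fin N) ℚ) _
              (MvPolynomial.C (c lam) * alternant fun i : Fin N => lam.part i) *
            ∏ j, ∏ i ∈ Finset.Iio j,
              (schurVar N i + schurVar N j) / (schurVar N i - schurVar N j) := by
          intro lam hlam
          rw [schurP_eq_alternant lam (Finset.mem_filter.1 hlam).2, map_mul,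
            IsScalarTower.algebraMap_apply ℚ (MvPolynomial (Fin N) ℚ)
              (FractionRing (MvPolynomial (Fin N) ℚ)), MvPolynomial.algebraMap_eq, mul_assoc]
        rw [Finset.sum_congr rfl h2, ← Finset.sum_mul, ← map_sum] at h
        have h3 : ∏ j, ∏ i ∈ Finset.Iio j,
            (schurVar N i + schurVar N j) / (schurVar N i - schurVar N j) ≠ 0 := by
          refine Finset.prod_ne_zero_iff.2 fun j _ => Finset.prod_ne_zero_iff.2 fun i hi => ?_
          have hij : i ≠ j := (Finset.mem_Iio.1 hi).ne
          exact div_ne_zero (schurVar_add_ne_zero hij)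
            (sub_ne_zero.2 fun h => hij (schurVar_injective N h))
        have h4 := (mul_eq_zero.1 h).resolve_right h3
        have h5 := IsFractionRing.injective (MvPolynomial (Fin N) ℚ)
          (FractionRing (MvPolynomial (Fin N) ℚ)) (h4.trans (map_zero _).symm)
        have h6 := congrArg (MvPolynomial.coeff
          (Finsupp.equivFunOnFinite.symm fun i : Fin N => mu.part i)) h5
        rw [MvPolynomial.coeff_sum, MvPolynomial.coeff_zero, Finset.sum_eq_single mu] at h6
        · rw [MvPolynomial.coeff_C_mul, coeff_alternant (mu.strictAnti_part hmu)
            (mu.strictAnti_part hmu), if_pos rfl, mul_one] at h6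
          exact h6
        · intro lam hlam hne
          have hl := (Finset.mem_filter.1 hlam).2
          rw [MvPolynomial.coeff_C_mul, coeff_alternant (lam.strictAnti_part hl)
            (mu.strictAnti_part hmu), if_neg, mul_zero]
          exact fun h => hne (StrictPartition.ext_part hl hmu fun i => congrFun h i)
        · intro h
          simp [hmu] at h
      · intro lam _ hne
        by_contra hl
        rcases lt_or_gt_of_ne hl with hlt | hgt
        · exact hne (by rw [ih _ hlt lam rfl, map_zero, zero_mul])
        · exact hne (by rw [schurP, if_neg hgt.not_ge, mul_zero])
  exact funext fun lam => key _ lam rfl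

theorem spinX_eq {n : ℕ} {ρ : n.Partition} {c : StrictPartition n → ℚ}
    (hc : IsSchurPExpansion ρ c) (lam : StrictPartition n) : spinX lam ρ = c lam := by
  have hu : ∀ c', IsSchurPExpansion ρ c' → c' = c := by
    intro c' hc'
    refine sub_eq_zero.1 (schurP_independent (c' - c) fun N => ?_)
    have h1 := hc N
    have h2 := hc' N
    rw [h2] at h1
    rw [← sub_eq_zero.2 h1, ← Finset.sum_sub_distrib]
    refine Finset.sum_congr rfl fun lam _ => ?_
    rw [Pi.sub_apply, map_sub, sub_mul]
  have h : ∃! c : StrictPartition n → ℚ, IsSchurPExpansion ρ c := ⟨c, hc, hu⟩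
  rw [spinX, dif_pos h, hu _ h.exists.choose_spec]

end

/-! ### Expansions at infinity and sums of residues -/

noncomputable section

section AtInfinity

variable {K : Type*} [Field K]

/-- The expansion at infinity of a polynomial, as a Laurent series in the reciprocal variable. -/
def expandAtInfty : Polynomial K →+* LaurentSeries K :=
  Polynomial.eval₂RingHom HahnSeries.C (HahnSeries.single (-1) 1)

theorem expandAtInfty_X_sub_C (c : K) :
    expandAtInfty (Polynomial.X - Polynomial.C c) =
      HahnSeries.single (-1) 1 * ((1 - PowerSeries.C c * PowerSeries.X : PowerSeries K) :
        LaurentSeries K) := by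
  simp [expandAtInfty, mul_sub, HahnSeries.C_apply, HahnSeries.single_mul_single]

theorem expandAtInfty_X_sq_sub_C (c : K) :
    expandAtInfty (Polynomial.X ^ 2 - Polynomial.C c) =
      HahnSeries.single (-2) 1 * ((1 - PowerSeries.C c * PowerSeries.X ^ 2 : PowerSeries K) :
        LaurentSeries K) := by
  simp [expandAtInfty, mul_sub, HahnSeries.C_apply, HahnSeries.single_mul_single, pow_two]

theorem expandAtInfty_eq_sum (p : Polynomial K) :
    expandAtInfty p = ∑ j ∈ Finset.range (p.natDegree + 1),
      HahnSeries.single (-(j : ℤ)) (p.coeff j) := by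
  rw [expandAtInfty, Polynomial.coe_eval₂RingHom, Polynomial.eval₂_eq_sum_range]
  refine Finset.sum_congr rfl fun j _ => ?_
  rw [HahnSeries.single_pow, HahnSeries.C_apply, HahnSeries.single_mul_single]
  simp

theorem coeff_one_expandAtInfty_mul (p : Polynomial K) (E : PowerSeries K) :
    (expandAtInfty p * (E : LaurentSeries K)).coeff 1 =
      ∑ j ∈ Finset.range (p.natDegree + 1), p.coeff j * PowerSeries.coeff (j + 1) E := by
  rw [expandAtInfty_eq_sum, Finset.sum_mul, HahnSeries.coeff_sum]
  refine Finset.sum_congr rfl fun j _ => ?_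
  have h : (1 : ℤ) = ((j + 1 : ℕ) : ℤ) + -(j : ℤ) := by push_cast; ring
  rw [h, HahnSeries.coeff_single_mul_add, LaurentSeries.coeff_coe_powerSeries]

/-- The leading coefficient of the polynomial is the coefficient of the lowest power of the
reciprocal variable. -/
theorem expandAtInfty_injective : Function.Injective (expandAtInfty (K := K)) := by
  rw [injective_iff_map_eq_zero]
  intro p hp
  by_contra hne
  have h := congrArg (fun f => HahnSeries.coeff f (-(p.natDegree : ℤ))) hp
  simp only [expandAtInfty_eq_sum, HahnSeries.coeff_sum, HahnSeries.coeff_zero] at h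
  rw [Finset.sum_eq_single p.natDegree] at h
  · rw [HahnSeries.coeff_single_same] at h
    exact hne (Polynomial.leadingCoeff_eq_zero.1 h)
  · intro j _ hj
    rw [HahnSeries.coeff_single_of_ne]
    simpa using hj.symm
  · simp

theorem inv_expandAtInfty_X_sub_C (c : K) :
    (expandAtInfty (Polynomial.X - Polynomial.C c))⁻¹ =
      HahnSeries.single 1 1 *
        (((1 - PowerSeries.C c * PowerSeries.X)⁻¹ : PowerSeries K) : LaurentSeries K) := by
  have h : ((1 - PowerSeries.C c * PowerSeries.X) : PowerSeries K) *
      (1 - PowerSeries.C c * PowerSeries.X)⁻¹ = 1 := PowerSeries.mul_inv_cancel _ (by simp)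
  refine inv_eq_of_mul_eq_one_right ?_
  rw [expandAtInfty_X_sub_C, mul_mul_mul_comm, ← PowerSeries.coe_mul, h,
    HahnSeries.single_mul_single]
  simp

theorem coeff_one_C_mul_inv_expandAtInfty (a c : K) :
    (HahnSeries.C a * (expandAtInfty (Polynomial.X - Polynomial.C c))⁻¹ :
      LaurentSeries K).coeff 1 = a := by
  rw [inv_expandAtInfty_X_sub_C, HahnSeries.C_apply, ← mul_assoc, HahnSeries.single_mul_single,
    zero_add, mul_one]
  have h := HahnSeries.coeff_single_mul_add (r := a) (a := ((0 : ℕ) : ℤ)) (b := (1 : ℤ))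
    (x := (((1 - PowerSeries.C c * PowerSeries.X)⁻¹ : PowerSeries K) : LaurentSeries K))
  rw [LaurentSeries.coeff_coe_powerSeries, Nat.cast_zero, zero_add] at h
  rw [h]
  simp

/-- The sum of the residues of a rational function with simple poles. -/
theorem coeff_one_div_eq_sum [DecidableEq K] (N : Polynomial K) (Ω : Finset K) :
    (expandAtInfty N / expandAtInfty (∏ ω ∈ Ω, (Polynomial.X - Polynomial.C ω))).coeff 1 =
      ∑ ω ∈ Ω, N.eval ω / ∏ ω' ∈ Ω.erase ω, (ω - ω') := by
  set D := ∏ ω ∈ Ω, (Polynomial.X - Polynomial.C ω) with hD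
  have hmonic : D.Monic := Polynomial.monic_prod_X_sub_C _ _
  have hD0 : expandAtInfty D ≠ 0 := fun h => hmonic.ne_zero
    (expandAtInfty_injective (h.trans (map_zero _).symm))
  have hdeg : (N %ₘ D).degree < Ω.card := by
    refine (Polynomial.degree_modByMonic_lt N hmonic).trans_eq ?_
    rw [hD, Polynomial.degree_prod]
    simp
  -- Lagrange interpolation of the remainder modulo `D` is the partial fraction decomposition; the
  -- polynomial quotient has no term of order `1` at infinity.
  have hlag := Lagrange.eq_interpolate (s := Ω) (v := id) Function.injective_id.injOn hdeg
  have heval : ∀ ω ∈ Ω, (N %ₘ D).eval ω = N.eval ω := by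
    intro ω hω
    have h0 : D.eval ω = 0 := by
      rw [hD, Polynomial.eval_prod]
      exact Finset.prod_eq_zero hω (by simp)
    conv_rhs => rw [← Polynomial.modByMonic_add_div N D]
    rw [Polynomial.eval_add, Polynomial.eval_mul, h0, zero_mul, add_zero]
  have hterm : ∀ ω ∈ Ω, expandAtInfty (Polynomial.C ((N %ₘ D).eval ω) * Lagrange.basis Ω id ω) /
      expandAtInfty D = HahnSeries.C (N.eval ω / ∏ ω' ∈ Ω.erase ω, (ω - ω')) *
        (expandAtInfty (Polynomial.X - Polynomial.C ω))⁻¹ := by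
    intro ω hω
    have hb : Lagrange.basis Ω id ω = Polynomial.C (∏ ω' ∈ Ω.erase ω, (ω - ω'))⁻¹ *
        ∏ ω' ∈ Ω.erase ω, (Polynomial.X - Polynomial.C ω') := by
      rw [Lagrange.basis, ← Finset.prod_inv_distrib, map_prod, ← Finset.prod_mul_distrib]
      rfl
    have hsplit : D = (Polynomial.X - Polynomial.C ω) *
        ∏ ω' ∈ Ω.erase ω, (Polynomial.X - Polynomial.C ω') := (Finset.mul_prod_erase _ _ hω).symm
    rw [hsplit, map_mul] at hD0
    have h1 := left_ne_zero_of_mul hD0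
    have h2 := right_ne_zero_of_mul hD0
    have hC : ∀ a : K, expandAtInfty (Polynomial.C a) = HahnSeries.C a := by
      intro a
      simp [expandAtInfty]
    rw [hb, heval ω hω, hsplit]
    simp only [map_mul, hC, div_eq_mul_inv (N.eval ω)]
    rw [← mul_assoc, mul_div_mul_right _ _ h2, div_eq_mul_inv]
  have hN : expandAtInfty N / expandAtInfty D = expandAtInfty (N /ₘ D) +
      ∑ ω ∈ Ω, HahnSeries.C (N.eval ω / ∏ ω' ∈ Ω.erase ω, (ω - ω')) *
        (expandAtInfty (Polynomial.X - Polynomial.C ω))⁻¹ := by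
    conv_lhs => rw [← Polynomial.modByMonic_add_div N D]
    rw [map_add, map_mul, add_div, mul_div_cancel_left₀ _ hD0, add_comm]
    congr 1
    conv_lhs => rw [hlag]
    rw [Lagrange.interpolate_apply, map_sum, Finset.sum_div]
    exact Finset.sum_congr rfl hterm
  have hpoly := coeff_one_expandAtInfty_mul (N /ₘ D) 1
  rw [PowerSeries.coe_one, mul_one] at hpoly
  rw [hN, HahnSeries.coeff_add, hpoly, HahnSeries.coeff_sum]
  rw [Finset.sum_eq_zero, zero_add]
  · exact Finset.sum_congr rfl fun ω _ => coeff_one_C_mul_inv_expandAtInfty _ _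
  · intro j _
    rw [PowerSeries.coeff_one, if_neg (Nat.succ_ne_zero j), mul_zero]

/-- The expansion of `∏ (1 - (t + h)² u²) / (1 - (t - h)² u²)` in powers of `u`. -/
def evenQuotient (h : K) (T : Finset ℕ) : PowerSeries K :=
  ∏ t ∈ T, (1 - PowerSeries.C (((t : K) + h) ^ 2) * PowerSeries.X ^ 2) *
    (1 - PowerSeries.C (((t : K) - h) ^ 2) * PowerSeries.X ^ 2)⁻¹

theorem expandAtInfty_div_eq_evenQuotient (h : K) (T : Finset ℕ) :
    expandAtInfty (∏ t ∈ T, (Polynomial.X ^ 2 - Polynomial.C (((t : K) + h) ^ 2))) /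
      expandAtInfty (∏ t ∈ T, (Polynomial.X ^ 2 - Polynomial.C (((t : K) - h) ^ 2))) =
      (evenQuotient h T : LaurentSeries K) := by
  rw [map_prod, map_prod, ← Finset.prod_div_distrib, evenQuotient, map_prod]
  refine Finset.prod_congr rfl fun t _ => ?_
  have hinv : (1 - PowerSeries.C (((t : K) - h) ^ 2) * PowerSeries.X ^ 2 : PowerSeries K) *
      (1 - PowerSeries.C (((t : K) - h) ^ 2) * PowerSeries.X ^ 2)⁻¹ = 1 :=
    PowerSeries.mul_inv_cancel _ (by simp)
  have hinv' := congrArg (fun f : PowerSeries K => (f : LaurentSeries K)) hinv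
  simp only [PowerSeries.coe_mul, PowerSeries.coe_one] at hinv'
  rw [expandAtInfty_X_sq_sub_C, expandAtInfty_X_sq_sub_C, PowerSeries.coe_mul]
  have hs : (HahnSeries.single (-2) 1 : LaurentSeries K) ≠ 0 := by simp
  have hne := left_ne_zero_of_mul_eq_one hinv'
  rw [mul_div_mul_left _ _ hs, div_eq_iff hne, mul_assoc,
    mul_comm (((1 - _)⁻¹ : PowerSeries K) : LaurentSeries K), hinv', mul_one]

end AtInfinity

end

/-! ### The bar sum as a sum of residues -/

noncomputable section

section BarResidue

variable {K : Type*} [Field K] [CharZero K]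

theorem cast_descFactorial_eq_prod_Ico (t : ℕ) {m : ℕ} (hm : 0 < m) :
    (t.descFactorial m : K) = t * ∏ s ∈ Finset.Ico 1 m, ((t : K) - s) := by
  rw [← descPochhammer_eval_eq_descFactorial, descPochhammer_eval_eq_prod_range,
    Finset.range_eq_Ico, Finset.prod_eq_prod_Ico_succ_bot hm]
  simp

/-- The factors with `s < a` give `(a - 1)!` and those with `s > a` give `(-1)^(b - 1) (b - 1)!`. -/
theorem prod_Ico_erase_sub {a b : ℕ} (ha : 0 < a) (hb : 0 < b) :
    (a * b : K) * ∏ s ∈ (Finset.Ico 1 (a + b)).erase a, ((a : K) - s) =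
      -((-1) ^ b * (a.factorial * b.factorial)) := by
  have h1 : (Finset.Ico 1 (a + b)).erase a = Finset.Ico 1 a ∪ Finset.Ico (a + 1) (a + b) := by
    ext s
    simp only [Finset.mem_erase, Finset.mem_Ico, Finset.mem_union]
    omega
  have h2 : Disjoint (Finset.Ico 1 a) (Finset.Ico (a + 1) (a + b)) := by
    rw [Finset.disjoint_left]
    intro s
    simp only [Finset.mem_Ico]
    omega
  have h3 := cast_descFactorial_eq_prod_Ico (K := K) a ha
  rw [Nat.descFactorial_self] at h3
  have h4 : (b : K) * ∏ s ∈ Finset.Ico (a + 1) (a + b), ((a : K) - s) =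
      -((-1) ^ b * b.factorial) := by
    obtain ⟨c, rfl⟩ := Nat.exists_eq_add_of_lt hb
    rw [Finset.prod_Ico_eq_prod_range, zero_add, show a + (c + 1) - (a + 1) = c by omega]
    have : ∀ i ∈ Finset.range c, (a : K) - (a + 1 + i : ℕ) = -1 * ((i + 1 : ℕ) : K) := by
      intro i _
      push_cast
      ring
    rw [Finset.prod_congr rfl this, Finset.prod_mul_distrib, Finset.prod_const, Finset.card_range,
      ← Nat.cast_prod, Finset.prod_range_add_one_eq_factorial, Nat.factorial_succ]
    push_cast
    ring
  rw [h1, Finset.prod_union h2, h3]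
  linear_combination (a : K) * (∏ s ∈ Finset.Ico 1 a, ((a : K) - s)) * h4

variable (K) in
/-- The point of the diagram that belongs to `s` in coordinates centred for `m`-bars. -/
def centred (m s : ℕ) : K := (s : K) - m / 2

theorem centred_injective (m : ℕ) : Function.Injective (centred K m) := by
  intro s t h
  exact Nat.cast_injective (sub_left_injective h)

theorem neg_centred_injective (m : ℕ) : Function.Injective fun t => -centred K m t :=
  neg_injective.comp (centred_injective m)

/-- The two families of poles meet exactly at pairs of parts with sum `m`. -/
theorem centred_eq_neg_iff {m s t : ℕ} : centred K m s = -centred K m t ↔ s + t = m := by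
  rw [centred, centred, ← Nat.cast_inj (R := K), Nat.cast_add]
  constructor
  · intro h
    linear_combination h
  · intro h
    linear_combination h

theorem centred_ne_zero {m : ℕ} (hm : Odd m) (t : ℕ) : centred K m t ≠ 0 := by
  intro h
  obtain ⟨r, rfl⟩ := hm
  have := (centred_eq_neg_iff (K := K) (m := 2 * r + 1) (s := t) (t := t)).1 (by rw [h, neg_zero])
  omega

variable [DecidableEq K]

/-- The nodes at which the rational function of an `m`-bar has poles. -/
def barNodes (m : ℕ) (T : Finset ℕ) : Finset K :=
  T.image (centred K m) ∪ T.image (fun t => -centred K m t)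

/-- The nodes at which a pole of second order is cancelled by a zero of the numerator. -/
def barDoubleNodes (m : ℕ) (T : Finset ℕ) : Finset K :=
  T.image (centred K m) ∩ T.image (fun t => -centred K m t)

/-- The reduced numerator of the rational function of an `m`-bar. -/
def barNumerator (m : ℕ) (T : Finset ℕ) : Polynomial K :=
  Polynomial.C 2 * Polynomial.X *
    (∏ s ∈ (Finset.Ico 1 m).image (centred K m) \ barDoubleNodes m T,
      (Polynomial.X - Polynomial.C s)) *
    ∏ t ∈ T, (Polynomial.X ^ 2 - Polynomial.C (((t : K) + m / 2) ^ 2))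

theorem centred_mem_barDoubleNodes {m t : ℕ} {T : Finset ℕ} (ht : t ∈ T) (h0 : 0 ∉ T) :
    centred K m t ∈ barDoubleNodes m T ↔ t < m ∧ m - t ∈ T := by
  rw [barDoubleNodes, Finset.mem_inter, Finset.mem_image, Finset.mem_image]
  constructor
  · rintro ⟨-, u, hu, h⟩
    have h' := centred_eq_neg_iff.1 h.symm
    have : u ≠ 0 := fun h => h0 (h ▸ hu)
    refine ⟨by omega, ?_⟩
    rwa [show m - t = u by omega]
  · rintro ⟨h1, h2⟩
    exact ⟨⟨t, ht, rfl⟩, m - t, h2, (centred_eq_neg_iff.2 (by omega)).symm⟩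

theorem neg_centred_mem_barDoubleNodes {m t : ℕ} {T : Finset ℕ} (ht : t ∈ T) (h0 : 0 ∉ T) :
    -centred K m t ∈ barDoubleNodes m T ↔ t < m ∧ m - t ∈ T := by
  rw [barDoubleNodes, Finset.mem_inter, Finset.mem_image, Finset.mem_image]
  constructor
  · rintro ⟨⟨u, hu, h⟩, -⟩
    have h' := centred_eq_neg_iff.1 h
    have : u ≠ 0 := fun h => h0 (h ▸ hu)
    refine ⟨by omega, ?_⟩
    rwa [show m - t = u by omega]
  · rintro ⟨h1, h2⟩
    exact ⟨⟨m - t, h2, centred_eq_neg_iff.2 (by omega)⟩, t, ht, rfl⟩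

/-- Every double pole lies at a zero of `∏_{0<s<m} (z - s + m/2)`, hence is effectively simple. -/
theorem barDoubleNodes_subset {m : ℕ} {T : Finset ℕ} (h0 : 0 ∉ T) :
    barDoubleNodes m T ⊆ (Finset.Ico 1 m).image (centred K m) := by
  intro ω hω
  obtain ⟨t, ht, rfl⟩ := Finset.mem_image.1 (Finset.mem_inter.1 hω).1
  have := (centred_mem_barDoubleNodes ht h0).1 hω
  have ht0 : t ≠ 0 := fun h => h0 (h ▸ ht)
  exact Finset.mem_image_of_mem _ (Finset.mem_Ico.2 ⟨by omega, this.1⟩)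

/-- Numerator and denominator are multiplied by the product over the double nodes, which restores
the unreduced fraction. -/
theorem expandAtInfty_barNumerator_div {m : ℕ} {T : Finset ℕ} (h0 : 0 ∉ T) :
    expandAtInfty (barNumerator m T) /
        expandAtInfty (∏ ω ∈ barNodes m T, (Polynomial.X - Polynomial.C ω)) =
      expandAtInfty (Polynomial.C 2 * Polynomial.X *
        ∏ s ∈ Finset.Ico 1 m, (Polynomial.X - Polynomial.C (centred K m s))) *
          (evenQuotient ((m : K) / 2) T : LaurentSeries K) := by
  set P := ∏ ω ∈ barDoubleNodes m T, (Polynomial.X - Polynomial.C (ω : K)) with hP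
  have hP0 : expandAtInfty P ≠ 0 := fun h =>
    (Polynomial.monic_prod_X_sub_C _ _).ne_zero (expandAtInfty_injective (h.trans (map_zero _).symm))
  rw [← expandAtInfty_div_eq_evenQuotient, ← mul_div_mul_right _ _ hP0, ← map_mul, ← map_mul,
    mul_div_assoc', ← map_mul]
  congr 2
  · rw [barNumerator, ← Finset.prod_image (g := centred K m) (s := Finset.Ico 1 m)
      (f := fun ω => Polynomial.X - Polynomial.C ω) (centred_injective m).injOn,
      ← Finset.prod_sdiff (barDoubleNodes_subset h0)]
    ring
  · rw [barNodes, hP, barDoubleNodes, Finset.prod_union_inter,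
      Finset.prod_image (centred_injective m).injOn,
      Finset.prod_image (neg_centred_injective m).injOn, ← Finset.prod_mul_distrib]
    refine Finset.prod_congr rfl fun t _ => ?_
    rw [map_neg, centred, map_pow]
    ring

/-- Rewrites the residue of the reduced fraction through the unreduced products over both families
of nodes; at a double node one zero and one pole are dropped. -/
theorem eval_barNumerator_div {m : ℕ} {T : Finset ℕ} (h0 : 0 ∉ T) (ω : K) :
    (barNumerator m T).eval ω / ∏ ω' ∈ (barNodes m T).erase ω, (ω - ω') =
      2 * ω * (if ω ∈ barDoubleNodes m T then
          ∏ s ∈ ((Finset.Ico 1 m).image (centred K m)).erase ω, (ω - s)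
        else ∏ s ∈ (Finset.Ico 1 m).image (centred K m), (ω - s)) *
        (∏ t ∈ T, (ω ^ 2 - ((t : K) + m / 2) ^ 2)) /
        ((∏ ω' ∈ (T.image (centred K m)).erase ω, (ω - ω')) *
          ∏ ω' ∈ (T.image (fun t => -centred K m t)).erase ω, (ω - ω')) := by
  have hP : ∏ ω' ∈ (barDoubleNodes m T).erase ω, (ω - ω') ≠ 0 :=
    Finset.prod_ne_zero_iff.2 fun ω' h => sub_ne_zero.2 (Finset.ne_of_mem_erase h).symm
  have hD : (∏ ω' ∈ (barNodes m T).erase ω, (ω - ω')) *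
      ∏ ω' ∈ (barDoubleNodes m T).erase ω, (ω - ω') =
      (∏ ω' ∈ (T.image (centred K m)).erase ω, (ω - ω')) *
          ∏ ω' ∈ (T.image (fun t => -centred K m t)).erase ω, (ω - ω') := by
    have hinter : (barDoubleNodes m T).erase ω = (T.image (centred K m)).erase ω ∩
        (T.image (fun t => -centred K m t)).erase ω := by
      ext ω'
      simp only [barDoubleNodes, Finset.mem_erase, Finset.mem_inter]
      tauto
    rw [barNodes, hinter, Finset.erase_union_distrib, Finset.prod_union_inter]
  have hsub := barDoubleNodes_subset (K := K) (m := m) h0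
  have hY : (∏ s ∈ (Finset.Ico 1 m).image (centred K m) \ barDoubleNodes m T, (ω - s)) *
      ∏ ω' ∈ (barDoubleNodes m T).erase ω, (ω - ω') =
      if ω ∈ barDoubleNodes m T then
          ∏ s ∈ ((Finset.Ico 1 m).image (centred K m)).erase ω, (ω - s)
        else ∏ s ∈ (Finset.Ico 1 m).image (centred K m), (ω - s) := by
    split_ifs with h
    · rw [← Finset.prod_sdiff (Finset.erase_subset_erase ω hsub)]
      congr 2
      ext s
      simp only [Finset.mem_sdiff, Finset.mem_erase]
      by_cases hs : s = ω
      · subst hs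
        simp [h]
      · simp [hs]
    · rw [Finset.erase_eq_of_notMem h, Finset.prod_sdiff hsub]
  rw [← mul_div_mul_right _ _ hP, hD, ← hY, barNumerator]
  simp only [Polynomial.eval_mul, Polynomial.eval_prod, Polynomial.eval_sub, Polynomial.eval_pow,
    Polynomial.eval_C, Polynomial.eval_X]
  ring

/-- The contribution of the removal of `m` cells from the row of length `t`. -/
def singleBarTerm (K : Type*) [Field K] (m : ℕ) (T : Finset ℕ) (t : ℕ) : K :=
  (t.descFactorial m : K) * ∏ s ∈ T.erase t,
    (((t : K) - m - s) * (t + s)) / (((t : K) - m + s) * (t - s))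

/-- The contribution of the removal of the rows of lengths `a` and `m - a`. -/
def pairBarTerm (K : Type*) [Field K] (m : ℕ) (T : Finset ℕ) (a : ℕ) : K :=
  (-1 : K) ^ (m - a) * ((a.factorial : K) * ((m - a).factorial : K) * m / (a - (m - a : ℕ))) *
    ∏ s ∈ (T.erase a).erase (m - a),
      (((a : K) + s) * ((m - a : ℕ) + s)) / (((a : K) - s) * ((m - a : ℕ) - s))

/-- The factor `2z` of the numerator cancels the distance from the node to its negative. -/
theorem residue_centred {m : ℕ} (hm : Odd m) {T : Finset ℕ} (h0 : 0 ∉ T) {t : ℕ} (ht : t ∈ T)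
    (hz : ¬(t < m ∧ m - t ∈ T)) :
    (barNumerator m T).eval (centred K m t) /
      ∏ ω' ∈ (barNodes m T).erase (centred K m t), (centred K m t - ω') =
      -(2 * m) * singleBarTerm K m T t := by
  have hy := centred_ne_zero (K := K) hm t
  have hmem : centred K m t ∉ barDoubleNodes m T := fun h =>
    hz ((centred_mem_barDoubleNodes ht h0).1 h)
  have hB : centred K m t ∉ T.image (fun t => -centred K m t) := fun h =>
    hmem (Finset.mem_inter.2 ⟨Finset.mem_image_of_mem _ ht, h⟩)
  rw [eval_barNumerator_div h0, if_neg hmem, Finset.erase_eq_of_notMem hB,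
    ← Finset.image_erase (centred_injective m), Finset.prod_image (centred_injective m).injOn,
    Finset.prod_image (centred_injective m).injOn, Finset.prod_image (neg_centred_injective m).injOn,
    ← Finset.mul_prod_erase T _ ht, ← Finset.mul_prod_erase T _ ht,
    mul_left_comm (∏ x ∈ T.erase t, (centred K m t - centred K m x)),
    ← Finset.prod_mul_distrib, singleBarTerm, cast_descFactorial_eq_prod_Ico t hm.pos,
    Finset.prod_div_distrib]
  have e1 : ∏ s ∈ Finset.Ico 1 m, (centred K m t - centred K m s) =
      ∏ s ∈ Finset.Ico 1 m, ((t : K) - s) :=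
    Finset.prod_congr rfl fun s _ => by rw [centred, centred]; ring
  have e2 : ∏ u ∈ T.erase t, (centred K m t ^ 2 - ((u : K) + m / 2) ^ 2) =
      ∏ s ∈ T.erase t, (((t : K) - m - s) * (t + s)) :=
    Finset.prod_congr rfl fun s _ => by rw [centred]; ring
  have e3 : ∏ u ∈ T.erase t, ((centred K m t - centred K m u) * (centred K m t - -centred K m u)) =
      ∏ s ∈ T.erase t, (((t : K) - m + s) * (t - s)) :=
    Finset.prod_congr rfl fun s _ => by rw [centred, centred]; ring
  have e4 : centred K m t ^ 2 - ((t : K) + m / 2) ^ 2 = -(2 * m) * t := by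
    rw [centred]
    ring
  rw [e1, e2, e3, e4, sub_neg_eq_add, ← two_mul]
  generalize ∏ s ∈ T.erase t, (((t : K) - m + s) * (t - s)) = X
  rw [show ∀ a b c : K, 2 * centred K m t * a * (b * c) = 2 * centred K m t * (a * (b * c)) by
    intros; ring, mul_div_mul_left _ _ (mul_ne_zero two_ne_zero hy)]
  ring

/-- The rational function is odd, so its residues at opposite nodes agree. -/
theorem residue_neg_centred {m : ℕ} (hm : Odd m) {T : Finset ℕ} (h0 : 0 ∉ T) {t : ℕ} (ht : t ∈ T)
    (hz : ¬(t < m ∧ m - t ∈ T)) :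
    (barNumerator m T).eval (-centred K m t) /
      ∏ ω' ∈ (barNodes m T).erase (-centred K m t), (-centred K m t - ω') =
      -(2 * m) * singleBarTerm K m T t := by
  have hy := centred_ne_zero (K := K) hm t
  have hmem : -centred K m t ∉ barDoubleNodes m T := fun h =>
    hz ((neg_centred_mem_barDoubleNodes ht h0).1 h)
  have hB : -centred K m t ∉ T.image (centred K m) := fun h =>
    hmem (Finset.mem_inter.2 ⟨h, Finset.mem_image_of_mem _ ht⟩)
  rw [eval_barNumerator_div h0, if_neg hmem, Finset.erase_eq_of_notMem hB,
    ← Finset.image_erase (neg_centred_injective m), Finset.prod_image (centred_injective m).injOn,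
    Finset.prod_image (centred_injective m).injOn, Finset.prod_image (neg_centred_injective m).injOn,
    ← Finset.mul_prod_erase T _ ht, ← Finset.mul_prod_erase T _ ht, mul_assoc (_ - centred K m t),
    ← Finset.prod_mul_distrib, singleBarTerm, cast_descFactorial_eq_prod_Ico t hm.pos,
    Finset.prod_div_distrib]
  have e1 : ∏ s ∈ Finset.Ico 1 m, (-centred K m t - centred K m s) =
      ∏ s ∈ Finset.Ico 1 m, ((t : K) - s) := by
    -- The substitution `s ↦ m - s` produces `m - 1` signs, an even number.
    have hr := Finset.prod_Ico_reflect (fun s => -centred K m t - centred K m s) 1 (Nat.le_succ m)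
    rw [Nat.add_sub_cancel_left, Nat.add_sub_cancel] at hr
    have : ∀ s ∈ Finset.Ico 1 m, -centred K m t - centred K m (m - s) = -1 * ((t : K) - s) := by
      intro s hs
      rw [centred, centred, Nat.cast_sub (Finset.mem_Ico.1 hs).2.le]
      ring
    rw [← hr, Finset.prod_congr rfl this, Finset.prod_mul_distrib, Finset.prod_const,
      Nat.card_Ico, (Nat.Odd.sub_odd hm odd_one).neg_one_pow, one_mul]
  have e2 : ∏ u ∈ T.erase t, ((-centred K m t) ^ 2 - ((u : K) + m / 2) ^ 2) =
      ∏ s ∈ T.erase t, (((t : K) - m - s) * (t + s)) :=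
    Finset.prod_congr rfl fun s _ => by rw [centred]; ring
  have e3 : ∏ u ∈ T.erase t, ((-centred K m t - centred K m u) *
      (-centred K m t - -centred K m u)) =
      ∏ s ∈ T.erase t, (((t : K) - m + s) * (t - s)) :=
    Finset.prod_congr rfl fun s _ => by rw [centred, centred]; ring
  have e4 : (-centred K m t) ^ 2 - ((t : K) + m / 2) ^ 2 = -(2 * m) * t := by
    rw [centred]
    ring
  rw [e1, e2, e3, e4, show -centred K m t - centred K m t = 2 * -centred K m t by ring]
  generalize ∏ s ∈ T.erase t, (((t : K) - m + s) * (t - s)) = X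
  rw [show ∀ a b c : K, 2 * -centred K m t * a * (b * c) = 2 * -centred K m t * (a * (b * c)) by
    intros; ring, mul_div_mul_left _ _ (mul_ne_zero two_ne_zero (neg_ne_zero.2 hy))]
  ring

/-- At the common node `a - m/2 = -(b - m/2)`, the distances to the other nodes of both families
combine into the factors of the pair term, and the products of consecutive differences give the two
factorials. -/
theorem residue_pair {m : ℕ} (hm : Odd m) {T : Finset ℕ} (h0 : 0 ∉ T) {a : ℕ} (ha : a ∈ T)
    (ham : a < m) (hma : m - a ∈ T) :
    (barNumerator m T).eval (centred K m a) /
      ∏ ω' ∈ (barNodes m T).erase (centred K m a), (centred K m a - ω') =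
      -(4 * m) * pairBarTerm K m T a := by
  have hy := centred_ne_zero (K := K) hm a
  have hmem : centred K m a ∈ barDoubleNodes m T :=
    (centred_mem_barDoubleNodes ha h0).2 ⟨ham, hma⟩
  have ha0 : 0 < a := Nat.pos_of_ne_zero fun h => h0 (h ▸ ha)
  obtain ⟨b, hb⟩ : ∃ b, b = m - a := ⟨_, rfl⟩
  have hb0 : 0 < b := by omega
  have hab : a ≠ b := by
    obtain ⟨r, rfl⟩ := hm
    omega
  have hsum : a + b = m := by omega
  have hneg : centred K m a = -centred K m b := centred_eq_neg_iff.2 hsum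
  have hmK : (m : K) = a + b := by rw [← hsum, Nat.cast_add]
  rw [pairBarTerm, ← hb]
  rw [← hb] at hma
  have hbT : b ∈ T.erase a := Finset.mem_erase.2 ⟨hab.symm, hma⟩
  have haT : a ∈ T.erase b := Finset.mem_erase.2 ⟨hab, ha⟩
  have e1 : ∏ s ∈ (Finset.Ico 1 m).erase a, (centred K m a - centred K m s) =
      ∏ s ∈ (Finset.Ico 1 (a + b)).erase a, ((a : K) - s) := by
    rw [hsum]
    exact Finset.prod_congr rfl fun s _ => by rw [centred, centred]; ring
  have e2 : ∏ t ∈ (T.erase a).erase b, (centred K m a ^ 2 - ((t : K) + m / 2) ^ 2) =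
      (-1) ^ ((T.erase a).erase b).card * ∏ s ∈ (T.erase a).erase b, (((a : K) + s) * (b + s)) := by
    rw [← Finset.prod_const, ← Finset.prod_mul_distrib]
    exact Finset.prod_congr rfl fun s _ => by rw [centred, hmK]; ring
  have e3 : ∏ u ∈ (T.erase a).erase b, ((centred K m a - centred K m u) *
      (centred K m a - -centred K m u)) =
      (-1) ^ ((T.erase a).erase b).card * ∏ s ∈ (T.erase a).erase b, (((a : K) - s) * (b - s)) := by
    rw [← Finset.prod_const, ← Finset.prod_mul_distrib]
    exact Finset.prod_congr rfl fun s _ => by rw [centred, centred, hmK]; ring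
  -- In the negative family the node belongs to `b`, so that factor is omitted while the factor of
  -- `a` remains.
  have hB : ∏ ω' ∈ (T.image (fun t => -centred K m t)).erase (centred K m a),
      (centred K m a - ω') = (centred K m a - -centred K m a) *
        ∏ u ∈ (T.erase a).erase b, (centred K m a - -centred K m u) := by
    conv_lhs => rw [hneg]
    rw [← Finset.image_erase (neg_centred_injective m) T b,
      Finset.prod_image (neg_centred_injective m).injOn, ← hneg, ← Finset.mul_prod_erase _ _ haT,
      Finset.erase_right_comm]
  rw [eval_barNumerator_div h0, if_pos hmem, hB, ← Finset.image_erase (centred_injective m),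
    ← Finset.image_erase (centred_injective m), Finset.prod_image (centred_injective m).injOn,
    Finset.prod_image (centred_injective m).injOn, ← Finset.mul_prod_erase T _ ha,
    ← Finset.mul_prod_erase (T.erase a) _ hbT, ← Finset.mul_prod_erase (T.erase a) _ hbT,
    mul_mul_mul_comm (centred K m a - centred K m b), ← Finset.prod_mul_distrib, e1, e2, e3,
    Finset.prod_div_distrib]
  have hfact := prod_Ico_erase_sub (K := K) ha0 hb0
  have h1 : (-1 : K) ^ ((T.erase a).erase b).card ≠ 0 := pow_ne_zero _ (by norm_num)
  have h2 : (a : K) - b ≠ 0 := sub_ne_zero.2 fun h => hab (Nat.cast_injective h)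
  have hya : 2 * centred K m a = a - b := by rw [centred, hmK]; ring
  rw [show centred K m a - centred K m b = a - b by rw [centred, centred]; ring,
    show centred K m a - -centred K m a = a - b by rw [← hya]; ring, hya,
    show centred K m a ^ 2 - ((a : K) + m / 2) ^ 2 = -(2 * m * a) by rw [centred]; ring,
    show centred K m a ^ 2 - ((b : K) + m / 2) ^ 2 = -(2 * m * b) by rw [centred, hmK]; ring]
  generalize (-1 : K) ^ ((T.erase a).erase b).card = s at *
  generalize ∏ s ∈ (Finset.Ico 1 (a + b)).erase a, ((a : K) - s) = F at *
  generalize ∏ s ∈ (T.erase a).erase b, (((a : K) - s) * (b - s)) = X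
  generalize ∏ s ∈ (T.erase a).erase b, (((a : K) + s) * (b + s)) = Y
  rw [show ((a : K) - b) * F * (-(2 * m * a) * (-(2 * m * b) * (s * Y))) =
    ((a : K) - b) * (s * (4 * m ^ 2 * (a * b * F) * Y)) by ring, hfact,
    show ((a : K) - b) * (a - b) * (s * X) = ((a : K) - b) * (s * ((a - b) * X)) by ring,
    mul_div_mul_left _ _ h2, mul_div_mul_left _ _ h1, div_eq_mul_inv, mul_inv]
  ring

theorem sum_residues_eq_barSum {m : ℕ} (hm : Odd m) {T : Finset ℕ} (h0 : 0 ∉ T) :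
    ∑ ω ∈ barNodes m T, (barNumerator m T).eval ω / ∏ ω' ∈ (barNodes m T).erase ω, (ω - ω') =
      -(4 * m) * barSum K m T := by
  set f : K → K := fun ω =>
    (barNumerator m T).eval ω / ∏ ω' ∈ (barNodes m T).erase ω, (ω - ω') with hf
  set Z := T.filter fun a => a < m ∧ m - a ∈ T with hZ
  have hdouble : barDoubleNodes m T = Z.image (centred K m) := by
    ext ω
    constructor
    · intro h
      obtain ⟨t, ht, rfl⟩ := Finset.mem_image.1 (Finset.mem_inter.1 h).1
      exact Finset.mem_image_of_mem _
        (Finset.mem_filter.2 ⟨ht, (centred_mem_barDoubleNodes ht h0).1 h⟩)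
    · intro h
      obtain ⟨t, ht, rfl⟩ := Finset.mem_image.1 h
      exact (centred_mem_barDoubleNodes (Finset.mem_filter.1 ht).1 h0).2 (Finset.mem_filter.1 ht).2
  -- A double node lies in both families but is a single pole: it has residue `-(4m)` times the pair
  -- term, while an unpaired part contributes `-(2m)` times its term at each of two nodes.
  have hsum := Finset.sum_union_inter (s₁ := T.image (centred K m))
    (s₂ := T.image (fun t => -centred K m t)) (f := f)
  rw [← barNodes, ← barDoubleNodes, hdouble, Finset.sum_image (centred_injective m).injOn,
    Finset.sum_image (centred_injective m).injOn, Finset.sum_image (neg_centred_injective m).injOn,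
    ← Finset.sum_filter_add_sum_filter_not T (fun a => a < m ∧ m - a ∈ T)
      (fun t => f (centred K m t)),
    ← Finset.sum_filter_add_sum_filter_not T (fun a => a < m ∧ m - a ∈ T)
      (fun t => f (-centred K m t)), ← hZ] at hsum
  have hflip : ∑ t ∈ Z, f (-centred K m t) = ∑ t ∈ Z, f (centred K m t) := by
    refine Finset.sum_bij' (fun t _ => m - t) (fun t _ => m - t) ?_ ?_ ?_ ?_ ?_
    · intro t ht
      obtain ⟨h1, h2, h3⟩ := Finset.mem_filter.1 ht
      have : t ≠ 0 := fun h => h0 (h ▸ h1)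
      exact Finset.mem_filter.2 ⟨h3, by omega, by rwa [Nat.sub_sub_self h2.le]⟩
    · intro t ht
      obtain ⟨h1, h2, h3⟩ := Finset.mem_filter.1 ht
      have : t ≠ 0 := fun h => h0 (h ▸ h1)
      exact Finset.mem_filter.2 ⟨h3, by omega, by rwa [Nat.sub_sub_self h2.le]⟩
    · intro t ht
      exact Nat.sub_sub_self (Finset.mem_filter.1 ht).2.1.le
    · intro t ht
      exact Nat.sub_sub_self (Finset.mem_filter.1 ht).2.1.le
    · intro t ht
      rw [centred_eq_neg_iff.2 (Nat.sub_add_cancel (Finset.mem_filter.1 ht).2.1.le)]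
  have h1 : ∑ t ∈ T with ¬(t < m ∧ m - t ∈ T), f (centred K m t) =
      ∑ t ∈ T with ¬(t < m ∧ m - t ∈ T), -(2 * m) * singleBarTerm K m T t :=
    Finset.sum_congr rfl fun t ht =>
      residue_centred hm h0 (Finset.mem_filter.1 ht).1 (Finset.mem_filter.1 ht).2
  have h2 : ∑ t ∈ T with ¬(t < m ∧ m - t ∈ T), f (-centred K m t) =
      ∑ t ∈ T with ¬(t < m ∧ m - t ∈ T), -(2 * m) * singleBarTerm K m T t :=
    Finset.sum_congr rfl fun t ht =>
      residue_neg_centred hm h0 (Finset.mem_filter.1 ht).1 (Finset.mem_filter.1 ht).2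
  have h3 : ∑ t ∈ Z, f (centred K m t) = ∑ t ∈ Z, -(4 * m) * pairBarTerm K m T t :=
    Finset.sum_congr rfl fun t ht =>
      residue_pair hm h0 (Finset.mem_filter.1 ht).1 (Finset.mem_filter.1 ht).2.1
        (Finset.mem_filter.1 ht).2.2
  -- Paired parts are smaller than `m`, so their single-bar terms vanish.
  have h4 : ∑ t ∈ T with ¬(t < m ∧ m - t ∈ T), singleBarTerm K m T t =
      ∑ t ∈ T, singleBarTerm K m T t := by
    refine Finset.sum_filter_of_ne fun t _ hne hz => hne ?_
    rw [singleBarTerm, Nat.descFactorial_eq_zero_iff_lt.2 hz.1, Nat.cast_zero, zero_mul]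
  have h5 : barSum K m T = ∑ t ∈ T, singleBarTerm K m T t + ∑ t ∈ Z, pairBarTerm K m T t := rfl
  rw [hflip, h1, h2, h3, ← Finset.mul_sum, ← Finset.mul_sum, h4] at hsum
  rw [h5]
  linear_combination hsum

/-- The residue formula for the spin character of an `m`-cycle. -/
theorem barSum_eq_coeff {m : ℕ} (hm : Odd m) {T : Finset ℕ} (h0 : 0 ∉ T) :
    -(4 * m) * barSum K m T =
      (expandAtInfty (Polynomial.C 2 * Polynomial.X *
        ∏ s ∈ Finset.Ico 1 m, (Polynomial.X - Polynomial.C (centred K m s))) *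
          (evenQuotient ((m : K) / 2) T : LaurentSeries K)).coeff 1 := by
  rw [← sum_residues_eq_barSum hm h0, ← coeff_one_div_eq_sum, expandAtInfty_barNumerator_div h0]

end BarResidue

end

/-! ### Newton recursion for the coefficients of the even quotient -/

noncomputable section

section LogDerivative

variable {K : Type*} [Field K]

/-- The logarithmic derivative `u f' / f` of `f = 1 - c² u²`. -/
def evenLogDeriv (c : K) : PowerSeries K :=
  PowerSeries.mk fun n => if n ≠ 0 ∧ Even n then -2 * c ^ n else 0

/-- The geometric series for `-2c²u² / (1 - c²u²)`, with the denominator cleared. -/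
theorem X_mul_derivative_one_sub (c : K) :
    PowerSeries.X * PowerSeries.derivative K (1 - PowerSeries.C (c ^ 2) * PowerSeries.X ^ 2) =
      (1 - PowerSeries.C (c ^ 2) * PowerSeries.X ^ 2) * evenLogDeriv c := by
  ext n
  rw [sub_mul, one_mul, map_sub (PowerSeries.coeff n), mul_assoc, PowerSeries.coeff_C_mul,
    PowerSeries.coeff_X_pow_mul', evenLogDeriv, PowerSeries.coeff_mk, PowerSeries.coeff_mk]
  rcases n with _ | n
  · simp
  · rw [PowerSeries.coeff_succ_X_mul, PowerSeries.coeff_derivative, map_sub,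
      PowerSeries.coeff_C_mul, PowerSeries.coeff_X_pow, PowerSeries.coeff_one,
      if_neg (Nat.succ_ne_zero n)]
    rcases n with _ | n
    · simp
    · have h2 : 2 ≤ n + 1 + 1 := by omega
      rw [if_pos h2, show n + 1 + 1 - 2 = n by omega]
      rcases n with _ | n
      · simp
        ring
      · have : Even (n + 1 + 1 + 1) ↔ Even (n + 1) := by simp [Nat.even_add_one]
        simp only [this]
        rw [if_neg (by omega)]
        by_cases he : Even (n + 1)
        · simp [he]
          ring
        · simp [he]

theorem X_mul_derivative_evenQuotient (h : K) (T : Finset ℕ) :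
    PowerSeries.X * PowerSeries.derivative K (evenQuotient h T) =
      evenQuotient h T * ∑ t ∈ T, (evenLogDeriv ((t : K) + h) - evenLogDeriv ((t : K) - h)) := by
  induction T using Finset.induction_on with
  | empty => simp [evenQuotient]
  | insert t T ht ih =>
    rw [evenQuotient, Finset.prod_insert ht, ← evenQuotient, Finset.sum_insert ht]
    have ha := X_mul_derivative_one_sub ((t : K) + h)
    have hb := X_mul_derivative_one_sub ((t : K) - h)
    have hinv : (1 - PowerSeries.C (((t : K) - h) ^ 2) * PowerSeries.X ^ 2 : PowerSeries K) *
      (1 - PowerSeries.C (((t : K) - h) ^ 2) * PowerSeries.X ^ 2)⁻¹ = 1 :=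
      PowerSeries.mul_inv_cancel _ (by simp)
    generalize (1 - PowerSeries.C (((t : K) + h) ^ 2) * PowerSeries.X ^ 2 : PowerSeries K) = a at *
    generalize (1 - PowerSeries.C (((t : K) - h) ^ 2) * PowerSeries.X ^ 2 : PowerSeries K) = b at *
    rw [Derivation.leibniz, Derivation.leibniz, PowerSeries.derivative_inv']
    simp only [smul_eq_mul]
    linear_combination (a * b⁻¹) * ih + (evenQuotient h T * b⁻¹) * ha -
      (evenQuotient h T * a * b⁻¹ ^ 2) * hb -
      (evenQuotient h T * a * b⁻¹ * evenLogDeriv ((t : K) - h)) * hinv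

/-- Coefficients of `u E' = E · (u E' / E)`, in which the logarithmic derivative is additive over
the factors of `E`. -/
theorem coeff_evenQuotient_recursion (h : K) (T : Finset ℕ) (n : ℕ) :
    (n : K) * PowerSeries.coeff n (evenQuotient h T) =
      ∑ p ∈ Finset.HasAntidiagonal.antidiagonal n, PowerSeries.coeff p.1 (evenQuotient h T) *
        if p.2 ≠ 0 ∧ Even p.2 then -2 * ∑ t ∈ T, (((t : K) + h) ^ p.2 - ((t : K) - h) ^ p.2)
        else 0 := by
  have h1 := congrArg (PowerSeries.coeff n) (X_mul_derivative_evenQuotient h T)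
  rw [PowerSeries.coeff_mul _ (evenQuotient h T)] at h1
  have h2 : PowerSeries.coeff n (PowerSeries.X * PowerSeries.derivative K (evenQuotient h T)) =
      (n : K) * PowerSeries.coeff n (evenQuotient h T) := by
    rcases n with _ | n
    · simp
    · rw [PowerSeries.coeff_succ_X_mul, PowerSeries.coeff_derivative]
      push_cast
      ring
  rw [← h2, h1]
  refine Finset.sum_congr rfl fun p _ => ?_
  rw [map_sum]
  simp only [map_sub, evenLogDeriv, PowerSeries.coeff_mk]
  split_ifs
  · congr 1
    rw [Finset.mul_sum]
    exact Finset.sum_congr rfl fun t _ => by ring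
  · simp

theorem coeff_zero_evenQuotient (h : K) (T : Finset ℕ) :
    PowerSeries.coeff 0 (evenQuotient h T) = 1 := by
  rw [PowerSeries.coeff_zero_eq_constantCoeff_apply, evenQuotient, map_prod]
  exact Finset.prod_eq_one fun t _ => by simp

variable [CharZero K]

theorem coeff_odd_evenQuotient (h : K) (T : Finset ℕ) {n : ℕ} (hn : Odd n) :
    PowerSeries.coeff n (evenQuotient h T) = 0 := by
  induction n using Nat.strong_induction_on with
  | _ n ih =>
    have hrec := coeff_evenQuotient_recursion h T n
    rw [Finset.sum_eq_zero] at hrec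
    · exact (mul_eq_zero.1 hrec).resolve_left (Nat.cast_ne_zero.2 hn.pos.ne')
    · intro p hp
      have hp' := Finset.HasAntidiagonal.mem_antidiagonal.1 hp
      split_ifs with h2
      · have hodd : Odd p.1 := by
          rw [← hp'] at hn
          exact (Nat.odd_add.1 hn).2 h2.2
        rw [ih p.1 (by omega) hodd, zero_mul]
      · rw [mul_zero]

/-- For `m = 1` both the residue formula and the recursion reduce to degree `2`. This is the
recursion for the weights under removing a cell, and it drives the expansion of `p_1^n`. -/
theorem barSum_one {T : Finset ℕ} (h0 : 0 ∉ T) : barSum K 1 T = ((∑ t ∈ T, t : ℕ) : K) := by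
  classical
  have h := barSum_eq_coeff (K := K) (m := 1) odd_one h0
  have hrec := coeff_evenQuotient_recursion ((1 : K) / 2) T 2
  rw [Finset.Ico_self, Finset.prod_empty, mul_one, coeff_one_expandAtInfty_mul,
    Polynomial.natDegree_C_mul_X _ two_ne_zero, Finset.sum_range_succ, Finset.sum_range_one] at h
  simp only [Polynomial.coeff_C_mul_X, Nat.cast_one] at h
  rw [if_neg (by norm_num), if_pos trivial, zero_mul, zero_add] at h
  have hanti : Finset.HasAntidiagonal.antidiagonal 2 = {(0, 2), (1, 1), (2, 0)} := rfl
  rw [hanti, Finset.sum_insert (by decide), Finset.sum_insert (by decide), Finset.sum_singleton,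
    if_pos (by decide), if_neg (by decide), if_neg (by decide), coeff_zero_evenQuotient] at hrec
  have hsum : ∑ t ∈ T, (((t : K) + 1 / 2) ^ 2 - ((t : K) - 1 / 2) ^ 2) = 2 * ∑ t ∈ T, (t : K) := by
    rw [Finset.mul_sum]
    exact Finset.sum_congr rfl fun t _ => by ring
  rw [hsum] at hrec
  push_cast at hrec ⊢
  have h4 : (4 : K) ≠ 0 := by norm_num
  refine mul_left_cancel₀ h4 ?_
  linear_combination -h - hrec

end LogDerivative

/-! ### Triangularity in the odd power sums -/

section PowerSumAlgebra

theorem add_pow_sub_sub_pow {R : Type*} [CommRing R] (t h : R) (j : ℕ) :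
    (t + h) ^ (2 * j + 2) - (t - h) ^ (2 * j + 2) =
      ∑ i ∈ Finset.range (j + 1),
        (2 * h ^ (2 * (j - i) + 1) * ((2 * j + 2).choose (2 * i + 1) : R)) * t ^ (2 * i + 1) := by
  have hsplit : ∀ (N : ℕ) (f : ℕ → R), ∑ k ∈ Finset.range (2 * N + 1), f k =
      ∑ i ∈ Finset.range N, f (2 * i + 1) + ∑ i ∈ Finset.range (N + 1), f (2 * i) := by
    intro N f
    induction N with
    | zero => simp
    | succ N ih =>
      rw [Finset.sum_range_succ _ (N + 1), Finset.sum_range_succ _ N,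
        show 2 * (N + 1) + 1 = 2 * N + 1 + 1 + 1 by ring, Finset.sum_range_succ,
        Finset.sum_range_succ, ih]
      ring_nf
  rw [sub_eq_add_neg t h, add_pow, add_pow, ← Finset.sum_sub_distrib,
    show 2 * j + 2 + 1 = 2 * (j + 1) + 1 by ring, hsplit]
  rw [add_eq_left.2]
  · refine Finset.sum_congr rfl fun i hi => ?_
    have := Finset.mem_range.1 hi
    rw [show 2 * j + 2 - (2 * i + 1) = 2 * (j - i) + 1 by omega, Odd.neg_pow (odd_two_mul_add_one _)]
    ring
  · refine Finset.sum_eq_zero fun i _ => ?_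
    rw [show 2 * j + 2 - 2 * i = 2 * (j + 1 - i) by omega, Even.neg_pow (even_two_mul _), sub_self]

variable {ι : Type*} (T : ι → Finset ℕ)

/-- The odd power sums of the parts, as functions of the strict partition. -/
def oddPowerSum (j : ℕ) : ι → ℝ := fun i => ∑ t ∈ T i, (t : ℝ) ^ (2 * j + 1)

/-- The algebra of functions generated by the first `n` odd power sums. -/
def powerSumAlgebra (n : ℕ) : Subalgebra ℚ (ι → ℝ) :=
  Algebra.adjoin ℚ (oddPowerSum T '' {j | j < n})

theorem powerSumAlgebra_mono {n n' : ℕ} (h : n ≤ n') :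
    powerSumAlgebra T n ≤ powerSumAlgebra T n' :=
  Algebra.adjoin_mono (Set.image_mono fun _ hj => lt_of_lt_of_le hj h)

theorem oddPowerSum_mem {j n : ℕ} (h : j < n) : oddPowerSum T j ∈ powerSumAlgebra T n :=
  Algebra.subset_adjoin ⟨j, h, rfl⟩

/-- In the binomial expansion only odd powers of `t` survive, and the top one has coefficient `2h(2j
+ 2)`. -/
theorem sum_pow_sub_mem (h : ℚ) (j : ℕ) :
    (fun i => ∑ t ∈ T i, (((t : ℝ) + h) ^ (2 * j + 2) - ((t : ℝ) - h) ^ (2 * j + 2))) -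
      (4 * h * (j + 1)) • oddPowerSum T j ∈ powerSumAlgebra T j := by
  have heq : (fun i => ∑ t ∈ T i, (((t : ℝ) + h) ^ (2 * j + 2) - ((t : ℝ) - h) ^ (2 * j + 2))) -
      (4 * h * (j + 1)) • oddPowerSum T j = ∑ i ∈ Finset.range j,
        (2 * h ^ (2 * (j - i) + 1) * ((2 * j + 2).choose (2 * i + 1) : ℚ)) • oddPowerSum T i := by
    funext i
    simp only [Pi.sub_apply, Finset.sum_apply, Pi.smul_apply, oddPowerSum, add_pow_sub_sub_pow]
    rw [Finset.sum_comm, Finset.sum_range_succ, Nat.sub_self, mul_zero, zero_add, pow_one,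
      show 2 * j + 2 = 2 * j + 1 + 1 by ring, Nat.choose_succ_self_right, ← Finset.mul_sum,
      Rat.smul_def, add_sub_assoc]
    rw [add_eq_left.2]
    · refine Finset.sum_congr rfl fun k _ => ?_
      rw [← Finset.mul_sum, Rat.smul_def]
      push_cast
      ring
    · push_cast
      ring
  rw [heq]
  exact Subalgebra.sum_mem _ fun i hi =>
    Subalgebra.smul_mem _ (oddPowerSum_mem T (Finset.mem_range.1 hi)) _

/-- In the recursion only the term with the constant coefficient reaches the power sum of index `n`.
Its coefficient there is `-8h(n + 1)`, and division by `2n + 2` leaves `-4h`. -/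
theorem coeff_evenQuotient_mem (h : ℚ) (n : ℕ) :
    (fun i => PowerSeries.coeff (2 * n + 2) (evenQuotient (h : ℝ) (T i))) +
      (4 * h) • oddPowerSum T n ∈ powerSumAlgebra T n := by
  induction n using Nat.strong_induction_on with
  | _ n ih =>
    set e : ℕ → ι → ℝ := fun k i => PowerSeries.coeff k (evenQuotient (h : ℝ) (T i)) with he
    set l : ℕ → ι → ℝ := fun k i => if k ≠ 0 ∧ Even k then
      -2 * ∑ t ∈ T i, (((t : ℝ) + h) ^ k - ((t : ℝ) - h) ^ k) else 0 with hl
    have hl' : ∀ j, l (2 * j + 2) + (8 * h * (j + 1)) • oddPowerSum T j ∈ powerSumAlgebra T j := by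
      intro j
      have h1 := Subalgebra.smul_mem _ (sum_pow_sub_mem T h j) (-2 : ℚ)
      convert h1 using 1
      funext i
      simp only [hl, Pi.add_apply, Pi.smul_apply, Pi.sub_apply, Rat.smul_def]
      rw [if_pos ⟨by omega, by simp [Nat.even_add]⟩]
      push_cast
      ring
    have hrec : ((2 * n + 2 : ℕ) : ℚ) • e (2 * n + 2) = l (2 * n + 2) +
        ∑ p ∈ (Finset.HasAntidiagonal.antidiagonal (2 * n + 2)).erase (0, 2 * n + 2), e p.1 * l p.2 := by
      have h0 : e 0 = 1 := by
        funext i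
        exact coeff_zero_evenQuotient _ _
      have h1 : l (2 * n + 2) = e 0 * l (2 * n + 2) := by rw [h0, one_mul]
      rw [h1, Finset.add_sum_erase (Finset.HasAntidiagonal.antidiagonal (2 * n + 2)) (fun p => e p.1 * l p.2)
        (a := (0, 2 * n + 2)) (by simp)]
      funext i
      have := coeff_evenQuotient_recursion (h : ℝ) (T i) (2 * n + 2)
      simp only [Pi.smul_apply, Finset.sum_apply, Pi.mul_apply, Rat.smul_def]
      rw [Rat.cast_natCast]
      exact this
    have hrest : ∑ p ∈ (Finset.HasAntidiagonal.antidiagonal (2 * n + 2)).erase (0, 2 * n + 2), e p.1 * l p.2 ∈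
        powerSumAlgebra T n := by
      refine Subalgebra.sum_mem _ fun p hp => ?_
      obtain ⟨hne, hp⟩ := Finset.mem_erase.1 hp
      have hp' := Finset.HasAntidiagonal.mem_antidiagonal.1 hp
      by_cases hb : p.2 ≠ 0 ∧ Even p.2
      · obtain ⟨c, hc⟩ := hb.2
        obtain ⟨j, hj⟩ : ∃ j, p.2 = 2 * j + 2 := ⟨c - 1, by omega⟩
        have hp1 : p.1 ≠ 0 := by
          intro h0
          apply hne
          ext
          · exact h0
          · simp only
            omega
        obtain ⟨k, hk⟩ : ∃ k, p.1 = 2 * k + 2 := ⟨n - j - 1, by omega⟩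
        have hkn : k < n := by omega
        have hjn : j < n := by omega
        refine Subalgebra.mul_mem _ ?_ ?_
        · rw [hk]
          have h1 := powerSumAlgebra_mono T hkn.le (ih k hkn)
          have h2 := Subalgebra.smul_mem _ (oddPowerSum_mem T hkn) (4 * h)
          have h3 := Subalgebra.sub_mem _ h1 h2
          rwa [add_sub_cancel_right] at h3
        · rw [hj]
          have h1 := powerSumAlgebra_mono T hjn.le (hl' j)
          have h2 := Subalgebra.smul_mem _ (oddPowerSum_mem T hjn) (8 * h * (j + 1))
          have h3 := Subalgebra.sub_mem _ h1 h2
          rwa [add_sub_cancel_right] at h3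
      · have : l p.2 = 0 := by
          funext i
          exact if_neg hb
        rw [this, mul_zero]
        exact Subalgebra.zero_mem _
    have h1 := Subalgebra.smul_mem _ (Subalgebra.add_mem _ (hl' n) hrest) (((2 * n + 2 : ℕ) : ℚ)⁻¹)
    convert h1 using 1
    have hn : ((2 * n + 2 : ℕ) : ℚ) ≠ 0 := Nat.cast_ne_zero.2 (by omega)
    rw [show l (2 * n + 2) + (8 * h * (n + 1)) • oddPowerSum T n +
      ∑ p ∈ (Finset.HasAntidiagonal.antidiagonal (2 * n + 2)).erase (0, 2 * n + 2), e p.1 * l p.2 =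
      ((2 * n + 2 : ℕ) : ℚ) • e (2 * n + 2) + (8 * h * (n + 1)) • oddPowerSum T n by
        rw [hrec]; abel, smul_add, smul_smul, inv_mul_cancel₀ hn, one_smul, smul_smul]
    congr 2
    push_cast at hn ⊢
    field_simp
    ring

theorem coeff_evenQuotient_mem_of_lt (h : ℚ) {k n : ℕ} (hk : k < 2 * n + 2) :
    (fun i => PowerSeries.coeff k (evenQuotient (h : ℝ) (T i))) ∈ powerSumAlgebra T n := by
  rcases Nat.even_or_odd k with ⟨c, hc⟩ | hodd
  · rcases Nat.eq_zero_or_pos k with rfl | hpos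
    · convert Subalgebra.one_mem (powerSumAlgebra T n) using 1
      funext i
      exact coeff_zero_evenQuotient _ _
    · obtain ⟨j, rfl⟩ : ∃ j, k = 2 * j + 2 := ⟨c - 1, by omega⟩
      have hjn : j < n := by omega
      have h1 := powerSumAlgebra_mono T hjn.le (coeff_evenQuotient_mem T h j)
      have h2 := Subalgebra.smul_mem _ (oddPowerSum_mem T hjn) (4 * h)
      have h3 := Subalgebra.sub_mem _ h1 h2
      rwa [add_sub_cancel_right] at h3
  · convert Subalgebra.zero_mem (powerSumAlgebra T n) using 1
    funext i
    exact coeff_odd_evenQuotient _ _ hodd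

end PowerSumAlgebra

end

/-! ### Moments of the transition measure -/

noncomputable section

section Moments

theorem coe_toMul_sum {ι L : Type*} [Field L] (s : Finset ι) (f : ι → Additive Lˣ) :
    ((Additive.toMul (∑ i ∈ s, f i) : Lˣ) : L) = ∏ i ∈ s, ((Additive.toMul (f i) : Lˣ) : L) := by
  classical
  induction s using Finset.induction_on with
  | empty => simp
  | insert i s hi ih => rw [Finset.sum_insert hi, Finset.prod_insert hi, toMul_add, Units.val_mul, ih]

/-- The identity `sum_symMinima_sub_sum_symMaxima`, valid in any abelian group, is applied to the
units of the Laurent series field written additively: corners between consecutive parts cancel, so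
all parts may be treated independently. -/
theorem expandAtInfty_symMaxima_div_symMinima (S : Finset ℕ) (hS : 0 ∉ S) :
    expandAtInfty (∏ y ∈ symMaxima S, (Polynomial.X - Polynomial.C y)) /
        expandAtInfty (∏ x ∈ symMinima S, (Polynomial.X - Polynomial.C x)) =
      (expandAtInfty Polynomial.X)⁻¹ * (evenQuotient (-1 / 2 : ℝ) S : LaurentSeries ℝ) := by
  have hne : ∀ x : ℝ, expandAtInfty (Polynomial.X - Polynomial.C x) ≠ 0 := fun x h =>
    Polynomial.X_sub_C_ne_zero x (expandAtInfty_injective (h.trans (map_zero _).symm))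
  have h := sum_symMinima_sub_sum_symMaxima S hS (fun x =>
    Additive.ofMul (Units.mk0 (expandAtInfty (Polynomial.X - Polynomial.C x)) (hne x)))
  have h2 := congrArg (fun g => ((Additive.toMul g : (LaurentSeries ℝ)ˣ) : LaurentSeries ℝ)) h
  simp only [toMul_sub, coe_toMul_sum, toMul_ofMul, toMul_add, Units.val_div_eq_div_val,
    Units.val_mk0, Units.val_mul, map_zero, sub_zero] at h2
  rw [← expandAtInfty_div_eq_evenQuotient, ← inv_inj, inv_div, map_prod, map_prod, h2, mul_inv,
    inv_inv, inv_div, map_prod, map_prod, ← Finset.prod_div_distrib]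
  congr 1
  refine Finset.prod_congr rfl fun t _ => ?_
  rw [← map_mul, div_div, ← map_mul]
  congr 2
  · rw [map_neg, map_pow, show (t : ℝ) - -1 / 2 = t + 1 / 2 by ring]
    ring
  · rw [map_neg, map_pow, show (t : ℝ) + -1 / 2 = t - 1 / 2 by ring]
    ring

/-- The `k`-th moment is the sum of the residues of `z^k` times the Cauchy transform, and for `k ≥
1` the factor `z⁻¹` of the latter is absorbed by `z^k`. -/
theorem integral_pow_symTransitionMeasure {n : ℕ} (lam : StrictPartition n) {k : ℕ} (hk : k ≠ 0) :
    ∫ x, x ^ k ∂(symTransitionMeasure lam) =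
      PowerSeries.coeff k (evenQuotient (-1 / 2 : ℝ) lam.partSet) := by
  obtain ⟨k, rfl⟩ := Nat.exists_eq_succ_of_ne_zero hk
  have hX : expandAtInfty (Polynomial.X : Polynomial ℝ) ≠ 0 := fun h =>
    Polynomial.X_ne_zero (expandAtInfty_injective (h.trans (map_zero _).symm))
  have h := coeff_one_div_eq_sum
    (Polynomial.X ^ (k + 1) * ∏ y ∈ symMaxima lam.partSet, (Polynomial.X - Polynomial.C y))
    (symMinima lam.partSet)
  rw [map_mul, mul_div_assoc, expandAtInfty_symMaxima_div_symMinima _ lam.zero_notMem_partSet,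
    pow_succ, map_mul, ← mul_assoc, mul_assoc (expandAtInfty (Polynomial.X ^ k)),
    mul_inv_cancel₀ hX, mul_one, coeff_one_expandAtInfty_mul, Polynomial.natDegree_X_pow,
    Finset.sum_eq_single k] at h
  · rw [Polynomial.coeff_X_pow_self, one_mul] at h
    rw [symTransitionMeasure, integral_transitionMeasure _ lam.zero_notMem_partSet, Nat.succ_eq_add_one,
      h]
    refine Finset.sum_congr rfl fun x _ => ?_
    simp only [Polynomial.eval_mul, Polynomial.eval_pow, Polynomial.eval_X, Polynomial.eval_prod,
      Polynomial.eval_sub, Polynomial.eval_C, smul_eq_mul]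
    ring
  · intro j _ hj
    rw [Polynomial.coeff_X_pow, if_neg hj, zero_mul]
  · simp

end Moments

/-! ### Free cumulants and bar sums in terms of odd power sums -/

section FreeCumulants

/-- A partition of a set of odd size has a block of odd size. -/
theorem freeCumulantOfMoments_odd {M : ℕ → ℝ} (hM : ∀ n, Odd n → M n = 0) {n : ℕ} (hn : Odd n) :
    freeCumulantOfMoments M n = 0 := by
  classical
  induction n using Nat.strong_induction_on with
  | _ n ih =>
    rw [freeCumulantOfMoments, hM n hn, zero_sub, neg_eq_zero]
    refine Finset.sum_eq_zero fun π _ => ?_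
    obtain ⟨B, hB, hodd⟩ : ∃ B ∈ π.1.parts, Odd B.card := by
      by_contra! h
      have hsum := π.1.sum_card_parts
      rw [Finset.card_univ, Fintype.card_fin] at hsum
      refine Nat.not_even_iff_odd.2 hn ?_
      rw [← hsum]
      exact Finset.even_sum _ fun B hB => Nat.not_odd_iff_even.1 (h B hB)
    exact Finset.prod_eq_zero (Finset.mem_univ ⟨B, hB⟩) (ih _ (π.2.2 B hB) hodd)

/-- The correction from moments to cumulants involves only cumulants of smaller order, hence only
lower power sums. -/
theorem freeCumulantOfMoments_mem {ι : Type*} {T : ι → Finset ℕ} {M : ι → ℕ → ℝ}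
    (hodd : ∀ i n, Odd n → M i n = 0)
    (heven : ∀ n, (fun i => M i (2 * n + 2)) - (2 : ℚ) • oddPowerSum T n ∈ powerSumAlgebra T n)
    (n : ℕ) :
    (fun i => freeCumulantOfMoments (M i) (2 * n + 2)) - (2 : ℚ) • oddPowerSum T n ∈
      powerSumAlgebra T n := by
  classical
  induction n using Nat.strong_induction_on with
  | _ n ih =>
    have hsplit : (fun i => freeCumulantOfMoments (M i) (2 * n + 2)) =
        (fun i => M i (2 * n + 2)) -
        ∑ π : {π : Finpartition (Finset.univ : Finset (Fin (2 * n + 2))) //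
            IsNoncrossing π ∧ ∀ B ∈ π.parts, B.card < 2 * n + 2},
          ∏ B : {B // B ∈ π.1.parts}, fun i => freeCumulantOfMoments (M i) B.1.card := by
      funext i
      rw [freeCumulantOfMoments]
      simp only [Pi.sub_apply, Finset.sum_apply, Finset.prod_apply]
    rw [hsplit, sub_right_comm]
    refine Subalgebra.sub_mem _ (heven n) (Subalgebra.sum_mem _ fun π _ =>
      Subalgebra.prod_mem _ fun B _ => ?_)
    have hlt := π.2.2 B.1 B.2
    have hpos : 0 < B.1.card := Finset.card_pos.2 (π.1.nonempty_of_mem_parts B.2)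
    rcases Nat.even_or_odd B.1.card with ⟨c, hc⟩ | ho
    · obtain ⟨j, hj⟩ : ∃ j, B.1.card = 2 * j + 2 := ⟨c - 1, by omega⟩
      rw [hj]
      have hjn : j < n := by omega
      have h1 := powerSumAlgebra_mono T hjn.le (ih j hjn)
      have h2 := Subalgebra.smul_mem _ (oddPowerSum_mem T hjn) (2 : ℚ)
      have h3 := Subalgebra.add_mem _ h1 h2
      rwa [sub_add_cancel] at h3
    · convert Subalgebra.zero_mem (powerSumAlgebra T n) using 1
      funext i
      exact freeCumulantOfMoments_odd (hodd i) ho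

/-- The set of parts of a strict partition of unspecified size. -/
def allPartSets (i : Σ n, StrictPartition n) : Finset ℕ := i.2.partSet

/-- At `h = -1/2` the leading coefficient `-4h` is `2`, and the factor `1/2` in `symR` normalizes it
to `1`. -/
theorem symR_mem (n : ℕ) :
    (fun i : Σ n, StrictPartition n => symR (2 * (n + 1)) i.2) - oddPowerSum allPartSets n ∈
      powerSumAlgebra allPartSets n := by
  have h := freeCumulantOfMoments_mem (T := allPartSets)
    (M := fun i k => ∫ x, x ^ k ∂(symTransitionMeasure i.2)) (fun i k hk => by
      rw [integral_pow_symTransitionMeasure _ hk.pos.ne']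
      exact coeff_odd_evenQuotient _ _ hk) (fun k => by
      have h1 := coeff_evenQuotient_mem allPartSets (-1 / 2) k
      convert h1 using 1
      rw [sub_eq_add_neg, ← neg_smul]
      congr 1
      · funext i
        rw [integral_pow_symTransitionMeasure _ (by omega)]
        push_cast
        rfl
      · norm_num) n
  have h2 := Subalgebra.smul_mem _ h (1 / 2 : ℚ)
  convert h2 using 1
  rw [smul_sub, smul_smul]
  congr 1
  · funext i
    simp only [symR, freeCumulant, Pi.smul_apply, Rat.smul_def]
    push_cast
    rw [show 2 * (n + 1) = 2 * n + 2 by ring]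
    ring
  · norm_num

/-- Inverts the unitriangular system of `symR_mem`. -/
theorem powerSumAlgebra_le_adjoin_symR (n : ℕ) :
    powerSumAlgebra allPartSets n ≤ Algebra.adjoin ℚ (Set.range fun j : Fin n =>
      fun i : Σ n, StrictPartition n => symR (2 * ((j : ℕ) + 1)) i.2) := by
  induction n with
  | zero =>
    refine Algebra.adjoin_le ?_
    rintro _ ⟨j, hj, rfl⟩
    exact absurd hj (Nat.not_lt_zero j)
  | succ n ih =>
    have hmono : Algebra.adjoin ℚ (Set.range fun j : Fin n =>
        fun i : Σ n, StrictPartition n => symR (2 * ((j : ℕ) + 1)) i.2) ≤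
        Algebra.adjoin ℚ (Set.range fun j : Fin (n + 1) =>
          fun i : Σ n, StrictPartition n => symR (2 * ((j : ℕ) + 1)) i.2) := by
      refine Algebra.adjoin_mono ?_
      rintro _ ⟨j, rfl⟩
      exact ⟨j.castSucc, rfl⟩
    refine Algebra.adjoin_le ?_
    rintro _ ⟨j, hj, rfl⟩
    rcases Nat.lt_succ_iff_lt_or_eq.1 hj with hlt | rfl
    · exact hmono (ih (oddPowerSum_mem _ hlt))
    · have h1 := hmono (ih (symR_mem j))
      have h2 : (fun i : Σ n, StrictPartition n => symR (2 * (j + 1)) i.2) ∈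
          Algebra.adjoin ℚ (Set.range fun j : Fin (j + 1) =>
            fun i : Σ n, StrictPartition n => symR (2 * ((j : ℕ) + 1)) i.2) :=
        Algebra.subset_adjoin ⟨Fin.last j, rfl⟩
      have h3 := Subalgebra.sub_mem _ h2 h1
      rwa [sub_sub_cancel] at h3

/-- In the residue formula the polynomial has degree `m = 2n + 1` and leading coefficient `2`, so
with `h = m/2` the top term is `2 · (-4h) = -4m` times the power sum, matching the prefactor of
`barSum`. -/
theorem barSum_mem (n : ℕ) :
    (fun i : Σ n, StrictPartition n => barSum ℝ (2 * n + 1) i.2.partSet) -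
      oddPowerSum allPartSets n ∈ powerSumAlgebra allPartSets n := by
  have hm : Odd (2 * n + 1) := odd_two_mul_add_one n
  -- Taken over `ℚ`, so that its coefficients act as scalars on the `ℚ`-algebra of power sums.
  obtain ⟨p, hp⟩ : ∃ p : Polynomial ℚ, p = Polynomial.C 2 * Polynomial.X *
    ∏ s ∈ Finset.Ico 1 (2 * n + 1), (Polynomial.X - Polynomial.C (centred ℚ (2 * n + 1) s)) :=
    ⟨_, rfl⟩
  have hmap : p.map (algebraMap ℚ ℝ) = Polynomial.C 2 * Polynomial.X *
      ∏ s ∈ Finset.Ico 1 (2 * n + 1),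
        (Polynomial.X - Polynomial.C (centred ℝ (2 * n + 1) s)) := by
    rw [hp]
    simp [Polynomial.map_prod, centred]
  have hmonic : (∏ s ∈ Finset.Ico 1 (2 * n + 1),
      (Polynomial.X - Polynomial.C (centred ℚ (2 * n + 1) s))).Monic :=
    Polynomial.monic_prod_X_sub_C _ _
  have hprod : (∏ s ∈ Finset.Ico 1 (2 * n + 1),
      (Polynomial.X - Polynomial.C (centred ℚ (2 * n + 1) s))).natDegree = 2 * n := by
    rw [Polynomial.natDegree_prod_of_monic _ _ fun s _ => Polynomial.monic_X_sub_C _]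
    simp
  have hdeg : p.natDegree = 2 * n + 1 := by
    rw [hp, Polynomial.natDegree_mul (by simp) hmonic.ne_zero,
      Polynomial.natDegree_C_mul_X _ two_ne_zero, hprod]
    ring
  have hlead : p.coeff (2 * n + 1) = 2 := by
    rw [← hdeg, Polynomial.coeff_natDegree, hp, Polynomial.leadingCoeff_mul, hmonic.leadingCoeff]
    simp
  set e : ℕ → (Σ n, StrictPartition n) → ℝ := fun k i =>
    PowerSeries.coeff k (evenQuotient ((((2 * n + 1 : ℕ) / 2 : ℚ)) : ℝ) (allPartSets i)) with he
  have hbar : (-(4 * (2 * n + 1 : ℕ)) : ℚ) • (fun i : Σ n, StrictPartition n =>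
      barSum ℝ (2 * n + 1) i.2.partSet) =
      ∑ j ∈ Finset.range (2 * n + 1), p.coeff j • e (j + 1) + (2 : ℚ) • e (2 * n + 2) := by
    funext i
    classical
    have h1 := barSum_eq_coeff (K := ℝ) hm i.2.zero_notMem_partSet
    rw [← hmap, coeff_one_expandAtInfty_mul,
      Polynomial.natDegree_map_eq_of_injective (algebraMap ℚ ℝ).injective, hdeg,
      Finset.sum_range_succ] at h1
    simp only [Polynomial.coeff_map, hlead] at h1
    simp only [Pi.smul_apply, Pi.add_apply, Finset.sum_apply, Rat.smul_def, he, allPartSets]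
    push_cast at h1 ⊢
    rw [h1]
    simp
  have hmem1 : ∑ j ∈ Finset.range (2 * n + 1), p.coeff j • e (j + 1) ∈
      powerSumAlgebra allPartSets n :=
    Subalgebra.sum_mem _ fun j hj => Subalgebra.smul_mem _ (coeff_evenQuotient_mem_of_lt _ _
      (by have := Finset.mem_range.1 hj; omega)) _
  have hmem2 := Subalgebra.smul_mem _
    (coeff_evenQuotient_mem allPartSets ((2 * n + 1 : ℕ) / 2 : ℚ) n) (2 : ℚ)
  have hmem3 := Subalgebra.smul_mem _ (Subalgebra.add_mem _ hmem1 hmem2)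
    ((-(4 * (2 * n + 1 : ℕ)) : ℚ)⁻¹)
  have hne : (-(4 * (2 * n + 1 : ℕ)) : ℚ) ≠ 0 :=
    neg_ne_zero.2 (mul_ne_zero (by norm_num) (Nat.cast_ne_zero.2 (by omega)))
  convert hmem3 using 1
  rw [smul_add (2 : ℚ), ← add_assoc, ← hbar, smul_add, smul_smul, inv_mul_cancel₀ hne, one_smul,
    smul_smul, smul_smul, sub_eq_add_neg]
  congr 1
  rw [← neg_one_smul ℚ]
  congr 1
  field_simp

end FreeCumulants

end

/-! ### Identification of the spin character with the bar sum -/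

noncomputable section

theorem map_shiftedWeight {K L : Type*} [Field K] [Field L] (f : K →+* L) (S : Finset ℕ) :
    f (shiftedWeight K S) = shiftedWeight L S := by
  simp [shiftedWeight, apply_ite f]

theorem map_barSum {K L : Type*} [Field K] [Field L] (f : K →+* L) (m : ℕ) (T : Finset ℕ) :
    f (barSum K m T) = barSum L m T := by
  simp [barSum]

/-- Matches the convention that the spin character is `0` when the cycle is longer than `n`. -/
theorem barSum_eq_zero {K : Type*} [Field K] {m : ℕ} (hm : Odd m) {T : Finset ℕ}
    (h : ∑ t ∈ T, t < m) : barSum K m T = 0 := by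
  rw [barSum, Finset.sum_eq_zero, zero_add, Finset.sum_eq_zero]
  · intro a ha
    obtain ⟨h1, h2, h3⟩ := Finset.mem_filter.1 ha
    have hne : m - a ≠ a := by
      obtain ⟨r, rfl⟩ := hm
      omega
    have e1 := Finset.add_sum_erase T (fun t => t) h1
    have e2 := Finset.single_le_sum (f := fun t => t) (fun _ _ => Nat.zero_le _)
      (Finset.mem_erase.2 ⟨hne, h3⟩)
    omega
  · intro t ht
    have e := Finset.single_le_sum (f := fun t => t) (fun _ _ => Nat.zero_le _) ht
    rw [Nat.descFactorial_eq_zero_iff_lt.2 (lt_of_le_of_lt e h), Nat.cast_zero, zero_mul]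

section PowerSums

variable (N : ℕ)

theorem algebraMap_psum (m : ℕ) :
    algebraMap (MvPolynomial (Fin N) ℚ) (FractionRing (MvPolynomial (Fin N) ℚ))
      (MvPolynomial.psum (Fin N) ℚ m) = psumFn (schurVar N) m Finset.univ := by
  simp [MvPolynomial.psum, psumFn, schurVar]

/-- Each further factor `p_1` multiplies the weight of `S` by `barSum` at `m = 1`, which is the size
of `S`. -/
theorem psumFn_one_pow (n : ℕ) :
    psumFn (schurVar N) 1 ^ n = (n.factorial : FractionRing (MvPolynomial (Fin N) ℚ)) •
      ∑ S ∈ strictSets n, shiftedWeight (FractionRing (MvPolynomial (Fin N) ℚ)) S •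
        schurFn (schurVar N) S := by
  induction n with
  | zero =>
    have : strictSets 0 = {∅} := by
      ext S
      rw [mem_strictSets, Finset.mem_singleton]
      constructor
      · rintro ⟨h0, h⟩
        refine Finset.eq_empty_of_forall_notMem fun s hs => h0 ?_
        have := Finset.sum_eq_zero_iff.1 h s hs
        exact this ▸ hs
      · rintro rfl
        simp
    rw [this, Finset.sum_singleton, schurFn_empty, shiftedWeight]
    simp
  | succ n ih =>
    rw [pow_succ', ih, mul_smul_comm, psumFn_mul_sum_shiftedWeight (schurVar_injective N)
      (fun i j => schurVar_add_ne_zero) odd_one, Nat.factorial_succ, Nat.cast_mul, mul_comm, mul_smul,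
      Finset.smul_sum (r := ((n + 1 : ℕ) : FractionRing (MvPolynomial (Fin N) ℚ)))]
    congr 1
    refine Finset.sum_congr rfl fun S hS => ?_
    obtain ⟨h0, hsum⟩ := mem_strictSets.1 hS
    rw [barSum_one h0, hsum, smul_smul, mul_comm]

theorem sum_strictPartition_schurP {n : ℕ} (c : Finset ℕ → ℚ) :
    ∑ lam : StrictPartition n, algebraMap ℚ (FractionRing (MvPolynomial (Fin N) ℚ))
        (c lam.partSet) * schurP lam N =
      (∑ S ∈ strictSets n, algebraMap ℚ (FractionRing (MvPolynomial (Fin N) ℚ)) (c S) •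
        schurFn (schurVar N) S) Finset.univ := by
  rw [Finset.sum_apply, ← StrictPartition.sum_eq_sum_strictSets]
  refine Finset.sum_congr rfl fun lam _ => ?_
  rw [schurP_eq_schurFn, Pi.smul_apply, smul_eq_mul]

end PowerSums

theorem isSchurPExpansion_ones (n : ℕ) :
    IsSchurPExpansion (padOnes (Nat.Partition.indiscrete 0) (Nat.zero_le n))
      fun lam => n.factorial * shiftedWeight ℚ lam.partSet := by
  intro N
  rw [sum_strictPartition_schurP N (fun S => n.factorial * shiftedWeight ℚ S),
    MvPolynomial.psumPart, padOnes]
  simp only [Nat.Partition.partition_zero_parts, zero_add, Multiset.map_replicate,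
    Multiset.prod_replicate, tsub_zero, map_pow, algebraMap_psum, map_mul, map_natCast,
    map_shiftedWeight]
  rw [← Pi.pow_apply, psumFn_one_pow, Finset.smul_sum]
  simp only [smul_smul]

theorem isSchurPExpansion_cycle {m n : ℕ} (hm : Odd m) (h : m ≤ n) :
    IsSchurPExpansion (padOnes (Nat.Partition.indiscrete m) h)
      fun lam => (n - m).factorial * (shiftedWeight ℚ lam.partSet * barSum ℚ m lam.partSet) := by
  intro N
  rw [sum_strictPartition_schurP N
    (fun S => (n - m).factorial * (shiftedWeight ℚ S * barSum ℚ m S)),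
    MvPolynomial.psumPart, padOnes]
  simp only [Nat.Partition.indiscrete_parts hm.pos.ne', Multiset.map_add, Multiset.map_singleton,
    Multiset.prod_add, Multiset.prod_singleton, Multiset.map_replicate,
    Multiset.prod_replicate, map_pow, algebraMap_psum, map_mul, map_natCast,
    map_shiftedWeight, map_barSum]
  rw [← Pi.pow_apply, ← Pi.mul_apply, psumFn_one_pow, mul_smul_comm,
    psumFn_mul_sum_shiftedWeight (schurVar_injective N) (fun i j => schurVar_add_ne_zero) hm,
    Finset.smul_sum, Nat.sub_add_cancel h]
  simp only [smul_smul]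

/-- The spin character of an odd cycle as a sum over the removals of a bar. -/
theorem spinCharacter_indiscrete {m n : ℕ} (hm : Odd m) (lam : StrictPartition n) :
    spinCharacter (Nat.Partition.indiscrete m) lam = barSum ℚ m lam.partSet := by
  rw [spinCharacter]
  split_ifs with h
  · rw [spinG, spinX_eq (isSchurPExpansion_cycle hm h), spinX_eq (isSchurPExpansion_ones n),
      ← Nat.factorial_mul_descFactorial h]
    have h1 : shiftedWeight ℚ lam.partSet ≠ 0 := shiftedWeight_ne_zero
    have h2 : ((n - m).factorial : ℚ) ≠ 0 := Nat.cast_ne_zero.2 (Nat.factorial_ne_zero _)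
    have h3 : (n.descFactorial m : ℚ) ≠ 0 :=
      Nat.cast_ne_zero.2 fun h0 => (Nat.descFactorial_eq_zero_iff_lt.1 h0).not_ge h
    push_cast
    field_simp
  · rw [barSum_eq_zero hm]
    rw [lam.sum_partSet]
    exact not_le.1 h

end

theorem mainTheorem6 (k : ℕ) (hk : 1 ≤ k) :
    ∃ Q : MvPolynomial (Fin (k - 1)) ℚ,
      ∀ (n : ℕ) (lam : StrictPartition n),
        (spinCharacter (Nat.Partition.indiscrete (2 * k - 1)) lam : ℝ) =
          symR (2 * k) lam +
            MvPolynomial.aeval (fun j : Fin (k - 1) => symR (2 * ((j : ℕ) + 1)) lam) Q := by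
  obtain ⟨k, rfl⟩ := Nat.exists_eq_add_of_le' hk
  rw [Nat.add_sub_cancel, show 2 * (k + 1) - 1 = 2 * k + 1 by omega]
  -- Both functions have the same leading term `oddPowerSum allPartSets k`, so their difference lies
  -- in the algebra of the lower power sums.
  have h := powerSumAlgebra_le_adjoin_symR k (Subalgebra.sub_mem _ (barSum_mem k) (symR_mem k))
  rw [sub_sub_sub_cancel_right, Algebra.adjoin_range_eq_range_aeval] at h
  obtain ⟨Q, hQ⟩ := h
  replace hQ : MvPolynomial.aeval (fun (j : Fin k) (i : Σ n, StrictPartition n) =>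
    symR (2 * ((j : ℕ) + 1)) i.2) Q = _ := hQ
  refine ⟨Q, fun n lam => ?_⟩
  -- The identity between functions on all strict partitions is evaluated at `λ`; `Q` was chosen
  -- before `λ`.
  have hQ' := congrArg (Pi.evalAlgHom ℚ (fun _ : Σ n, StrictPartition n => ℝ) ⟨n, lam⟩) hQ
  rw [← AlgHom.comp_apply, MvPolynomial.comp_aeval] at hQ'
  simp only [Pi.evalAlgHom_apply, Pi.sub_apply] at hQ'
  have hcast : ((barSum ℚ (2 * k + 1) lam.partSet : ℚ) : ℝ) = barSum ℝ (2 * k + 1) lam.partSet :=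
    map_barSum (algebraMap ℚ ℝ) _ _
  rw [spinCharacter_indiscrete (odd_two_mul_add_one k), hcast, hQ']
  ring
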